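/- Theorem 6. For integers $m\ge 3$, $l\ge 0$ let $G(m,l)$ be the set of $l$-dissections of a regular $m$-gon, i.e. of sets of $l$ pairwise non-crossing diagonals, and let the dihedral group $D_{2m}$ act on $G(m,l)$ through its action on the vertices. Put $A^m_l=|G(m,l)|$ if $m\ge 3$ and $l$ are integers with $0\le l\le m-3$, put $A^2_0=1$, and put $A^m_l=0$ for all other rational $m,l$. Let $\varphi$ be Euler's totient function. For integers $N,k,t\ge 0$ put $$S_t(N,k)=\sum\ \prod_{s=0}^{t}\left(A^{n_s+1}_{k_s-1}+A^{n_s+1}_{k_s}\right),$$ the sum being over all integers $n_0,\dots,n_t\ge 1$ and $k_0,\dots,k_t\ge 0$ with $n_0+\dots+n_t=N$, $k_0+\dots+k_t=(k-t)/2$ and $k_s\le n_s-1$ for every $s$. Let $1\le k\le n-3$, and put $$R(n,k)=\sum_{3\le d\mid n}\frac{\varphi(d)}{2d}A^{n/d+1}_{k/d-1}+\sum_{2\le d\le n/3}\frac{\varphi(d)(n+k-d)}{2dn}A^{n/d}_{k/d-1}+\sum\frac{\varphi(d)}{2dr}\prod_{i=1}^{r}A^{n_i+1}_{k_i},$$ where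 the last sum is over all divisors $d\ge 2$ of $n$, all $r\ge 3$, and all integers $n_1,\dots,n_r\ge 1$, $k_1,\dots,k_r\ge 0$ with $n_1+\dots+n_r=n/d$ and $k_1+\dots+k_r+|\{i:n_i\ge 2\}|=k/d$. The number $|G(n,k)/D_{2n}|$ of $k$-dissections of a regular $n$-gon modulo the dihedral action is, if $n$ is even, $$\frac1{2n}A^n_k+\frac12A^{n/2+1}_{(k-1)/2}+\frac14A^{n/2+1}_{k/2}+R(n,k)+\frac14\sum_{t=1}^{k}S_t\left(\tfrac n2,k\right)+\frac14\sum_{t=0}^{k}S_t\left(\tfrac n2-1,k\right),$$ and, if $n$ is odd, $$\frac1{2n}A^n_k+R(n,k)+\frac12\sum_{t=0}^{k}S_t\left(\tfrac{n-1}2,k\right).$$ -/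

import Mathlib

namespace PolygonDissection

/-- A side of the `n`-gon with cyclically labelled vertices `ZMod n` joins cyclically consecutive
vertices; a diagonal joins two distinct vertices that are not cyclically consecutive. -/
def IsDiagonal {n : ℕ} (e : Sym2 (ZMod n)) : Prop :=
  ∃ a b : ZMod n, e = s(a, b) ∧ a ≠ b ∧ b ≠ a + 1 ∧ a ≠ b + 1

/-- With the vertices read as `0, …, n - 1`, the diagonals `e = ab` and `f = cd` satisfy
`a < c < b < d` for a suitable order of their endpoints. The diagonals cross if and only if
`Crosses e f` or `Crosses f e`. -/
def Crosses {n : ℕ} (e f : Sym2 (ZMod n)) : Prop :=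
  ∃ a b c d : ZMod n, e = s(a, b) ∧ f = s(c, d) ∧
    a.val < c.val ∧ c.val < b.val ∧ b.val < d.val

/-- `E` is a set of `k` pairwise non-crossing diagonals of the `n`-gon. -/
def IsDissection {n : ℕ} (k : ℕ) (E : Finset (Sym2 (ZMod n))) : Prop :=
  E.card = k ∧ (∀ e ∈ E, IsDiagonal e) ∧ ∀ e ∈ E, ∀ f ∈ E, ¬ Crosses e f

/-- The type `G(n,k)` of `k`-dissections of the `n`-gon. -/
def Dissection (n k : ℕ) : Type := {E : Finset (Sym2 (ZMod n)) // IsDissection k E}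

/-- The dihedral group acting on the vertices of the `n`-gon: `r i` is the rotation `v ↦ v + i`,
and `sr i` is the reflection `v ↦ -(v + i)`. -/
def vertexAction (n : ℕ) : DihedralGroup n →* Equiv.Perm (ZMod n) where
  toFun g := match g with
    | .r i => Equiv.addRight i
    | .sr i => (Equiv.addRight i).trans (Equiv.neg (ZMod n))
  map_one' := by
    ext v
    change v + 0 = v
    simp
  map_mul' := by
    rintro (i | i) (j | j) <;> refine Equiv.ext fun v => ?_
    · change v + (i + j) = v + j + i
      ring
    · change -(v + (j - i)) = -(v + j) + i
      ring
    · change -(v + (i + j)) = -(v + j + i)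
      ring
    · change v + (j - i) = -(-(v + j) + i)
      ring

theorem val_add_cases {n : ℕ} [NeZero n] (a i : ZMod n) :
    ((a + i).val = a.val + i.val ∧ a.val + i.val < n) ∨
      ((a + i).val + n = a.val + i.val ∧ n ≤ a.val + i.val) := by
  rcases lt_or_ge (a.val + i.val) n with h | h
  · exact Or.inl ⟨ZMod.val_add_of_lt h, h⟩
  · exact Or.inr ⟨(ZMod.val_add_val_of_le h).symm, h⟩

theorem val_neg_cases {n : ℕ} [NeZero n] (a : ZMod n) :
    (a.val = 0 ∧ (-a).val = 0) ∨ (0 < a.val ∧ (-a).val + a.val = n) := by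
  have hlt := ZMod.val_lt a
  by_cases h : a = 0
  · left
    simp [h]
  · right
    have h0 : a.val ≠ 0 := fun h' => h ((ZMod.val_eq_zero a).1 h')
    rw [ZMod.neg_val, if_neg h]
    omega

theorem Crosses.add {n : ℕ} [NeZero n] {e f : Sym2 (ZMod n)} (h : Crosses e f) (i : ZMod n) :
    Crosses (e.map (· + i)) (f.map (· + i)) ∨ Crosses (f.map (· + i)) (e.map (· + i)) := by
  obtain ⟨a, b, c, d, rfl, rfl, h1, h2, h3⟩ := h
  have ha := val_add_cases a i
  have hb := val_add_cases b i
  have hc := val_add_cases c i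
  have hd := val_add_cases d i
  have la := ZMod.val_lt (a + i)
  have lb := ZMod.val_lt (b + i)
  have lc := ZMod.val_lt (c + i)
  have ld := ZMod.val_lt (d + i)
  have l := ZMod.val_lt i
  have l' := ZMod.val_lt d
  simp only [Sym2.map_mk]
  have key : ((a + i).val < (c + i).val ∧ (c + i).val < (b + i).val ∧ (b + i).val < (d + i).val) ∨
      ((d + i).val < (a + i).val ∧ (a + i).val < (c + i).val ∧ (c + i).val < (b + i).val) ∨
      ((b + i).val < (d + i).val ∧ (d + i).val < (a + i).val ∧ (a + i).val < (c + i).val) ∨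
      ((c + i).val < (b + i).val ∧ (b + i).val < (d + i).val ∧ (d + i).val < (a + i).val) := by
    omega
  rcases key with k | k | k | k
  · exact Or.inl ⟨a + i, b + i, c + i, d + i, rfl, rfl, k⟩
  · exact Or.inr ⟨d + i, c + i, a + i, b + i, Sym2.eq_swap, rfl, k⟩
  · exact Or.inl ⟨b + i, a + i, d + i, c + i, Sym2.eq_swap, Sym2.eq_swap, k⟩
  · exact Or.inr ⟨c + i, d + i, b + i, a + i, rfl, Sym2.eq_swap, k⟩

theorem Crosses.neg {n : ℕ} [NeZero n] {e f : Sym2 (ZMod n)} (h : Crosses e f) :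
    Crosses (e.map (- ·)) (f.map (- ·)) ∨ Crosses (f.map (- ·)) (e.map (- ·)) := by
  obtain ⟨a, b, c, d, rfl, rfl, h1, h2, h3⟩ := h
  have ha := val_neg_cases a
  have hb := val_neg_cases b
  have hc := val_neg_cases c
  have hd := val_neg_cases d
  have l' := ZMod.val_lt d
  simp only [Sym2.map_mk]
  have key : ((-a).val < (-d).val ∧ (-d).val < (-b).val ∧ (-b).val < (-c).val) ∨
      ((-d).val < (-b).val ∧ (-b).val < (-c).val ∧ (-c).val < (-a).val) := by
    omega
  rcases key with k | k
  · exact Or.inl ⟨-a, -b, -d, -c, rfl, Sym2.eq_swap, k⟩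
  · exact Or.inr ⟨-d, -c, -b, -a, Sym2.eq_swap, Sym2.eq_swap, k⟩

theorem Crosses.vertexAction {n : ℕ} [NeZero n] {e f : Sym2 (ZMod n)} (h : Crosses e f)
    (g : DihedralGroup n) :
    Crosses (e.map (vertexAction n g)) (f.map (vertexAction n g)) ∨
      Crosses (f.map (vertexAction n g)) (e.map (vertexAction n g)) := by
  rcases g with i | i
  · exact h.add i
  · have hm : ∀ x : Sym2 (ZMod n),
        x.map (PolygonDissection.vertexAction n (.sr i)) = (x.map (· + i)).map (- ·) := fun x => by
      rw [Sym2.map_map]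
      rfl
    rw [hm e, hm f]
    rcases h.add i with h' | h'
    · exact h'.neg
    · exact h'.neg.symm

theorem IsDiagonal.vertexAction {n : ℕ} {e : Sym2 (ZMod n)} (h : IsDiagonal e)
    (g : DihedralGroup n) : IsDiagonal (e.map (vertexAction n g)) := by
  obtain ⟨a, b, rfl, h1, h2, h3⟩ := h
  rcases g with i | i
  · refine ⟨a + i, b + i, rfl, fun h => h1 (add_right_cancel h), fun h => h2 ?_, fun h => h3 ?_⟩
    · exact add_right_cancel (b := i) (by rw [h]; ring)
    · exact add_right_cancel (b := i) (by rw [h]; ring)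
  · refine ⟨-(a + i), -(b + i), rfl, fun h => h1 (add_right_cancel (neg_inj.1 h)),
      fun h => h3 ?_, fun h => h2 ?_⟩
    · linear_combination h
    · linear_combination h

theorem map_vertexAction_mul {n : ℕ} (g h : DihedralGroup n) (e : Sym2 (ZMod n)) :
    e.map (vertexAction n (g * h)) = (e.map (vertexAction n h)).map (vertexAction n g) := by
  rw [Sym2.map_map, map_mul]
  rfl

theorem map_vertexAction_one {n : ℕ} (e : Sym2 (ZMod n)) :
    e.map (vertexAction n 1) = e := by
  rw [map_one]
  exact congrFun Sym2.map_id e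

theorem IsDissection.vertexAction {n k : ℕ} [NeZero n] {E : Finset (Sym2 (ZMod n))}
    (h : IsDissection k E) (g : DihedralGroup n) :
    IsDissection k (E.image (Sym2.map (vertexAction n g))) := by
  obtain ⟨h1, h2, h3⟩ := h
  refine ⟨?_, ?_, ?_⟩
  · rw [Finset.card_image_of_injective _ (Sym2.map.injective (Equiv.injective _)), h1]
  · intro e he
    obtain ⟨e', he', rfl⟩ := Finset.mem_image.1 he
    exact (h2 e' he').vertexAction g
  · intro e he f hf hc
    obtain ⟨e', he', rfl⟩ := Finset.mem_image.1 he
    obtain ⟨f', hf', rfl⟩ := Finset.mem_image.1 hf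
    have := hc.vertexAction g⁻¹
    simp only [← map_vertexAction_mul, inv_mul_cancel, map_vertexAction_one] at this
    exact this.elim (h3 e' he' f' hf') (h3 f' hf' e' he')

/-- The dihedral group acts on the `k`-dissections of the `n`-gon by moving the vertices. -/
instance instMulAction (n k : ℕ) [NeZero n] : MulAction (DihedralGroup n) (Dissection n k) where
  smul g Φ := ⟨Φ.1.image (Sym2.map (vertexAction n g)), Φ.2.vertexAction g⟩
  one_smul Φ := by
    refine Subtype.ext ?_
    change Φ.1.image (Sym2.map (vertexAction n 1)) = Φ.1
    rw [show Sym2.map (vertexAction n 1) = id from funext map_vertexAction_one, Finset.image_id]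
  mul_smul g h Φ := by
    refine Subtype.ext ?_
    change Φ.1.image (Sym2.map (vertexAction n (g * h))) =
      (Φ.1.image (Sym2.map (vertexAction n h))).image (Sym2.map (vertexAction n g))
    rw [Finset.image_image]
    exact Finset.image_congr fun e _ => map_vertexAction_mul g h e

/-- `|G(n,k)/D_{2n}|`, the number of orbits of the dihedral group on `k`-dissections. -/
noncomputable def numDihedralClasses (n k : ℕ) [NeZero n] : ℕ :=
  Nat.card (MulAction.orbitRel.Quotient (DihedralGroup n) (Dissection n k))

/-- `A^m_l`: the number `|G(m,l)|` of `l`-dissections of an `m`-gon if `m` and `l` are integers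
with `0 ≤ l ≤ m - 3`; `A^2_0 = 1` for the trivial dissection of the digon; and `0` for all other
rational `m` and `l`. -/
noncomputable def A (m l : ℚ) : ℚ :=
  if m = 2 ∧ l = 0 then 1
  else if m = ⌊m⌋₊ ∧ l = ⌊l⌋₊ ∧ l ≤ m - 3 then (Nat.card (Dissection ⌊m⌋₊ ⌊l⌋₊) : ℚ)
  else 0

/-- The sequences `(n_1, …, n_r; k_1, …, k_r)` with `n_i ≥ 1` and `k_i ≥ 0` integers such that
`n_1 + ⋯ + n_r = n / d` and `k_1 + ⋯ + k_r + |{i : n_i ≥ 2}| = k / d`. -/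
def markedIndex (n k d r : ℕ) : Finset ((Fin r → ℕ) × (Fin r → ℕ)) :=
  (Fintype.piFinset (fun _ => Finset.Icc 1 n) ×ˢ
    Fintype.piFinset (fun _ => Finset.Icc 0 k)).filter fun p =>
      d * ∑ i, p.1 i = n ∧
      d * (∑ i, p.2 i + (Finset.univ.filter fun i => 2 ≤ p.1 i).card) = k

/-- The sequences `(n_0, …, n_t; k_0, …, k_t)` with `n_s ≥ 1` and `0 ≤ k_s ≤ n_s - 1` integers such
that `n_0 + ⋯ + n_t = N` and `k_0 + ⋯ + k_t = (k - t) / 2`. -/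
def axialIndex (N k t : ℕ) : Finset ((Fin (t + 1) → ℕ) × (Fin (t + 1) → ℕ)) :=
  (Fintype.piFinset (fun _ => Finset.Icc 1 N) ×ˢ
    Fintype.piFinset (fun _ => Finset.Icc 0 k)).filter fun p =>
      (∀ s, p.2 s + 1 ≤ p.1 s) ∧ ∑ s, p.1 s = N ∧ 2 * ∑ s, p.2 s + t = k

/-- The sum over `axialIndex N k t` of `∏_{s=0}^t (A^{n_s+1}_{k_s-1} + A^{n_s+1}_{k_s})`. -/
noncomputable def axialSum (N k t : ℕ) : ℚ :=
  ∑ p ∈ axialIndex N k t,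
    ∏ s, (A ((p.1 s : ℚ) + 1) ((p.2 s : ℚ) - 1) + A ((p.1 s : ℚ) + 1) (p.2 s : ℚ))

end PolygonDissection

/-! The count is Burnside's lemma (`numDihedralClasses_eq`), so everything reduces to counting
dissections fixed by a rotation or by a reflection. In both cases an invariant dissection is encoded
by its restriction to a fundamental interval of vertices. That restriction is a non-crossing arc
system on a segment `[0, N]`, possibly with some marked uncovered points, as in `IsCut`. Cutting the
segment at the marked points gives independent blocks (`cutNumber_eq_sum`). A block of length `m`,
after removal of its root arc `(0, m)` if present, is a dissection of an `(m + 1)`-gon; this is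
where the factors `A^{m+1}_l` come from.

Rotation of order `d`, with `n = d * M`: call a vertex exposed if no diagonal spanning at most `M`
sides cuts it off. Exposed vertices exist, and they are the vertices of the central polygon; a
diameter counts as a central digon. Giving each exposed vertex weight `1 / |exposed|` and rotating
one of them to `0` reduces the count to arc systems on `[0, M]` (`card_rotFixed_eq_sum`). A system
with `r` free interior points has `d * (r + 1)` exposed vertices and so weight `M / (r + 1)`. All
free points are used as cuts, so each block of length at least `2` contains its root arc. One block
gives the first sum of `R(n, k)`, and three or more blocks give the third. Two blocks amount to an
`M`-gon dissection with a marked oriented side or diagonal issuing from `0`, which double counting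
evaluates in closed form (`cutNumber_true_one`); this gives the second sum. For `d = 2` the diameter
is its own image under the half-turn, so the one-block case occurs only for odd `k` and gives a
separate term.

Reflection `v ↦ c - v`: up to conjugation by rotations only `c = n` and `c = n - 1` matter, and for
odd `n` one of them suffices. The arcs on `[0, c / 2]` together with the starting points of the
symmetric chords determine the dissection (`IsDissection.double_eq`). Here the cut points are an
arbitrary set of uncovered points, so a block may or may not contain its root arc, whence the
factors `A_{k-1} + A_k`. If `c = n` is even, the root arc of the whole segment lies on the axis and
is counted once instead of twice; hence that case is split off. -/

namespace PolygonDissection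

/-! ### Arc systems on a segment, cut points, and concatenation -/

/-- `Q` is a set of pairwise non-crossing arcs `(i, j)`, `i + 2 ≤ j`, on the points `0, …, m`. -/
def IsArcSystem (m : ℕ) (Q : Finset (ℕ × ℕ)) : Prop :=
  (∀ e ∈ Q, e.1 + 2 ≤ e.2 ∧ e.2 ≤ m) ∧
    ∀ e ∈ Q, ∀ f ∈ Q, ¬ (e.1 < f.1 ∧ f.1 < e.2 ∧ e.2 < f.2)

/-- The point `x` lies strictly below an arc of `Q`. -/
def Covers (Q : Finset (ℕ × ℕ)) (x : ℕ) : Prop := ∃ e ∈ Q, e.1 < x ∧ x < e.2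

/-- `P` is a set of interior points of `[0, N]` that are not covered by the arc system `Q`; if `β`
holds, then it is the set of all such points. -/
structure IsCut (β : Prop) (N : ℕ) (P : Finset ℕ) (Q : Finset (ℕ × ℕ)) : Prop where
  pos : ∀ p ∈ P, 0 < p
  lt : ∀ p ∈ P, p < N
  arcs : IsArcSystem N Q
  free : ∀ p ∈ P, ¬ Covers Q p
  full : β → ∀ x, 0 < x → x < N → x ∉ P → Covers Q x

open Classical in
/-- The pairs `(P, Q)` with `IsCut β N P Q`, `|P| = r` and `|Q| = K`. -/
noncomputable def cuts (β : Prop) (r N K : ℕ) : Finset (Finset ℕ × Finset (ℕ × ℕ)) :=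
  ((Finset.range N).powerset ×ˢ
    (Finset.range (N + 1) ×ˢ Finset.range (N + 1)).powerset).filter fun z =>
      IsCut β N z.1 z.2 ∧ z.1.card = r ∧ z.2.card = K

theorem IsArcSystem.subset {m : ℕ} {Q : Finset (ℕ × ℕ)} (h : IsArcSystem m Q) :
    Q ⊆ Finset.range (m + 1) ×ˢ Finset.range (m + 1) := fun e he => by
  have := h.1 e he
  simp only [Finset.mem_product, Finset.mem_range]
  omega

theorem mem_cuts {β : Prop} {r N K : ℕ} {z : Finset ℕ × Finset (ℕ × ℕ)} :
    z ∈ cuts β r N K ↔ IsCut β N z.1 z.2 ∧ z.1.card = r ∧ z.2.card = K := by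
  classical
  rw [cuts, Finset.mem_filter, and_iff_right_iff_imp]
  intro h
  rw [Finset.mem_product, Finset.mem_powerset, Finset.mem_powerset]
  exact ⟨fun p hp => Finset.mem_range.2 (h.1.lt p hp), h.1.arcs.subset⟩

/-- Translation of arcs by `p`. -/
def arcShift (p : ℕ) : ℕ × ℕ ↪ ℕ × ℕ :=
  ⟨fun e => (e.1 + p, e.2 + p), fun e f h => by
    simp only [Prod.mk.injEq, add_left_inj] at h
    exact Prod.ext h.1 h.2⟩

@[simp] theorem arcShift_apply (p : ℕ) (e : ℕ × ℕ) : arcShift p e = (e.1 + p, e.2 + p) := rfl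

/-- The concatenation of an arc system on `[0, p]` and one on `[0, m]`. -/
def glueArcs (p : ℕ) (Q₁ Q₂ : Finset (ℕ × ℕ)) : Finset (ℕ × ℕ) := Q₁ ∪ Q₂.map (arcShift p)

/-- The cut points of a concatenation. -/
def gluePoints (p : ℕ) (P : Finset ℕ) : Finset ℕ := insert p (P.map (addRightEmbedding p))

/-- The part of `Q` to the right of `p`. -/
noncomputable def rightArcs (p : ℕ) (Q : Finset (ℕ × ℕ)) : Finset (ℕ × ℕ) :=
  Q.preimage (arcShift p) (arcShift p).injective.injOn

/-- The points to the right of `p`. -/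
noncomputable def rightPoints (p : ℕ) (P : Finset ℕ) : Finset ℕ :=
  (P.preimage (addRightEmbedding p) (addRightEmbedding p).injective.injOn).erase 0

theorem mem_glueArcs {p : ℕ} {Q₁ Q₂ : Finset (ℕ × ℕ)} {e : ℕ × ℕ} :
    e ∈ glueArcs p Q₁ Q₂ ↔ e ∈ Q₁ ∨ ∃ f ∈ Q₂, e.1 = f.1 + p ∧ e.2 = f.2 + p := by
  simp only [glueArcs, Finset.mem_union, Finset.mem_map, arcShift_apply]
  refine or_congr Iff.rfl (exists_congr fun f => and_congr_right fun _ => ?_)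
  rw [Prod.ext_iff]
  exact and_congr eq_comm eq_comm

theorem mem_gluePoints {p x : ℕ} {P : Finset ℕ} :
    x ∈ gluePoints p P ↔ x = p ∨ ∃ y ∈ P, x = y + p := by
  simp only [gluePoints, Finset.mem_insert, Finset.mem_map, addRightEmbedding_apply]
  exact or_congr Iff.rfl (exists_congr fun f => and_congr_right fun _ => eq_comm)

theorem mem_rightArcs {p : ℕ} {Q : Finset (ℕ × ℕ)} {e : ℕ × ℕ} :
    e ∈ rightArcs p Q ↔ (e.1 + p, e.2 + p) ∈ Q := by
  simp [rightArcs]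

theorem mem_rightPoints {p x : ℕ} {P : Finset ℕ} :
    x ∈ rightPoints p P ↔ x ≠ 0 ∧ x + p ∈ P := by
  simp [rightPoints]

theorem IsCut.glue {β : Prop} {p m : ℕ} {P : Finset ℕ} {Q₁ Q₂ : Finset (ℕ × ℕ)}
    (h₁ : IsCut β p ∅ Q₁) (h₂ : IsCut β m P Q₂) (hp : 0 < p) (hm : 0 < m) :
    IsCut β (p + m) (gluePoints p P) (glueArcs p Q₁ Q₂) where
  pos x hx := by
    rcases mem_gluePoints.1 hx with rfl | ⟨y, hy, rfl⟩ <;> omega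
  lt x hx := by
    rcases mem_gluePoints.1 hx with rfl | ⟨y, hy, rfl⟩
    · omega
    · have := h₂.lt y hy
      omega
  arcs := by
    refine ⟨fun e he => ?_, fun e he f hf hc => ?_⟩
    · rcases mem_glueArcs.1 he with he | ⟨e', he', h, h'⟩
      · have := h₁.arcs.1 e he
        omega
      · have := h₂.arcs.1 e' he'
        omega
    · rcases mem_glueArcs.1 he with he | ⟨e', he', h, h'⟩ <;>
        rcases mem_glueArcs.1 hf with hf | ⟨f', hf', g, g'⟩
      · exact h₁.arcs.2 e he f hf hc
      · have := h₁.arcs.1 e he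
        omega
      · have := h₁.arcs.1 f hf
        omega
      · exact h₂.arcs.2 e' he' f' hf' (by omega)
  free x hx := by
    rintro ⟨e, he, hc⟩
    rcases mem_gluePoints.1 hx with rfl | ⟨y, hy, rfl⟩ <;>
      rcases mem_glueArcs.1 he with he | ⟨e', he', h, h'⟩
    · have := h₁.arcs.1 e he
      omega
    · omega
    · have := h₁.arcs.1 e he
      omega
    · exact h₂.free y hy ⟨e', he', by omega⟩
  full hβ x hx hxm hxP := by
    rcases lt_trichotomy x p with h | rfl | h
    · obtain ⟨e, he, hc⟩ := h₁.full hβ x hx h (Finset.notMem_empty x)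
      exact ⟨e, mem_glueArcs.2 (Or.inl he), hc⟩
    · exact absurd (mem_gluePoints.2 (Or.inl rfl)) hxP
    · obtain ⟨e, he, hc⟩ := h₂.full hβ (x - p) (by omega) (by omega) fun hy =>
        hxP (mem_gluePoints.2 (Or.inr ⟨_, hy, by omega⟩))
      exact ⟨(e.1 + p, e.2 + p), mem_glueArcs.2 (Or.inr ⟨e, he, rfl, rfl⟩), by
        constructor <;> dsimp only <;> omega⟩

/-- An arc that covers a point left of `p` cannot reach beyond `p`, because `p` itself is uncovered.
So coverage survives the restriction to `[0, p]`, and minimality of `p` leaves no cut point inside.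
-/
theorem IsCut.left {β : Prop} {p N : ℕ} {P : Finset ℕ} {Q : Finset (ℕ × ℕ)}
    (h : IsCut β N P Q) (hp : p ∈ P) (hmin : ∀ x ∈ P, p ≤ x) :
    IsCut β p ∅ (Q.filter fun e => e.2 ≤ p) where
  pos x hx := absurd hx (Finset.notMem_empty x)
  lt x hx := absurd hx (Finset.notMem_empty x)
  arcs := by
    refine ⟨fun e he => ?_, fun e he f hf => ?_⟩
    · rw [Finset.mem_filter] at he
      exact ⟨(h.arcs.1 e he.1).1, he.2⟩
    · rw [Finset.mem_filter] at he hf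
      exact h.arcs.2 e he.1 f hf.1
  free x hx := absurd hx (Finset.notMem_empty x)
  full hβ x hx hxp _ := by
    obtain ⟨e, he, hc⟩ := h.full hβ x hx (hxp.trans (h.lt p hp)) fun hxP =>
      absurd (hmin x hxP) (by omega)
    refine ⟨e, Finset.mem_filter.2 ⟨he, ?_⟩, hc⟩
    by_contra hlt
    exact h.free p hp ⟨e, he, by omega⟩

theorem IsCut.right {β : Prop} {p N : ℕ} {P : Finset ℕ} {Q : Finset (ℕ × ℕ)}
    (h : IsCut β N P Q) (hp : p ∈ P) :
    IsCut β (N - p) (rightPoints p P) (rightArcs p Q) where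
  pos x hx := Nat.pos_of_ne_zero (mem_rightPoints.1 hx).1
  lt x hx := by
    have := h.lt _ (mem_rightPoints.1 hx).2
    omega
  arcs := by
    refine ⟨fun e he => ?_, fun e he f hf hc => ?_⟩
    · have := h.arcs.1 _ (mem_rightArcs.1 he)
      dsimp only at this
      omega
    · exact h.arcs.2 _ (mem_rightArcs.1 he) _ (mem_rightArcs.1 hf) (by dsimp only; omega)
  free x hx := by
    rintro ⟨e, he, hc⟩
    exact h.free _ (mem_rightPoints.1 hx).2 ⟨_, mem_rightArcs.1 he, by dsimp only; omega⟩
  full hβ x hx hxp hxP := by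
    obtain ⟨e, he, hc⟩ := h.full hβ (x + p) (by omega) (by omega) fun h' =>
      hxP (mem_rightPoints.2 ⟨by omega, h'⟩)
    have hpe : p ≤ e.1 := by
      by_contra hlt
      exact h.free p hp ⟨e, he, by omega⟩
    refine ⟨(e.1 - p, e.2 - p), mem_rightArcs.2 ?_, by dsimp only; omega⟩
    have := h.arcs.1 e he
    have h1 : e.1 - p + p = e.1 := by omega
    have h2 : e.2 - p + p = e.2 := by omega
    simpa only [h1, h2] using he

/-- No arc straddles the uncovered point `p`, so splitting at `p` loses nothing. -/
theorem glueArcs_left_right {β : Prop} {p N : ℕ} {P : Finset ℕ} {Q : Finset (ℕ × ℕ)}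
    (h : IsCut β N P Q) (hp : p ∈ P) :
    glueArcs p (Q.filter fun e => e.2 ≤ p) (rightArcs p Q) = Q := by
  ext e
  rw [mem_glueArcs, Finset.mem_filter]
  constructor
  · rintro (he | ⟨f, hf, h1, h2⟩)
    · exact he.1
    · have := mem_rightArcs.1 hf
      rwa [← h1, ← h2] at this
  · intro he
    by_cases hle : e.2 ≤ p
    · exact Or.inl ⟨he, hle⟩
    · have hpe : p ≤ e.1 := by
        by_contra hlt
        exact h.free p hp ⟨e, he, by omega⟩
      refine Or.inr ⟨(e.1 - p, e.2 - p), mem_rightArcs.2 ?_, by dsimp only; omega,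
        by dsimp only; omega⟩
      have h1 : e.1 - p + p = e.1 := by omega
      have h2 : e.2 - p + p = e.2 := by omega
      simpa only [h1, h2] using he

theorem gluePoints_right {p : ℕ} {P : Finset ℕ} (hp : p ∈ P) (hmin : ∀ x ∈ P, p ≤ x) :
    gluePoints p (rightPoints p P) = P := by
  ext x
  rw [mem_gluePoints]
  constructor
  · rintro (rfl | ⟨y, hy, rfl⟩)
    · exact hp
    · exact (mem_rightPoints.1 hy).2
  · intro hx
    have := hmin x hx
    rcases eq_or_ne x p with rfl | hne
    · exact Or.inl rfl
    · refine Or.inr ⟨x - p, mem_rightPoints.2 ⟨by omega, ?_⟩, by omega⟩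
      rwa [Nat.sub_add_cancel this]

theorem left_glueArcs {m p : ℕ} {Q₁ Q₂ : Finset (ℕ × ℕ)} (h₁ : IsArcSystem p Q₁)
    (h₂ : IsArcSystem m Q₂) : ((glueArcs p Q₁ Q₂).filter fun e => e.2 ≤ p) = Q₁ := by
  ext e
  rw [Finset.mem_filter, mem_glueArcs]
  constructor
  · rintro ⟨he | ⟨f, hf, h, h'⟩, hle⟩
    · exact he
    · have := h₂.1 f hf
      omega
  · intro he
    exact ⟨Or.inl he, (h₁.1 e he).2⟩

theorem right_glueArcs {p : ℕ} {Q₁ Q₂ : Finset (ℕ × ℕ)} (h₁ : IsArcSystem p Q₁) :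
    rightArcs p (glueArcs p Q₁ Q₂) = Q₂ := by
  ext e
  rw [mem_rightArcs, mem_glueArcs]
  constructor
  · rintro (he | ⟨f, hf, h, h'⟩)
    · have := h₁.1 _ he
      dsimp only at this
      omega
    · dsimp only at h h'
      rwa [show e = f from Prod.ext (by omega) (by omega)]
  · intro he
    exact Or.inr ⟨e, he, rfl, rfl⟩

theorem right_gluePoints {p : ℕ} {P : Finset ℕ} (h : ∀ x ∈ P, 0 < x) :
    rightPoints p (gluePoints p P) = P := by
  ext x
  rw [mem_rightPoints, mem_gluePoints]
  constructor
  · rintro ⟨hx, h | ⟨y, hy, h⟩⟩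
    · omega
    · rwa [show x = y by omega]
  · intro hx
    exact ⟨(h x hx).ne', Or.inr ⟨x, hx, rfl⟩⟩

theorem card_glueArcs {m p : ℕ} {Q₁ Q₂ : Finset (ℕ × ℕ)} (h₁ : IsArcSystem p Q₁)
    (h₂ : IsArcSystem m Q₂) : (glueArcs p Q₁ Q₂).card = Q₁.card + Q₂.card := by
  rw [glueArcs, Finset.card_union_of_disjoint, Finset.card_map]
  rw [Finset.disjoint_left]
  intro e he he'
  obtain ⟨f, hf, rfl⟩ := Finset.mem_map.1 he'
  have h1 := h₁.1 _ he
  have h2 := h₂.1 _ hf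
  simp only [arcShift_apply] at h1
  omega

theorem card_gluePoints {p : ℕ} {P : Finset ℕ} (h : ∀ x ∈ P, 0 < x) :
    (gluePoints p P).card = P.card + 1 := by
  rw [gluePoints, Finset.card_insert_of_notMem, Finset.card_map]
  intro hp
  obtain ⟨x, hx, hxp⟩ := Finset.mem_map.1 hp
  have := h x hx
  rw [addRightEmbedding_apply] at hxp
  omega

/-! ### Counting cut arc systems block by block -/

/-- The number of pairs in `cuts β r N K`, or `0` on a trivial segment. -/
noncomputable def cutNumber (β : Prop) (r N K : ℕ) : ℕ :=
  if N = 0 then 0 else (cuts β r N K).card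

theorem sInf_gluePoints {p : ℕ} {P : Finset ℕ} : sInf (gluePoints p P : Set ℕ) = p := by
  refine le_antisymm (Nat.sInf_le (by simp [gluePoints])) ?_
  refine le_csInf ⟨p, by simp [gluePoints]⟩ fun x hx => ?_
  rcases mem_gluePoints.1 (Finset.mem_coe.1 hx) with rfl | ⟨y, hy, rfl⟩ <;> omega

/-- Cut at the smallest marked point, which splits off the first block. The antidiagonal also
contains splittings with an empty side; these do not occur geometrically, and the value `0` on the
trivial segment removes them. -/
theorem cutNumber_succ (β : Prop) (r N K : ℕ) :
    cutNumber β (r + 1) N K = ∑ p ∈ Finset.HasAntidiagonal.antidiagonal N,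
      ∑ q ∈ Finset.HasAntidiagonal.antidiagonal K, cutNumber β 0 p.1 q.1 * cutNumber β r p.2 q.2 := by
  have hl : cutNumber β (r + 1) N K = (cuts β (r + 1) N K).card := by
    rw [cutNumber]
    -- For `N = 0` the convention agrees with the true count, since a marked point would have to lie
    -- below `0`.
    split_ifs with h
    · subst h
      symm
      rw [Finset.card_eq_zero, Finset.eq_empty_iff_forall_notMem]
      intro z hz
      obtain ⟨h1, h2, -⟩ := mem_cuts.1 hz
      obtain ⟨x, hx⟩ := Finset.card_pos.1 (by omega : 0 < z.1.card)
      exact absurd (h1.lt x hx) (by omega)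
    · rfl
  have hr : ∀ p q : ℕ × ℕ, cutNumber β 0 p.1 q.1 * cutNumber β r p.2 q.2 =
      ((if p.1 = 0 ∨ p.2 = 0 then ∅ else cuts β 0 p.1 q.1 ×ˢ cuts β r p.2 q.2 :
        Finset ((Finset ℕ × Finset (ℕ × ℕ)) × (Finset ℕ × Finset (ℕ × ℕ)))).card) := by
    intro p q
    by_cases h1 : p.1 = 0
    · simp [h1, cutNumber]
    · by_cases h2 : p.2 = 0
      · simp [h2, cutNumber]
      · simp [h1, h2, cutNumber, Finset.card_product]
  rw [hl]
  simp_rw [hr]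
  rw [← Finset.sum_product', ← Finset.card_sigma]
  refine Finset.card_nbij'
    (fun z => ⟨((sInf (z.1 : Set ℕ), N - sInf (z.1 : Set ℕ)),
        ((z.2.filter fun e => e.2 ≤ sInf (z.1 : Set ℕ)).card,
          (rightArcs (sInf (z.1 : Set ℕ)) z.2).card)),
      ((∅, z.2.filter fun e => e.2 ≤ sInf (z.1 : Set ℕ)),
        (rightPoints (sInf (z.1 : Set ℕ)) z.1, rightArcs (sInf (z.1 : Set ℕ)) z.2))⟩)
    (fun w => (gluePoints w.1.1.1 w.2.2.1, glueArcs w.1.1.1 w.2.1.2 w.2.2.2)) ?_ ?_ ?_ ?_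
  · intro z hz
    obtain ⟨h, h1, h2⟩ := mem_cuts.1 hz
    have hne : z.1.Nonempty := Finset.card_pos.1 (by omega)
    have hp : sInf (z.1 : Set ℕ) ∈ z.1 := Nat.sInf_mem (s := (z.1 : Set ℕ)) hne
    have hmin : ∀ x ∈ z.1, sInf (z.1 : Set ℕ) ≤ x := fun x hx => Nat.sInf_le hx
    simp only [Finset.mem_sigma, Finset.mem_product, Finset.HasAntidiagonal.mem_antidiagonal,
      Finset.mem_coe]
    generalize sInf (z.1 : Set ℕ) = p at hp hmin ⊢
    have := h.lt p hp
    have := h.pos p hp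
    have hL := h.left hp hmin
    have hR := h.right hp
    refine ⟨⟨by omega, ?_⟩, ?_⟩
    · rw [← card_glueArcs hL.arcs hR.arcs, glueArcs_left_right h hp, h2]
    · rw [if_neg (by omega), Finset.mem_product, mem_cuts, mem_cuts]
      refine ⟨⟨hL, rfl, rfl⟩, hR, ?_, rfl⟩
      have := card_gluePoints (p := p) hR.pos
      rw [gluePoints_right hp hmin] at this
      dsimp only
      omega
  · rintro ⟨⟨⟨p, m⟩, ⟨k, l⟩⟩, ⟨⟨P₁, Q₁⟩, ⟨P, Q⟩⟩⟩ hw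
    simp only [Finset.mem_sigma, Finset.mem_product, Finset.HasAntidiagonal.mem_antidiagonal,
      Finset.mem_coe] at hw
    obtain ⟨⟨h1, h2⟩, h3⟩ := hw
    split_ifs at h3 with h0
    · exact absurd h3 (Finset.notMem_empty _)
    · rw [Finset.mem_product, mem_cuts, mem_cuts] at h3
      dsimp only at h3 ⊢
      obtain ⟨⟨g1, g2, g3⟩, g4, g5, g6⟩ := h3
      obtain rfl := Finset.card_eq_zero.1 g2
      refine Finset.mem_coe.2 (mem_cuts.2 ⟨?_, ?_, ?_⟩)
      · rw [← h1]
        exact g1.glue g4 (by omega) (by omega)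
      · rw [card_gluePoints g4.pos, g5]
      · rw [card_glueArcs g1.arcs g4.arcs, g3, g6, h2]
  · intro z hz
    obtain ⟨h, h1, h2⟩ := mem_cuts.1 hz
    have hne : z.1.Nonempty := Finset.card_pos.1 (by omega)
    have hp : sInf (z.1 : Set ℕ) ∈ z.1 := Nat.sInf_mem (s := (z.1 : Set ℕ)) hne
    have hmin : ∀ x ∈ z.1, sInf (z.1 : Set ℕ) ≤ x := fun x hx => Nat.sInf_le hx
    exact Prod.ext (gluePoints_right hp hmin) (glueArcs_left_right h hp)
  · rintro ⟨⟨⟨p, m⟩, ⟨k, l⟩⟩, ⟨⟨P₁, Q₁⟩, ⟨P, Q⟩⟩⟩ hw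
    simp only [Finset.mem_sigma, Finset.mem_product, Finset.HasAntidiagonal.mem_antidiagonal,
      Finset.mem_coe] at hw
    obtain ⟨⟨h1, h2⟩, h3⟩ := hw
    split_ifs at h3 with h0
    · exact absurd h3 (Finset.notMem_empty _)
    · rw [Finset.mem_product, mem_cuts, mem_cuts] at h3
      dsimp only at h3 ⊢
      obtain ⟨⟨g1, g2, g3⟩, g4, g5, g6⟩ := h3
      obtain rfl := Finset.card_eq_zero.1 g2
      simp only [sInf_gluePoints, left_glueArcs g1.arcs g4.arcs, right_glueArcs g1.arcs,
        right_gluePoints g4.pos, g3, g6]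
      rw [show N - p = m by omega]

theorem sum_antidiagonalTuple_succ {R : Type*} [AddCommMonoid R] (r N : ℕ)
    (F : (Fin (r + 1) → ℕ) → R) :
    ∑ f ∈ Finset.Nat.antidiagonalTuple (r + 1) N, F f =
      ∑ p ∈ Finset.HasAntidiagonal.antidiagonal N,
        ∑ f ∈ Finset.Nat.antidiagonalTuple r p.2, F (Fin.cons p.1 f) := by
  rw [Finset.sum_sigma']
  refine Finset.sum_nbij' (fun f => ⟨(f 0, ∑ i, f (Fin.succ i)), Fin.tail f⟩)
    (fun w => Fin.cons w.1.1 w.2) ?_ ?_ ?_ ?_ ?_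
  · intro f hf
    rw [Finset.Nat.mem_antidiagonalTuple, Fin.sum_univ_succ] at hf
    simp only [Finset.mem_sigma, Finset.HasAntidiagonal.mem_antidiagonal,
      Finset.Nat.mem_antidiagonalTuple]
    exact ⟨hf, rfl⟩
  · rintro ⟨⟨a, b⟩, f⟩ hf
    simp only [Finset.mem_sigma, Finset.HasAntidiagonal.mem_antidiagonal,
      Finset.Nat.mem_antidiagonalTuple] at hf
    rw [Finset.Nat.mem_antidiagonalTuple, Fin.sum_univ_succ]
    simp only [Fin.cons_zero, Fin.cons_succ]
    omega
  · intro f _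
    exact Fin.cons_self_tail f
  · rintro ⟨⟨a, b⟩, f⟩ hf
    simp only [Finset.mem_sigma, Finset.HasAntidiagonal.mem_antidiagonal,
      Finset.Nat.mem_antidiagonalTuple] at hf
    obtain ⟨h1, rfl⟩ := hf
    simp [Fin.tail_cons]
  · intro f _
    rw [Fin.cons_self_tail]

/-- Iterating the first-block recursion turns `r` cut points into `r + 1` blocks without cut points.
-/
theorem cutNumber_eq_sum (β : Prop) (r N K : ℕ) :
    cutNumber β r N K = ∑ f ∈ Finset.Nat.antidiagonalTuple (r + 1) N,
      ∑ g ∈ Finset.Nat.antidiagonalTuple (r + 1) K, ∏ i, cutNumber β 0 (f i) (g i) := by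
  induction r generalizing N K with
  | zero => simp
  | succ r ih =>
    rw [cutNumber_succ, sum_antidiagonalTuple_succ]
    refine Finset.sum_congr rfl fun p _ => ?_
    rw [Finset.sum_congr rfl fun f _ => sum_antidiagonalTuple_succ (r + 1) K _, Finset.sum_comm]
    refine Finset.sum_congr rfl fun q _ => ?_
    rw [ih, Finset.mul_sum]
    refine Finset.sum_congr rfl fun f _ => ?_
    rw [Finset.mul_sum]
    refine Finset.sum_congr rfl fun g _ => ?_
    rw [Fin.prod_univ_succ (n := r + 1)]
    simp only [Fin.cons_zero, Fin.cons_succ]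

/-! ### The maximal number of arcs, and the root arc -/

theorem IsArcSystem.mono {m : ℕ} {Q Q' : Finset (ℕ × ℕ)} (h : IsArcSystem m Q) (hQ : Q' ⊆ Q) :
    IsArcSystem m Q' :=
  ⟨fun e he => h.1 e (hQ he), fun e he f hf => h.2 e (hQ he) f (hQ hf)⟩

theorem IsArcSystem.insert_root {m : ℕ} {Q : Finset (ℕ × ℕ)} (h : IsArcSystem m Q) (hm : 2 ≤ m) :
    IsArcSystem m (insert (0, m) Q) := by
  refine ⟨fun e he => ?_, fun e he f hf hc => ?_⟩
  · rcases Finset.mem_insert.1 he with rfl | he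
    · exact ⟨by dsimp only; omega, le_rfl⟩
    · exact h.1 e he
  · rcases Finset.mem_insert.1 he with rfl | he <;> rcases Finset.mem_insert.1 hf with rfl | hf
    · dsimp only at hc
      omega
    · have := h.1 f hf
      dsimp only at hc
      omega
    · dsimp only at hc
      omega
    · exact h.2 e he f hf hc

open Classical in
/-- The apex of the triangle to the left below the arc `e`: the largest `x` strictly below `e`
that is joined to the left endpoint of `e` by a side or an arc of `Q`. -/
noncomputable def apex (Q : Finset (ℕ × ℕ)) (e : ℕ × ℕ) : ℕ :=
  ((Finset.Ioo e.1 e.2).filter fun x => x = e.1 + 1 ∨ (e.1, x) ∈ Q).sup id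

theorem apex_spec {Q : Finset (ℕ × ℕ)} {e : ℕ × ℕ} (he : e.1 + 2 ≤ e.2) :
    e.1 < apex Q e ∧ apex Q e < e.2 ∧ (apex Q e = e.1 + 1 ∨ (e.1, apex Q e) ∈ Q) ∧
      ∀ x, apex Q e < x → x < e.2 → (e.1, x) ∉ Q := by
  classical
  have hne : ((Finset.Ioo e.1 e.2).filter fun x => x = e.1 + 1 ∨ (e.1, x) ∈ Q).Nonempty :=
    ⟨e.1 + 1, by simp; omega⟩
  obtain ⟨y, hy, hy'⟩ := Finset.exists_mem_eq_sup _ hne id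
  have hap : apex Q e = y := hy'
  rw [Finset.mem_filter, Finset.mem_Ioo] at hy
  refine ⟨by omega, by omega, ?_, fun x hx hx2 hxQ => ?_⟩
  · rw [hap]
    exact hy.2
  · have : x ≤ apex Q e := Finset.le_sup (f := id)
      (Finset.mem_filter.2 ⟨Finset.mem_Ioo.2 ⟨by omega, hx2⟩, Or.inr hxQ⟩)
    omega

/-- The map `apex` from arcs to interior points is injective. Two arcs with a common apex are
nested. If their left endpoints differed, the inner arc would leave no room for, or would cross, the
edge from the outer left endpoint to the apex. If only the right endpoints differed, the inner arc
would provide a larger candidate for the outer apex. -/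
theorem IsArcSystem.card_le {m : ℕ} {Q : Finset (ℕ × ℕ)} (h : IsArcSystem m Q) :
    Q.card ≤ m - 1 := by
  have hcard : (Finset.Ioo 0 m).card = m - 1 := by simp
  rw [← hcard]
  refine Finset.card_le_card_of_injOn (apex Q) ?_ ?_
  · intro e he
    have := apex_spec (Q := Q) (h.1 e he).1
    have := h.1 e he
    simp only [Finset.coe_Ioo, Set.mem_Ioo]
    omega
  · have key : ∀ e ∈ Q, ∀ f ∈ Q, apex Q e = apex Q f → e.1 ≤ f.1 → f.2 ≤ e.2 → e = f := by
      intro e he f hf hef h1 h2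
      obtain ⟨e1, e2, e3, e4⟩ := apex_spec (Q := Q) (h.1 e he).1
      obtain ⟨f1, f2, f3, f4⟩ := apex_spec (Q := Q) (h.1 f hf).1
      have h3 : e.1 = f.1 := by
        by_contra hne
        rcases e3 with e3 | e3
        · omega
        · exact h.2 _ e3 f hf (by dsimp only; omega)
      refine Prod.ext h3 ?_
      by_contra hne
      refine e4 f.2 (by omega) (by omega) ?_
      rw [h3]
      exact hf
    intro e he f hf hef
    have n1 := h.2 e he f hf
    have n2 := h.2 f hf e he
    have e1 := apex_spec (Q := Q) (h.1 e he).1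
    have f1 := apex_spec (Q := Q) (h.1 f hf).1
    rcases le_total e.1 f.1 with h1 | h1 <;> rcases le_total e.2 f.2 with h2 | h2
    · rcases eq_or_lt_of_le h1 with h1' | h1'
      · exact (key f hf e he hef.symm h1'.ge h2).symm
      · rcases eq_or_lt_of_le h2 with h2' | h2'
        · exact key e he f hf hef h1 h2'.ge
        · omega
    · exact key e he f hf hef h1 h2
    · exact (key f hf e he hef.symm h1 h2).symm
    · rcases eq_or_lt_of_le h1 with h1' | h1'
      · exact key e he f hf hef h1'.ge h2
      · rcases eq_or_lt_of_le h2 with h2' | h2'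
        · exact (key f hf e he hef.symm h1 h2'.ge).symm
        · omega

theorem IsArcSystem.card_le_of_root_notMem {m : ℕ} {Q : Finset (ℕ × ℕ)} (h : IsArcSystem m Q)
    (hm : 2 ≤ m) (h0 : (0, m) ∉ Q) : Q.card ≤ m - 2 := by
  have := (h.insert_root hm).card_le
  rw [Finset.card_insert_of_notMem h0] at this
  omega

/-- For the nontrivial direction, let `x` be the largest interior point joined to `0`. An arc
covering `x` must start at `0`, as otherwise it crosses `(0, x)`; by maximality of `x` it then ends
at `m`. -/
theorem IsArcSystem.root_mem_iff {m : ℕ} {Q : Finset (ℕ × ℕ)} (h : IsArcSystem m Q)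
    (hm : 2 ≤ m) : (0, m) ∈ Q ↔ ∀ x, 0 < x → x < m → Covers Q x := by
  refine ⟨fun h0 x hx hxm => ⟨_, h0, hx, hxm⟩, fun hc => ?_⟩
  obtain ⟨e1, e2, e3, e4⟩ := apex_spec (Q := Q) (e := (0, m)) (by dsimp only; omega)
  dsimp only at e1 e2 e3 e4
  obtain ⟨f, hf, f1, f2⟩ := hc _ e1 e2
  have hf1 : f.1 = 0 := by
    by_contra hne
    rcases e3 with e3 | e3
    · omega
    · exact h.2 _ e3 f hf (by dsimp only; omega)
  have hf2 : f.2 = m := by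
    by_contra hne
    have := h.1 f hf
    refine e4 f.2 f2 (by omega) ?_
    rwa [← hf1]
  rwa [← hf1, ← hf2]

/-! ### Single blocks, with and without the root arc -/

open Classical in
/-- The systems of `l` arcs on `0, …, m` that do not contain the arc `(0, m)`. -/
noncomputable def arcSystems (m l : ℕ) : Finset (Finset (ℕ × ℕ)) :=
  (Finset.range (m + 1) ×ˢ Finset.range (m + 1)).powerset.filter fun Q =>
    IsArcSystem m Q ∧ (0, m) ∉ Q ∧ Q.card = l

theorem mem_arcSystems {m l : ℕ} {Q : Finset (ℕ × ℕ)} :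
    Q ∈ arcSystems m l ↔ IsArcSystem m Q ∧ (0, m) ∉ Q ∧ Q.card = l := by
  classical
  rw [arcSystems, Finset.mem_filter, and_iff_right_iff_imp]
  exact fun h => Finset.mem_powerset.2 h.1.subset

theorem card_arcSystems_eq_zero {m l : ℕ} (hm : 2 ≤ m) (hl : m ≤ l + 1) :
    (arcSystems m l).card = 0 := by
  rw [Finset.card_eq_zero, Finset.eq_empty_iff_forall_notMem]
  intro Q hQ
  obtain ⟨h, h0, hc⟩ := mem_arcSystems.1 hQ
  have := h.card_le_of_root_notMem hm h0
  omega

theorem IsArcSystem.eq_empty {Q : Finset (ℕ × ℕ)} (h : IsArcSystem 1 Q) : Q = ∅ := by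
  have := h.card_le
  exact Finset.card_eq_zero.1 (by omega)

theorem isArcSystem_empty (m : ℕ) : IsArcSystem m ∅ :=
  ⟨fun _ h => absurd h (Finset.notMem_empty _), fun _ h => absurd h (Finset.notMem_empty _)⟩

theorem card_arcSystems_one (l : ℕ) : (arcSystems 1 l).card = if l = 0 then 1 else 0 := by
  split_ifs with h
  · rw [Finset.card_eq_one]
    refine ⟨∅, Finset.ext fun Q => ?_⟩
    rw [mem_arcSystems, Finset.mem_singleton]
    refine ⟨fun hQ => hQ.1.eq_empty, ?_⟩
    rintro rfl
    exact ⟨isArcSystem_empty 1, Finset.notMem_empty _, by simp [h]⟩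
  · rw [Finset.card_eq_zero, Finset.eq_empty_iff_forall_notMem]
    intro Q hQ
    obtain ⟨h1, -, h2⟩ := mem_arcSystems.1 hQ
    rw [h1.eq_empty] at h2
    exact h (by simpa using h2.symm)

theorem cutNumber_zero_one (β : Prop) (l : ℕ) :
    cutNumber β 0 1 l = if l = 0 then 1 else 0 := by
  rw [cutNumber, if_neg one_ne_zero]
  split_ifs with h
  · rw [Finset.card_eq_one]
    refine ⟨(∅, ∅), Finset.ext fun z => ?_⟩
    rw [mem_cuts, Finset.mem_singleton]
    refine ⟨fun hz => Prod.ext (Finset.card_eq_zero.1 hz.2.1) hz.1.arcs.eq_empty, ?_⟩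
    rintro rfl
    exact ⟨⟨by simp, by simp, isArcSystem_empty 1, by simp, fun _ x h1 h2 => by omega⟩, by simp,
      by simp [h]⟩
  · rw [Finset.card_eq_zero, Finset.eq_empty_iff_forall_notMem]
    intro z hz
    obtain ⟨h1, -, h2⟩ := mem_cuts.1 hz
    rw [h1.arcs.eq_empty] at h2
    exact h (by simpa using h2.symm)

/-- The root arc covers every interior point, so the maximality condition governed by `β` holds
automatically and the count does not depend on it. -/
theorem card_rooted (β : Prop) {m : ℕ} (l : ℕ) (hm : 2 ≤ m) :
    ((cuts β 0 m (l + 1)).filter fun z => (0, m) ∈ z.2).card = (arcSystems m l).card := by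
  refine Finset.card_nbij' (fun z => z.2.erase (0, m)) (fun Q => (∅, insert (0, m) Q)) ?_ ?_ ?_ ?_
  · intro z hz
    rw [Finset.mem_coe, Finset.mem_filter, mem_cuts] at hz
    refine Finset.mem_coe.2 (mem_arcSystems.2 ⟨hz.1.1.arcs.mono (Finset.erase_subset _ _),
      Finset.notMem_erase _ _, ?_⟩)
    rw [Finset.card_erase_of_mem hz.2, hz.1.2.2]
    rfl
  · intro Q hQ
    obtain ⟨h1, h2, h3⟩ := mem_arcSystems.1 (Finset.mem_coe.1 hQ)
    rw [Finset.mem_coe, Finset.mem_filter, mem_cuts]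
    refine ⟨⟨⟨by simp, by simp, h1.insert_root hm, by simp, fun _ x hx hxm _ =>
      ⟨_, Finset.mem_insert_self _ _, hx, hxm⟩⟩, rfl, ?_⟩, Finset.mem_insert_self _ _⟩
    rw [Finset.card_insert_of_notMem h2, h3]
  · intro z hz
    rw [Finset.mem_coe, Finset.mem_filter, mem_cuts] at hz
    exact Prod.ext (Finset.card_eq_zero.1 hz.1.2.1).symm (Finset.insert_erase hz.2)
  · intro Q hQ
    exact Finset.erase_insert (mem_arcSystems.1 (Finset.mem_coe.1 hQ)).2.1

theorem card_unrooted {m : ℕ} (l : ℕ) :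
    ((cuts False 0 m l).filter fun z => (0, m) ∉ z.2).card = (arcSystems m l).card := by
  refine Finset.card_nbij' (fun z => z.2) (fun Q => (∅, Q)) ?_ ?_ ?_ ?_
  · intro z hz
    rw [Finset.mem_coe, Finset.mem_filter, mem_cuts] at hz
    exact Finset.mem_coe.2 (mem_arcSystems.2 ⟨hz.1.1.arcs, hz.2, hz.1.2.2⟩)
  · intro Q hQ
    obtain ⟨h1, h2, h3⟩ := mem_arcSystems.1 (Finset.mem_coe.1 hQ)
    rw [Finset.mem_coe, Finset.mem_filter, mem_cuts]
    exact ⟨⟨⟨by simp, by simp, h1, by simp, fun h => h.elim⟩, rfl, h3⟩, h2⟩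
  · intro z hz
    rw [Finset.mem_coe, Finset.mem_filter, mem_cuts] at hz
    exact Prod.ext (Finset.card_eq_zero.1 hz.1.2.1).symm rfl
  · intro Q hQ
    rfl

theorem cuts_zero_zero_root {β : Prop} {m : ℕ} {z : Finset ℕ × Finset (ℕ × ℕ)}
    (hz : z ∈ cuts β 0 m 0) : (0, m) ∉ z.2 := by
  rw [Finset.card_eq_zero.1 (mem_cuts.1 hz).2.2]
  exact Finset.notMem_empty _

theorem cutNumber_false_zero {m l : ℕ} (hm : 2 ≤ m) : cutNumber False 0 m l =
    (if l = 0 then 0 else (arcSystems m (l - 1)).card) + (arcSystems m l).card := by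
  rw [cutNumber, if_neg (by omega), ← Finset.card_filter_add_card_filter_not
    (fun z : Finset ℕ × Finset (ℕ × ℕ) => (0, m) ∈ z.2), card_unrooted]
  congr 1
  rcases l with _ | l
  · rw [if_pos rfl, Finset.card_eq_zero, Finset.filter_eq_empty_iff]
    exact fun z hz => cuts_zero_zero_root hz
  · rw [card_rooted _ _ hm]
    rfl

theorem cutNumber_true_zero {m l : ℕ} (hm : 2 ≤ m) : cutNumber True 0 m l =
    if l = 0 then 0 else (arcSystems m (l - 1)).card := by
  have hroot : ∀ z ∈ cuts True 0 m l, (0, m) ∈ z.2 := fun z hz => by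
    obtain ⟨h, h1, h2⟩ := mem_cuts.1 hz
    rw [h.arcs.root_mem_iff hm]
    intro x hx hxm
    refine h.full trivial x hx hxm ?_
    rw [Finset.card_eq_zero.1 h1]
    exact Finset.notMem_empty _
  rw [cutNumber, if_neg (by omega)]
  rcases l with _ | l
  · rw [if_pos rfl, Finset.card_eq_zero, Finset.eq_empty_iff_forall_notMem]
    exact fun z hz => cuts_zero_zero_root hz (hroot z hz)
  · rw [if_neg (by omega), Nat.add_sub_cancel, ← card_rooted True l hm,
      Finset.filter_true_of_mem hroot]

/-! ### Chords with integer representatives and their crossings -/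

/-- The chord of the `n`-gon that joins the vertices with integer labels `a` and `b`. -/
def chord (n : ℕ) (a b : ℤ) : Sym2 (ZMod n) := s((a : ZMod n), (b : ZMod n))

theorem chord_comm (n : ℕ) (a b : ℤ) : chord n a b = chord n b a := Sym2.eq_swap

theorem chord_add_mul (n : ℕ) (a b s t : ℤ) : chord n (a + s * n) (b + t * n) = chord n a b := by
  simp [chord]

theorem exists_mul_of_cast_eq {n : ℕ} {a b : ℤ} (h : (a : ZMod n) = b) :
    ∃ s : ℤ, b = a + s * n := by
  obtain ⟨s, hs⟩ := (ZMod.intCast_eq_intCast_iff_dvd_sub a b n).1 h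
  exact ⟨s, by linear_combination hs⟩

theorem eq_zero_of_mul_lt {n z : ℤ} (h1 : -n < z * n) (h2 : z * n < n) : z = 0 := by
  have hn : 0 < n := by omega
  have h3 : -1 < z := by nlinarith
  have h4 : z < 1 := by nlinarith
  omega

/-- A chord has two families of representing intervals, one for each of the two boundary paths
between its endpoints; within a family they differ by multiples of `n`. -/
theorem chord_eq_cases {n : ℕ} {a c p q : ℤ} (h : chord n a c = chord n p q) (hac : a < c)
    (hca : c < a + n) (hpq : p < q) (hqp : q < p + n) :
    ∃ s : ℤ, (p = a + s * n ∧ q = c + s * n) ∨ (p = c + s * n ∧ q = a + n + s * n) := by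
  rcases Sym2.eq_iff.1 h with ⟨h1, h2⟩ | ⟨h1, h2⟩
  · obtain ⟨s, rfl⟩ := exists_mul_of_cast_eq h1
    obtain ⟨t, rfl⟩ := exists_mul_of_cast_eq h2
    have : t - s = 0 := eq_zero_of_mul_lt (n := n) (by rw [sub_mul]; omega) (by rw [sub_mul]; omega)
    obtain rfl : t = s := by omega
    exact ⟨t, Or.inl ⟨rfl, rfl⟩⟩
  · obtain ⟨s, rfl⟩ := exists_mul_of_cast_eq h1
    obtain ⟨t, rfl⟩ := exists_mul_of_cast_eq h2
    have : s - t - 1 = 0 := eq_zero_of_mul_lt (n := n)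
      (by rw [sub_mul, sub_mul]; omega) (by rw [sub_mul, sub_mul]; omega)
    obtain rfl : s = t + 1 := by omega
    exact ⟨t, Or.inr ⟨rfl, by ring⟩⟩

theorem isDiagonal_chord {n : ℕ} {a b : ℤ} (h1 : a + 2 ≤ b) (h2 : b + 2 ≤ a + n) :
    IsDiagonal (chord n a b) := by
  have key : ∀ x : ℤ, 0 < x → x < n → (x : ZMod n) ≠ 0 := fun x hx hxn h => by
    have := Int.le_of_dvd hx ((ZMod.intCast_zmod_eq_zero_iff_dvd x n).1 h)
    omega
  refine ⟨a, b, rfl, fun h => key (b - a) (by omega) (by omega) ?_,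
    fun h => key (b - a - 1) (by omega) (by omega) ?_,
    fun h => key (b + 1 - a) (by omega) (by omega) ?_⟩
  · push_cast
    rw [h, sub_self]
  · push_cast
    rw [h]
    ring
  · push_cast
    rw [h]
    ring

theorem isDiagonal_chord_iff {n : ℕ} {a b : ℤ} (h1 : a < b) (h2 : b < a + n) :
    IsDiagonal (chord n a b) ↔ a + 2 ≤ b ∧ b + 2 ≤ a + n := by
  refine ⟨fun h => ?_, fun h => isDiagonal_chord h.1 h.2⟩
  obtain ⟨x, y, hxy, -, h3, h4⟩ := h
  constructor
  · by_contra hlt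
    obtain rfl : b = a + 1 := by omega
    rcases Sym2.eq_iff.1 hxy with ⟨rfl, rfl⟩ | ⟨rfl, rfl⟩
    · exact h3 (by push_cast; rfl)
    · exact h4 (by push_cast; rfl)
  · by_contra hlt
    obtain rfl : b = a + n - 1 := by omega
    rcases Sym2.eq_iff.1 hxy with ⟨rfl, rfl⟩ | ⟨rfl, rfl⟩
    · exact h4 (by push_cast; simp)
    · exact h3 (by push_cast; simp)

theorem exists_chord {n : ℕ} [NeZero n] (e : Sym2 (ZMod n)) :
    ∃ a b : ℕ, a ≤ b ∧ b < n ∧ e = chord n a b := by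
  induction e using Sym2.ind with
  | _ x y =>
    have hx := ZMod.val_lt x
    have hy := ZMod.val_lt y
    have hx' : ((x.val : ℤ) : ZMod n) = x := by simp
    have hy' : ((y.val : ℤ) : ZMod n) = y := by simp
    rcases le_total x.val y.val with h | h
    · exact ⟨x.val, y.val, h, hy, by rw [chord, hx', hy']⟩
    · exact ⟨y.val, x.val, h, hx, by rw [chord, hx', hy', Sym2.eq_swap]⟩

theorem IsDiagonal.exists_chord {n : ℕ} [NeZero n] {e : Sym2 (ZMod n)} (he : IsDiagonal e) :
    ∃ a b : ℕ, a + 2 ≤ b ∧ b < n ∧ b + 2 ≤ a + n ∧ e = chord n a b := by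
  obtain ⟨a, b, h1, h2, rfl⟩ := PolygonDissection.exists_chord e
  have hne : a ≠ b := by
    rintro rfl
    obtain ⟨x, y, hxy, h, -, -⟩ := he
    rcases Sym2.eq_iff.1 hxy with ⟨rfl, rfl⟩ | ⟨rfl, rfl⟩ <;> exact h rfl
  have := (isDiagonal_chord_iff (n := n) (a := a) (b := b) (by omega) (by omega)).1 he
  exact ⟨a, b, by omega, h2, by omega, rfl⟩

theorem map_add_chord {n : ℕ} (a b c : ℤ) :
    (chord n a b).map (· + (c : ZMod n)) = chord n (a + c) (b + c) := by
  simp [chord]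

theorem val_intCast_of_lt {n : ℕ} [NeZero n] {a : ℤ} (h0 : 0 ≤ a) (h : a < n) :
    ((a : ZMod n).val : ℤ) = a := by
  rw [ZMod.val_intCast, Int.emod_eq_of_lt h0 h]

/-- Rotating `a` to `0` puts all four labels in `[0, n)`, where the order of residues is that of
integers. Rotating back preserves crossing up to the order of the two chords. -/
theorem crosses_chord {n : ℕ} [NeZero n] {a b c d : ℤ} (h1 : a < b) (h2 : b < c) (h3 : c < d)
    (h4 : d < a + n) :
    Crosses (chord n a c) (chord n b d) ∨ Crosses (chord n b d) (chord n a c) := by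
  have h : Crosses (chord n 0 (c - a)) (chord n (b - a) (d - a)) := by
    refine ⟨_, _, _, _, rfl, rfl, ?_, ?_, ?_⟩
    · rw [← Int.ofNat_lt, val_intCast_of_lt, val_intCast_of_lt] <;> omega
    · rw [← Int.ofNat_lt, val_intCast_of_lt, val_intCast_of_lt] <;> omega
    · rw [← Int.ofNat_lt, val_intCast_of_lt, val_intCast_of_lt] <;> omega
  have := h.add (a : ZMod n)
  simpa only [map_add_chord, zero_add, sub_add_cancel] using this

theorem Crosses.exists_chord {n : ℕ} [NeZero n] {e f : Sym2 (ZMod n)} (h : Crosses e f) :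
    ∃ a b c d : ℤ, a < b ∧ b < c ∧ c < d ∧ d < a + n ∧ e = chord n a c ∧ f = chord n b d := by
  obtain ⟨a, b, c, d, rfl, rfl, h1, h2, h3⟩ := h
  have := ZMod.val_lt d
  exact ⟨a.val, c.val, b.val, d.val, by omega, by omega, by omega, by omega, by simp [chord],
    by simp [chord]⟩

/-- Two crossing chords with given integer representatives: after a shift of one of them by a
multiple of `n`, the representing intervals overlap. -/
theorem overlap_of_crossing {n : ℕ} {a b c d p q u v : ℤ} (h1 : a < b) (h2 : b < c) (h3 : c < d)
    (h4 : d < a + n) (hac : chord n a c = chord n p q) (hbd : chord n b d = chord n u v)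
    (hpq : p < q) (hqp : q < p + n) (huv : u < v) (hvu : v < u + n) :
    ∃ t : ℤ, (p < u + t * n ∧ u + t * n < q ∧ q < v + t * n) ∨
      (u + t * n < p ∧ p < v + t * n ∧ v + t * n < q) := by
  obtain ⟨s, hs⟩ := chord_eq_cases hac (by omega) (by omega) hpq hqp
  obtain ⟨s', hs'⟩ := chord_eq_cases hbd (by omega) (by omega) huv hvu
  rcases hs with ⟨rfl, rfl⟩ | ⟨rfl, rfl⟩ <;> rcases hs' with ⟨rfl, rfl⟩ | ⟨rfl, rfl⟩
  · refine ⟨s - s', Or.inl ?_⟩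
    rw [sub_mul]
    omega
  · refine ⟨s - s' - 1, Or.inr ?_⟩
    rw [sub_mul, sub_mul]
    omega
  · refine ⟨s - s', Or.inr ?_⟩
    rw [sub_mul]
    omega
  · refine ⟨s - s', Or.inl ?_⟩
    rw [sub_mul]
    omega

theorem IsDissection.not_crossing {n k : ℕ} [NeZero n] {E : Finset (Sym2 (ZMod n))}
    (h : IsDissection k E) {a b c d : ℤ} (h1 : a < b) (h2 : b < c) (h3 : c < d) (h4 : d < a + n)
    (hac : chord n a c ∈ E) (hbd : chord n b d ∈ E) : False :=
  (crosses_chord h1 h2 h3 h4).elim (h.2.2 _ hac _ hbd) (h.2.2 _ hbd _ hac)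

/-- The criterion for dissections given by chords with integer representatives. -/
theorem isDissection_of_reps {n : ℕ} [NeZero n] {E : Finset (Sym2 (ZMod n))} (S : Set (ℤ × ℤ))
    (hE : ∀ e ∈ E, ∃ p ∈ S, e = chord n p.1 p.2)
    (hS : ∀ p ∈ S, p.1 + 2 ≤ p.2 ∧ p.2 + 2 ≤ p.1 + n)
    (hcr : ∀ p ∈ S, ∀ q ∈ S, ∀ t : ℤ, ¬ (p.1 < q.1 + t * n ∧ q.1 + t * n < p.2 ∧
      p.2 < q.2 + t * n)) : IsDissection E.card E := by
  refine ⟨rfl, fun e he => ?_, fun e he f hf hc => ?_⟩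
  · obtain ⟨p, hp, rfl⟩ := hE e he
    exact isDiagonal_chord (hS p hp).1 (hS p hp).2
  · obtain ⟨a, b, c, d, h1, h2, h3, h4, rfl, rfl⟩ := hc.exists_chord
    obtain ⟨p, hp, hep⟩ := hE _ he
    obtain ⟨q, hq, heq⟩ := hE _ hf
    have hp' := hS p hp
    have hq' := hS q hq
    obtain ⟨t, ht | ht⟩ := overlap_of_crossing h1 h2 h3 h4 hep heq (by omega) (by omega)
      (by omega) (by omega)
    · exact hcr p hp q hq t ht
    · refine hcr q hq p hp (-t) ?_
      rw [neg_mul]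
      omega

/-! ### Dissections of a polygon as arc systems -/

/-- The chords of the `n`-gon given by a set of arcs. -/
def chords (n : ℕ) (Q : Finset (ℕ × ℕ)) : Finset (Sym2 (ZMod n)) :=
  Q.image fun e => chord n e.1 e.2

/-- The arcs on `0, …, M` that are chords in `E`. -/
def arcsOf (n M : ℕ) (E : Finset (Sym2 (ZMod n))) : Finset (ℕ × ℕ) :=
  (Finset.range (M + 1) ×ˢ Finset.range (M + 1)).filter fun e =>
    e.1 + 2 ≤ e.2 ∧ chord n e.1 e.2 ∈ E

theorem mem_arcsOf {n M : ℕ} {E : Finset (Sym2 (ZMod n))} {e : ℕ × ℕ} :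
    e ∈ arcsOf n M E ↔ e.1 + 2 ≤ e.2 ∧ e.2 ≤ M ∧ chord n e.1 e.2 ∈ E := by
  simp only [arcsOf, Finset.mem_filter, Finset.mem_product, Finset.mem_range]
  constructor
  · rintro ⟨⟨h1, h2⟩, h3, h4⟩
    exact ⟨h3, by omega, h4⟩
  · rintro ⟨h1, h2, h3⟩
    exact ⟨⟨by omega, by omega⟩, h1, h3⟩

theorem mem_chords {n : ℕ} {Q : Finset (ℕ × ℕ)} {e : Sym2 (ZMod n)} :
    e ∈ chords n Q ↔ ∃ f ∈ Q, chord n f.1 f.2 = e := Finset.mem_image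

theorem IsDissection.isArcSystem {n k M : ℕ} [NeZero n] {E : Finset (Sym2 (ZMod n))}
    (h : IsDissection k E) (hM : M < n) : IsArcSystem M (arcsOf n M E) := by
  refine ⟨fun e he => ?_, fun e he f hf hc => ?_⟩
  · rw [mem_arcsOf] at he
    exact ⟨he.1, he.2.1⟩
  · rw [mem_arcsOf] at he hf
    refine h.not_crossing (a := e.1) (b := f.1) (c := e.2) (d := f.2) ?_ ?_ ?_ ?_ he.2.2 hf.2.2 <;>
      omega

theorem chord_natCast_inj {n : ℕ} {a b c d : ℕ} (hab : a < b) (hcd : c < d) (hb : b < n)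
    (hd : d < n) (h : chord n a b = chord n c d) : a = c ∧ b = d := by
  obtain ⟨s, ⟨h1, h2⟩ | ⟨h1, h2⟩⟩ := chord_eq_cases h (by omega) (by omega) (by omega) (by omega)
  · have hs : s = 0 := eq_zero_of_mul_lt (n := n) (by omega) (by omega)
    subst hs
    omega
  · have hs : s + 1 = 0 := eq_zero_of_mul_lt (n := n) (by rw [add_mul]; omega)
      (by rw [add_mul]; omega)
    obtain rfl : s = -1 := by omega
    omega

theorem IsArcSystem.injOn_chord {n M : ℕ} {Q : Finset (ℕ × ℕ)} (h : IsArcSystem M Q)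
    (hM : M < n) : Set.InjOn (fun e : ℕ × ℕ => chord n e.1 e.2) Q := by
  intro e he f hf hef
  have h1 := h.1 e he
  have h2 := h.1 f hf
  have := chord_natCast_inj (by omega) (by omega) (by omega) (by omega) hef
  exact Prod.ext this.1 this.2

theorem IsArcSystem.arcsOf_chords {n M : ℕ} {Q : Finset (ℕ × ℕ)} (h : IsArcSystem M Q)
    (hM : M < n) : arcsOf n M (chords n Q) = Q := by
  ext e
  rw [mem_arcsOf, mem_chords]
  constructor
  · rintro ⟨h1, h2, f, hf, hfe⟩
    have h3 := h.1 f hf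
    have := chord_natCast_inj (by omega) (by omega) (by omega) (by omega) hfe
    rwa [show e = f from Prod.ext this.1.symm this.2.symm]
  · intro he
    exact ⟨(h.1 e he).1, (h.1 e he).2, e, he, rfl⟩

theorem IsArcSystem.isDissection {m l : ℕ} {Q : Finset (ℕ × ℕ)} (h : IsArcSystem m Q)
    (h0 : (0, m) ∉ Q) (hl : Q.card = l) : IsDissection l (chords (m + 1) Q) := by
  have hcard : (chords (m + 1) Q).card = l := by
    rw [chords, Finset.card_image_of_injOn (h.injOn_chord (Nat.lt_succ_self m)), hl]
  have hlt : ∀ e ∈ Q, 0 < e.1 ∨ e.2 < m := fun e he => by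
    by_contra hn
    have := h.1 e he
    have h1 : e.1 = 0 := by omega
    have h2 : e.2 = m := by omega
    rw [show e = (0, m) from Prod.ext h1 h2] at he
    exact h0 he
  rw [← hcard]
  refine isDissection_of_reps {p | ∃ e ∈ Q, p = ((e.1 : ℤ), (e.2 : ℤ))} ?_ ?_ ?_
  · intro e he
    obtain ⟨f, hf, rfl⟩ := mem_chords.1 he
    exact ⟨_, ⟨f, hf, rfl⟩, rfl⟩
  · rintro p ⟨e, he, rfl⟩
    have h1 := h.1 e he
    have h2 := hlt e he
    dsimp only
    omega
  · rintro p ⟨e, he, rfl⟩ q ⟨f, hf, rfl⟩ t ht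
    dsimp only at ht
    have h1 := h.1 e he
    have h2 := h.1 f hf
    -- All representatives lie in `[0, m]`, a window shorter than the period `m + 1`, so overlapping
    -- intervals cannot differ by a nonzero period.
    have ht0 : t = 0 := eq_zero_of_mul_lt (n := (m + 1 : ℕ)) (by omega) (by omega)
    subst ht0
    exact h.2 e he f hf (by omega)

theorem IsDissection.chords_arcsOf {m l : ℕ} {E : Finset (Sym2 (ZMod (m + 1)))}
    (h : IsDissection l E) : chords (m + 1) (arcsOf (m + 1) m E) = E := by
  ext e
  rw [mem_chords]
  constructor
  · rintro ⟨f, hf, rfl⟩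
    exact (mem_arcsOf.1 hf).2.2
  · intro he
    obtain ⟨a, b, h1, h2, h3, rfl⟩ := (h.2.1 e he).exists_chord
    exact ⟨(a, b), mem_arcsOf.2 ⟨h1, by dsimp only; omega, he⟩, rfl⟩

open Classical in
/-- The finite set of `k`-dissections of the `n`-gon. -/
noncomputable def dissections (n k : ℕ) [NeZero n] : Finset (Finset (Sym2 (ZMod n))) :=
  Finset.univ.filter fun E => IsDissection k E

theorem mem_dissections {n k : ℕ} [NeZero n] {E : Finset (Sym2 (ZMod n))} :
    E ∈ dissections n k ↔ IsDissection k E := by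
  simp [dissections]

theorem natCard_dissection (n k : ℕ) [NeZero n] :
    Nat.card (Dissection n k) = (dissections n k).card :=
  Nat.subtype_card _ fun _ => mem_dissections

theorem IsDissection.arcsOf_mem {m l : ℕ} {E : Finset (Sym2 (ZMod (m + 1)))}
    (h : IsDissection l E) : arcsOf (m + 1) m E ∈ arcSystems m l := by
  have hQ := h.isArcSystem (M := m) (by omega)
  refine mem_arcSystems.2 ⟨hQ, fun h0 => ?_, ?_⟩
  · have h1 := mem_arcsOf.1 h0
    have := (isDiagonal_chord_iff (n := m + 1) (by dsimp only at h1 ⊢; omega)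
      (by push_cast; omega)).1 (h.2.1 _ h1.2.2)
    push_cast at this
    omega
  · rw [← h.1]
    conv_rhs => rw [← h.chords_arcsOf]
    rw [chords, Finset.card_image_of_injOn (hQ.injOn_chord (by omega))]

/-- Label the vertices `0, …, m`. The diagonals are then exactly the arcs other than `(0, m)`, which
is a side of the polygon. -/
theorem card_dissections_succ (m l : ℕ) :
    (dissections (m + 1) l).card = (arcSystems m l).card := by
  refine Finset.card_nbij' (arcsOf (m + 1) m) (chords (m + 1)) ?_ ?_ ?_ ?_
  · intro E hE
    exact (mem_dissections.1 hE).arcsOf_mem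
  · intro Q hQ
    obtain ⟨h1, h2, h3⟩ := mem_arcSystems.1 hQ
    exact mem_dissections.2 (h1.isDissection h2 h3)
  · intro E hE
    exact (mem_dissections.1 hE).chords_arcsOf
  · intro Q hQ
    exact (mem_arcSystems.1 hQ).1.arcsOf_chords (by omega)

theorem card_dissections_succ_filter {m l p : ℕ} (hp : 2 ≤ p) (hpm : p ≤ m) :
    ((dissections (m + 1) l).filter fun E => chord (m + 1) 0 p ∈ E).card =
      ((arcSystems m l).filter fun Q => (0, p) ∈ Q).card := by
  have key : ∀ E : Finset (Sym2 (ZMod (m + 1))),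
      (0, p) ∈ arcsOf (m + 1) m E ↔ chord (m + 1) 0 p ∈ E := fun E => by
    rw [mem_arcsOf]
    refine ⟨fun h => by simpa using h.2.2, fun h => ⟨by dsimp only; omega, hpm, by simpa using h⟩⟩
  refine Finset.card_nbij' (arcsOf (m + 1) m) (chords (m + 1)) ?_ ?_ ?_ ?_
  · intro E hE
    rw [Finset.mem_coe, Finset.mem_filter, mem_dissections] at hE
    exact Finset.mem_coe.2 (Finset.mem_filter.2 ⟨hE.1.arcsOf_mem, (key E).2 hE.2⟩)
  · intro Q hQ
    rw [Finset.mem_coe, Finset.mem_filter, mem_arcSystems] at hQ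
    refine Finset.mem_coe.2 (Finset.mem_filter.2
      ⟨mem_dissections.2 (hQ.1.1.isDissection hQ.1.2.1 hQ.1.2.2), (key _).1 ?_⟩)
    rw [hQ.1.1.arcsOf_chords (by omega)]
    exact hQ.2
  · intro E hE
    rw [Finset.mem_coe, Finset.mem_filter, mem_dissections] at hE
    exact hE.1.chords_arcsOf
  · intro Q hQ
    rw [Finset.mem_coe, Finset.mem_filter, mem_arcSystems] at hQ
    exact hQ.1.1.arcsOf_chords (by omega)

/-! ### The numbers `A` and the index sums in terms of cut numbers -/

theorem A_natCast_succ {m : ℕ} (l : ℕ) (hm : 1 ≤ m) :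
    A ((m : ℚ) + 1) l = (arcSystems m l).card := by
  rcases eq_or_lt_of_le hm with rfl | hm
  -- The digon convention `A^2_0 = 1` corresponds to the single empty arc system on a segment of
  -- length `1`.
  · rw [card_arcSystems_one, A]
    by_cases hl : l = 0
    · rw [if_pos ⟨by norm_num, by simp [hl]⟩, if_pos hl]
      simp
    · rw [if_neg (fun h => hl (by exact_mod_cast h.2)), if_neg, if_neg hl]
      · simp
      · rintro ⟨-, -, h⟩
        have : (0 : ℚ) ≤ l := Nat.cast_nonneg l
        norm_num at h
        linarith
  · have hm2 : (2 : ℚ) ≤ m := by exact_mod_cast hm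
    rw [A, if_neg (fun h => by linarith [h.1])]
    have h1 : ⌊(m : ℚ) + 1⌋₊ = m + 1 := by
      rw [show ((m : ℚ) + 1) = ((m + 1 : ℕ) : ℚ) by push_cast; ring, Nat.floor_natCast]
    rw [h1, Nat.floor_natCast, natCard_dissection, card_dissections_succ]
    split_ifs with h
    · rfl
    · rw [card_arcSystems_eq_zero hm, Nat.cast_zero]
      by_contra hlt
      refine h ⟨by push_cast; ring, rfl, ?_⟩
      have : ((l + 2 : ℕ) : ℚ) ≤ m := by exact_mod_cast (by omega)
      push_cast at this
      linarith

theorem A_eq_zero_of_left {m l : ℚ} (h : ∀ x : ℕ, m ≠ x) : A m l = 0 := by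
  rw [A, if_neg (fun h' => h 2 (by exact_mod_cast h'.1)), if_neg (fun h' => h _ h'.1)]

theorem A_eq_zero_of_right {m l : ℚ} (h : ∀ x : ℕ, l ≠ x) : A m l = 0 := by
  rw [A, if_neg (fun h' => h 0 (by exact_mod_cast h'.2)), if_neg (fun h' => h _ h'.2.1)]

theorem A_natCast_succ_sub_one {m : ℕ} (l : ℕ) (hm : 1 ≤ m) :
    A ((m : ℚ) + 1) ((l : ℚ) - 1) = if l = 0 then 0 else ((arcSystems m (l - 1)).card : ℚ) := by
  rcases l with _ | l
  · rw [if_pos rfl]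
    refine A_eq_zero_of_right fun x h => ?_
    have : (0 : ℚ) ≤ x := Nat.cast_nonneg x
    norm_num at h
    linarith
  · rw [if_neg (by omega), ← A_natCast_succ _ hm]
    push_cast
    simp

theorem cutNumber_zero_left (β : Prop) (r K : ℕ) : cutNumber β r 0 K = 0 := by
  rw [cutNumber, if_pos rfl]

/-- The first summand counts blocks with the root arc, the second those without. The restriction `l
+ 1 ≤ m` matters for `m = 1`, `l = 1`: there the expression would yield `A^2_0 = 1`, although a
segment of length `1` carries no arc. -/
theorem cutNumber_false_zero_eq_A (m l : ℕ) : (cutNumber False 0 m l : ℚ) =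
    if l + 1 ≤ m then A ((m : ℚ) + 1) ((l : ℚ) - 1) + A ((m : ℚ) + 1) l else 0 := by
  rcases Nat.lt_or_ge 1 m with hm | hm
  · rw [A_natCast_succ_sub_one l hm.le, A_natCast_succ l hm.le, cutNumber_false_zero hm]
    split_ifs with h0 h1 h1
    · simp
    · omega
    · simp
    · rw [card_arcSystems_eq_zero hm (by omega), card_arcSystems_eq_zero hm (by omega)]
      simp
  · interval_cases m
    · rw [cutNumber_zero_left, if_neg (by omega), Nat.cast_zero]
    · rw [A_natCast_succ_sub_one l le_rfl, A_natCast_succ l le_rfl, cutNumber_zero_one]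
      by_cases hl : l = 0 <;> simp [hl, card_arcSystems_one]

/-- A block without free interior points has its root arc as soon as there are interior points, that
is, for `2 ≤ m`. This extra arc is the source of the term `|{i : n_i ≥ 2}|`. -/
theorem cutNumber_true_zero_eq_A (m l : ℕ) (hm : 1 ≤ m) :
    (cutNumber True 0 m (l + if 2 ≤ m then 1 else 0) : ℚ) = A ((m : ℚ) + 1) l := by
  rcases Nat.lt_or_ge 1 m with hm' | hm'
  · replace hm' : 2 ≤ m := hm'
    rw [A_natCast_succ l hm, cutNumber_true_zero hm', if_pos hm', if_neg (by omega),
      Nat.add_sub_cancel]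
  · obtain rfl : m = 1 := by omega
    rw [A_natCast_succ l hm, cutNumber_zero_one, card_arcSystems_one]
    simp

/-- The cut points split `[0, N]` into `t + 1` arbitrary blocks. Tuples outside `axialIndex` have
some `k_s ≥ n_s`, for which the block count vanishes. -/
theorem axialSum_eq (N t K : ℕ) : axialSum N (t + 2 * K) t = cutNumber False t N K := by
  rw [cutNumber_eq_sum, ← Finset.sum_product', Nat.cast_sum, axialSum]
  refine (Finset.sum_congr rfl (g := fun p : (Fin (t + 1) → ℕ) × (Fin (t + 1) → ℕ) =>
    ((∏ i, cutNumber False 0 (p.1 i) (p.2 i) : ℕ) : ℚ)) fun p hp => ?_).trans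
    (Finset.sum_subset (fun p hp => ?_) fun p hp hp' => ?_)
  · simp only [axialIndex, Finset.mem_filter] at hp
    rw [Nat.cast_prod]
    refine Finset.prod_congr rfl fun s _ => ?_
    rw [cutNumber_false_zero_eq_A, if_pos (hp.2.1 s)]
  · simp only [axialIndex, Finset.mem_filter] at hp
    rw [Finset.mem_product, Finset.Nat.mem_antidiagonalTuple, Finset.Nat.mem_antidiagonalTuple]
    exact ⟨hp.2.2.1, by omega⟩
  · rw [Finset.mem_product, Finset.Nat.mem_antidiagonalTuple,
      Finset.Nat.mem_antidiagonalTuple] at hp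
    obtain ⟨h1, h2⟩ := hp
    have hex : ∃ s, ¬ p.2 s + 1 ≤ p.1 s := by
      by_contra hall
      push Not at hall
      refine hp' ?_
      simp only [axialIndex, Finset.mem_filter, Finset.mem_product, Fintype.mem_piFinset,
        Finset.mem_Icc]
      refine ⟨⟨fun s => ⟨by have := hall s; omega, ?_⟩, fun s => ⟨Nat.zero_le _, ?_⟩⟩,
        hall, h1, by omega⟩
      · rw [← h1]
        exact Finset.single_le_sum (fun i _ => Nat.zero_le (p.1 i)) (Finset.mem_univ s)
      · have := Finset.single_le_sum (fun i _ => Nat.zero_le (p.2 i)) (Finset.mem_univ s)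
        omega
    obtain ⟨s, hs⟩ := hex
    rw [Nat.cast_prod]
    refine Finset.prod_eq_zero (Finset.mem_univ s) ?_
    rw [cutNumber_false_zero_eq_A, if_neg hs]

theorem axialSum_eq_zero {N k t : ℕ} (h : ∀ K, t + 2 * K ≠ k) : axialSum N k t = 0 := by
  refine Finset.sum_eq_zero fun p hp => ?_
  simp only [axialIndex, Finset.mem_filter] at hp
  exact absurd (by omega) (h (∑ s, p.2 s))

theorem markedIndex_eq_empty_of_not_dvd {n k d r : ℕ} (h : ¬ d ∣ k) :
    markedIndex n k d r = ∅ := by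
  rw [Finset.eq_empty_iff_forall_notMem]
  intro p hp
  simp only [markedIndex, Finset.mem_filter] at hp
  exact h ⟨_, hp.2.2.symm⟩

/-- Restoring the root arc of every block of length at least `2` replaces `k_i` by `k_i + 1` there.
The tuples missed by this substitution have a block of length `0`, or a longer block with no arcs,
and contribute nothing. -/
theorem sum_markedIndex {d : ℕ} (hd : 0 < d) (s M K : ℕ) :
    ∑ p ∈ markedIndex (d * M) (d * K) d (s + 1), ∏ i, A ((p.1 i : ℚ) + 1) (p.2 i) =
      cutNumber True s M K := by
  have hMd : M ≤ d * M := Nat.le_mul_of_pos_left _ hd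
  have hKd : K ≤ d * K := Nat.le_mul_of_pos_left _ hd
  have hsum : ∀ p : (Fin (s + 1) → ℕ) × (Fin (s + 1) → ℕ),
      ∑ i, (p.2 i + if 2 ≤ p.1 i then 1 else 0) =
        ∑ i, p.2 i + (Finset.univ.filter fun i => 2 ≤ p.1 i).card := fun p => by
    rw [Finset.sum_add_distrib, Finset.card_filter]
  rw [cutNumber_eq_sum, ← Finset.sum_product', Nat.cast_sum]
  refine Finset.sum_of_injOn (fun p => (p.1, fun i => p.2 i + if 2 ≤ p.1 i then 1 else 0))
    ?_ ?_ ?_ ?_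
  · rintro ⟨f, g⟩ _ ⟨f', g'⟩ _ h
    simp only [Prod.mk.injEq] at h
    obtain ⟨rfl, h⟩ := h
    refine Prod.ext rfl (funext fun i => ?_)
    have := congrFun h i
    simpa using this
  · intro p hp
    simp only [markedIndex, Finset.coe_filter, Set.mem_ofPred_eq] at hp
    rw [Finset.mem_coe, Finset.mem_product, Finset.Nat.mem_antidiagonalTuple,
      Finset.Nat.mem_antidiagonalTuple]
    refine ⟨Nat.eq_of_mul_eq_mul_left hd hp.2.1, ?_⟩
    rw [hsum]
    exact Nat.eq_of_mul_eq_mul_left hd hp.2.2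
  · intro p hp hp'
    rw [Finset.mem_product, Finset.Nat.mem_antidiagonalTuple,
      Finset.Nat.mem_antidiagonalTuple] at hp
    obtain ⟨h1, h2⟩ := hp
    by_contra hne
    have hne' : ∀ i, cutNumber True 0 (p.1 i) (p.2 i) ≠ 0 := fun i hi => by
      refine hne ?_
      rw [Finset.prod_eq_zero (Finset.mem_univ i) hi, Nat.cast_zero]
    have hpos : ∀ i, 1 ≤ p.1 i := fun i => by
      by_contra h0
      refine hne' i ?_
      rw [show p.1 i = 0 by omega, cutNumber_zero_left]
    have hpos' : ∀ i, (if 2 ≤ p.1 i then 1 else 0) ≤ p.2 i := fun i => by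
      split_ifs with h
      · by_contra h0
        refine hne' i ?_
        rw [cutNumber_true_zero h, if_pos (by omega)]
      · exact Nat.zero_le _
    have hback : (fun i => (p.2 i - if 2 ≤ p.1 i then 1 else 0) +
        if 2 ≤ p.1 i then 1 else 0) = p.2 := funext fun i => Nat.sub_add_cancel (hpos' i)
    refine hp' ⟨(p.1, fun i => p.2 i - if 2 ≤ p.1 i then 1 else 0), ?_, ?_⟩
    · simp only [markedIndex, Finset.coe_filter, Set.mem_ofPred_eq, Finset.mem_product,
        Fintype.mem_piFinset, Finset.mem_Icc]
      refine ⟨⟨fun i => ⟨hpos i, ?_⟩, fun i => ⟨Nat.zero_le _, ?_⟩⟩, by rw [h1], ?_⟩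
      · have := Finset.single_le_sum (fun i _ => Nat.zero_le (p.1 i)) (Finset.mem_univ i)
        omega
      · have := Finset.single_le_sum (fun i _ => Nat.zero_le (p.2 i)) (Finset.mem_univ i)
        omega
      · have h3 := hsum (p.1, fun i => p.2 i - if 2 ≤ p.1 i then 1 else 0)
        dsimp only at h3
        rw [← h3, ← h2]
        congr 1
        exact Finset.sum_congr rfl fun i _ => congrFun hback i
    · exact Prod.ext rfl hback
  · intro p hp
    simp only [markedIndex, Finset.mem_filter, Finset.mem_product, Fintype.mem_piFinset,
      Finset.mem_Icc] at hp
    rw [Nat.cast_prod]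
    refine Finset.prod_congr rfl fun i _ => ?_
    rw [cutNumber_true_zero_eq_A _ _ (hp.1.1 i).1]

/-! ### Moving dissections, and double counting of oriented diagonals -/

/-- The image of a set of chords under a dihedral symmetry. -/
def move {n : ℕ} (g : DihedralGroup n) (E : Finset (Sym2 (ZMod n))) : Finset (Sym2 (ZMod n)) :=
  E.image (Sym2.map (vertexAction n g))

theorem map_mem_move {n : ℕ} {g : DihedralGroup n} {E : Finset (Sym2 (ZMod n))}
    {e : Sym2 (ZMod n)} : e.map (vertexAction n g) ∈ move g E ↔ e ∈ E :=
  (Sym2.map.injective (Equiv.injective _)).mem_finset_image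

theorem move_mul {n : ℕ} (g h : DihedralGroup n) (E : Finset (Sym2 (ZMod n))) :
    move (g * h) E = move g (move h E) := by
  rw [move, move, move, Finset.image_image]
  exact Finset.image_congr fun e _ => map_vertexAction_mul g h e

theorem move_one {n : ℕ} (E : Finset (Sym2 (ZMod n))) : move 1 E = E := by
  rw [move, show Sym2.map (vertexAction n 1) = id from funext map_vertexAction_one,
    Finset.image_id]

theorem sum_dissections_move {n k : ℕ} [NeZero n] {R : Type*} [AddCommMonoid R]
    (g : DihedralGroup n) (F : Finset (Sym2 (ZMod n)) → R) :
    ∑ E ∈ dissections n k, F (move g E) = ∑ E ∈ dissections n k, F E := by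
  refine Finset.sum_nbij' (move g) (move g⁻¹) ?_ ?_ ?_ ?_ fun _ _ => rfl
  · exact fun E hE => mem_dissections.2 ((mem_dissections.1 hE).vertexAction g)
  · exact fun E hE => mem_dissections.2 ((mem_dissections.1 hE).vertexAction g⁻¹)
  · intro E _
    rw [← move_mul, inv_mul_cancel, move_one]
  · intro E _
    rw [← move_mul, mul_inv_cancel, move_one]

theorem mem_move_r {n : ℕ} {i u v : ZMod n} {E : Finset (Sym2 (ZMod n))} :
    s(u + i, v + i) ∈ move (.r i) E ↔ s(u, v) ∈ E :=
  map_mem_move (g := .r i) (e := s(u, v))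

theorem sum_zmod {n : ℕ} [NeZero n] {R : Type*} [AddCommMonoid R] (F : ZMod n → R) :
    ∑ v, F v = ∑ p ∈ Finset.range n, F p := by
  refine Finset.sum_nbij' (fun v => v.val) (fun p => (p : ZMod n)) ?_ ?_ ?_ ?_ ?_
  · exact fun v _ => Finset.mem_range.2 (ZMod.val_lt v)
  · exact fun p _ => Finset.mem_univ _
  · exact fun v _ => ZMod.natCast_zmod_val v
  · exact fun p hp => ZMod.val_cast_of_lt (Finset.mem_range.1 hp)
  · intro v _
    rw [ZMod.natCast_zmod_val]

theorem card_ordered_pairs {V : Type*} [Fintype V] [DecidableEq V] (E : Finset (Sym2 V))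
    (hE : ∀ e ∈ E, ¬ e.IsDiag) :
    ∑ u : V, ∑ v : V, (if s(u, v) ∈ E then 1 else 0) = 2 * E.card := by
  rw [← Finset.sum_product', ← Finset.sum_filter, ← Finset.card_eq_sum_ones,
    Finset.card_eq_sum_card_fiberwise (f := fun p : V × V => s(p.1, p.2)) (t := E)]
  · rw [Finset.sum_const_nat (m := 2), mul_comm]
    intro e he
    induction e using Sym2.ind with
    | _ a b =>
      have hab : a ≠ b := fun h => hE _ he (Sym2.mk_isDiag_iff.2 h)
      rw [Finset.card_eq_two]
      refine ⟨(a, b), (b, a), fun h => hab (Prod.ext_iff.1 h).1, ?_⟩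
      ext ⟨x, y⟩
      simp only [Finset.mem_filter, Finset.mem_product, Finset.mem_univ, true_and, Sym2.eq_iff,
        Finset.mem_insert, Finset.mem_singleton, Prod.mk.injEq]
      refine ⟨fun h => h.2, fun h => ⟨?_, h⟩⟩
      rcases h with ⟨rfl, rfl⟩ | ⟨rfl, rfl⟩
      · exact he
      · rwa [Sym2.eq_swap]
  · intro p hp
    exact (Finset.mem_filter.1 hp).2

theorem IsDiagonal.not_isDiag {n : ℕ} {e : Sym2 (ZMod n)} (h : IsDiagonal e) : ¬ e.IsDiag := by
  obtain ⟨a, b, rfl, h, -⟩ := h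
  exact fun h' => h (Sym2.mk_isDiag_iff.1 h')

/-- Double counting of the pairs of a dissection and an oriented diagonal. -/
theorem sum_card_dissections_diagonal (n k : ℕ) [NeZero n] :
    n * ∑ p ∈ Finset.range n, ((dissections n k).filter fun E => chord n 0 p ∈ E).card =
      2 * k * (dissections n k).card := by
  have h1 : ∑ E ∈ dissections n k, ∑ u : ZMod n, ∑ v : ZMod n, (if s(u, v) ∈ E then 1 else 0) =
      2 * k * (dissections n k).card := by
    rw [Finset.sum_const_nat (m := 2 * k), mul_comm]
    intro E hE
    have h := mem_dissections.1 hE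
    rw [card_ordered_pairs E fun e he => (h.2.1 e he).not_isDiag, h.1]
  -- By rotation invariance of the set of dissections, every starting vertex contributes as much as
  -- `0`.
  have h2 : ∀ u : ZMod n, ∑ E ∈ dissections n k, ∑ v : ZMod n, (if s(u, v) ∈ E then 1 else 0) =
      ∑ E ∈ dissections n k, ∑ v : ZMod n, (if s(0, v) ∈ E then 1 else 0) := fun u => by
    rw [← sum_dissections_move (.r u)]
    refine Finset.sum_congr rfl fun E _ => ?_
    rw [← Equiv.sum_comp (Equiv.addRight u)]
    refine Finset.sum_congr rfl fun v _ => ?_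
    have := mem_move_r (i := u) (u := 0) (v := v) (E := E)
    rw [zero_add] at this
    simp only [Equiv.coe_addRight, this]
  rw [← h1, Finset.sum_comm, Finset.sum_congr rfl fun u _ => h2 u, Finset.sum_const,
    Finset.card_univ, ZMod.card, smul_eq_mul]
  congr 1
  rw [Finset.sum_comm, sum_zmod]
  refine Finset.sum_congr rfl fun p _ => ?_
  rw [Finset.card_filter]
  simp [chord]

/-! ### Contraction along a diagonal from `0`, and the two-block count -/

/-- The order embedding of `[0, m + 1 - p]` onto `{0} ∪ [p, m]`. -/
def expand (p x : ℕ) : ℕ := if x = 0 then 0 else x + p - 1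

theorem expand_cases (p x : ℕ) : (x = 0 ∧ expand p x = 0) ∨ (0 < x ∧ expand p x = x + p - 1) := by
  unfold expand
  split_ifs <;> omega

theorem expand_of_pos {p y : ℕ} (hy : p ≤ y) (hp : 0 < p) : expand p (y + 1 - p) = y := by
  rcases expand_cases p (y + 1 - p) with h | h <;> omega

/-- The arcs not below `(0, p)`, after contraction of `[0, p]` to a side. -/
noncomputable def contractArcs (p m : ℕ) (Q : Finset (ℕ × ℕ)) : Finset (ℕ × ℕ) :=
  (Finset.range (m + 1) ×ˢ Finset.range (m + 1)).filter fun e =>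
    e.1 + 2 ≤ e.2 ∧ (expand p e.1, expand p e.2) ∈ Q

theorem mem_cuts_true_zero {m l : ℕ} (hm : 2 ≤ m) {z : Finset ℕ × Finset (ℕ × ℕ)} :
    z ∈ cuts True 0 m l ↔ z.1 = ∅ ∧ IsArcSystem m z.2 ∧ (0, m) ∈ z.2 ∧ z.2.card = l := by
  rw [mem_cuts]
  constructor
  · rintro ⟨h, h1, h2⟩
    rw [Finset.card_eq_zero] at h1
    refine ⟨h1, h.arcs, (h.arcs.root_mem_iff hm).2 fun x hx hxm => h.full trivial x hx hxm ?_, h2⟩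
    rw [h1]
    exact Finset.notMem_empty _
  · rintro ⟨h1, h2, h3, h4⟩
    refine ⟨⟨by simp [h1], by simp [h1], h2, by simp [h1], fun _ x hx hxm _ =>
      ⟨_, h3, hx, hxm⟩⟩, by simp [h1], h4⟩

theorem mem_contractArcs {p m : ℕ} {Q : Finset (ℕ × ℕ)} (hQ : IsArcSystem m Q) (hp : 2 ≤ p)
    {e : ℕ × ℕ} :
    e ∈ contractArcs p m Q ↔ e.1 + 2 ≤ e.2 ∧ (expand p e.1, expand p e.2) ∈ Q := by
  rw [contractArcs, Finset.mem_filter, and_iff_right_iff_imp]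
  rintro ⟨h1, h2⟩
  have h3 := hQ.1 _ h2
  dsimp only at h3
  have := expand_cases p e.1
  have := expand_cases p e.2
  rw [Finset.mem_product, Finset.mem_range, Finset.mem_range]
  omega

/-- The inverse of the contraction: insert an arc system below the side `(0, 1)`. -/
def insertArcs (p : ℕ) (Q₁ Q₂ : Finset (ℕ × ℕ)) : Finset (ℕ × ℕ) :=
  Q₁ ∪ Q₂.image fun e => (expand p e.1, expand p e.2)

theorem mem_insertArcs {p : ℕ} {Q₁ Q₂ : Finset (ℕ × ℕ)} {e : ℕ × ℕ} :
    e ∈ insertArcs p Q₁ Q₂ ↔ e ∈ Q₁ ∨ ∃ f ∈ Q₂, e.1 = expand p f.1 ∧ e.2 = expand p f.2 := by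
  simp only [insertArcs, Finset.mem_union, Finset.mem_image]
  refine or_congr Iff.rfl (exists_congr fun f => and_congr_right fun _ => ?_)
  rw [Prod.ext_iff]
  exact and_congr eq_comm eq_comm

theorem IsArcSystem.contract {p m : ℕ} {Q : Finset (ℕ × ℕ)} (hQ : IsArcSystem m Q) (hp : 2 ≤ p) :
    IsArcSystem (m + 1 - p) (contractArcs p m Q) := by
  refine ⟨fun e he => ?_, fun e he f hf hc => ?_⟩
  · rw [mem_contractArcs hQ hp] at he
    have h3 := hQ.1 _ he.2
    dsimp only at h3
    have := expand_cases p e.1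
    have := expand_cases p e.2
    omega
  · rw [mem_contractArcs hQ hp] at he hf
    refine hQ.2 _ he.2 _ hf.2 ?_
    have := expand_cases p e.1
    have := expand_cases p e.2
    have := expand_cases p f.1
    have := expand_cases p f.2
    dsimp only
    omega

theorem IsArcSystem.insertArcs {p m : ℕ} {Q₁ Q₂ : Finset (ℕ × ℕ)} (h₁ : IsArcSystem p Q₁)
    (h₂ : IsArcSystem (m + 1 - p) Q₂) (hp : 2 ≤ p) (hpm : p < m) :
    IsArcSystem m (insertArcs p Q₁ Q₂) := by
  refine ⟨fun e he => ?_, fun e he f hf hc => ?_⟩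
  · rcases mem_insertArcs.1 he with he | ⟨e', he', g1, g2⟩
    · have := h₁.1 e he
      omega
    · have := h₂.1 e' he'
      have := expand_cases p e'.1
      have := expand_cases p e'.2
      omega
  · rcases mem_insertArcs.1 he with he | ⟨e', he', g1, g2⟩ <;>
      rcases mem_insertArcs.1 hf with hf | ⟨f', hf', g3, g4⟩
    · exact h₁.2 e he f hf hc
    · have := h₁.1 e he
      have := h₂.1 f' hf'
      have := expand_cases p f'.1
      have := expand_cases p f'.2
      omega
    · have := h₁.1 f hf
      have := h₂.1 e' he'
      have := expand_cases p e'.1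
      have := expand_cases p e'.2
      omega
    · refine h₂.2 e' he' f' hf' ?_
      have := expand_cases p e'.1
      have := expand_cases p e'.2
      have := expand_cases p f'.1
      have := expand_cases p f'.2
      omega

theorem insertArcs_contract {p m : ℕ} {Q : Finset (ℕ × ℕ)} (hQ : IsArcSystem m Q) (hp : 2 ≤ p)
    (h0 : (0, p) ∈ Q) :
    insertArcs p (Q.filter fun e => e.2 ≤ p) (contractArcs p m Q) = Q := by
  ext e
  rw [mem_insertArcs, Finset.mem_filter]
  constructor
  · rintro (h | ⟨f, hf, h1, h2⟩)
    · exact h.1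
    · rw [mem_contractArcs hQ hp, ← h1, ← h2] at hf
      exact hf.2
  · intro he
    by_cases hle : e.2 ≤ p
    · exact Or.inl ⟨he, hle⟩
    · right
      have h1 := hQ.2 _ h0 e he
      have h2 := hQ.1 e he
      dsimp only at h1
      have h4 := expand_of_pos (p := p) (y := e.2) (by omega) (by omega)
      rcases Nat.eq_zero_or_pos e.1 with h3 | h3
      · refine ⟨(0, e.2 + 1 - p), (mem_contractArcs hQ hp).2 ⟨by dsimp only; omega, ?_⟩, h3,
          h4.symm⟩
        dsimp only
        rw [h4, expand, if_pos rfl, ← h3]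
        exact he
      · have h5 := expand_of_pos (p := p) (y := e.1) (by omega) (by omega)
        refine ⟨(e.1 + 1 - p, e.2 + 1 - p), (mem_contractArcs hQ hp).2
          ⟨by dsimp only; omega, ?_⟩, h5.symm, h4.symm⟩
        dsimp only
        rw [h4, h5]
        exact he

theorem left_insertArcs {p m : ℕ} {Q₁ Q₂ : Finset (ℕ × ℕ)} (h₁ : IsArcSystem p Q₁)
    (h₂ : IsArcSystem m Q₂) (hp : 2 ≤ p) :
    ((insertArcs p Q₁ Q₂).filter fun e => e.2 ≤ p) = Q₁ := by
  ext e
  rw [Finset.mem_filter, mem_insertArcs]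
  constructor
  · rintro ⟨he | ⟨f, hf, g1, g2⟩, hle⟩
    · exact he
    · have := h₂.1 f hf
      have := expand_cases p f.2
      omega
  · exact fun he => ⟨Or.inl he, (h₁.1 e he).2⟩

theorem expand_injective {p : ℕ} (hp : 2 ≤ p) : Function.Injective (expand p) := fun x y h => by
  have := expand_cases p x
  have := expand_cases p y
  omega

theorem contract_insertArcs {p m : ℕ} {Q₁ Q₂ : Finset (ℕ × ℕ)} (h₁ : IsArcSystem p Q₁)
    (h₂ : IsArcSystem (m + 1 - p) Q₂) (hp : 2 ≤ p) (hpm : p < m) :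
    contractArcs p m (insertArcs p Q₁ Q₂) = Q₂ := by
  ext e
  rw [mem_contractArcs (h₁.insertArcs h₂ hp hpm) hp, mem_insertArcs]
  constructor
  · rintro ⟨h0, h | ⟨f, hf, g1, g2⟩⟩
    · have := h₁.1 _ h
      dsimp only at this
      have := expand_cases p e.1
      have := expand_cases p e.2
      omega
    · rwa [show e = f from Prod.ext (expand_injective hp g1) (expand_injective hp g2)]
  · exact fun he => ⟨(h₂.1 e he).1, Or.inr ⟨e, he, rfl, rfl⟩⟩

theorem card_insertArcs {p m : ℕ} {Q₁ Q₂ : Finset (ℕ × ℕ)} (h₁ : IsArcSystem p Q₁)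
    (h₂ : IsArcSystem m Q₂) (hp : 2 ≤ p) :
    (insertArcs p Q₁ Q₂).card = Q₁.card + Q₂.card := by
  rw [insertArcs, Finset.card_union_of_disjoint, Finset.card_image_of_injective]
  · exact fun e f h => Prod.ext (expand_injective hp (Prod.ext_iff.1 h).1)
      (expand_injective hp (Prod.ext_iff.1 h).2)
  · rw [Finset.disjoint_left]
    intro e he he'
    obtain ⟨f, hf, rfl⟩ := Finset.mem_image.1 he'
    have h1 := h₁.1 _ he
    have h2 := h₂.1 _ hf
    dsimp only at h1
    have := expand_cases p f.1
    have := expand_cases p f.2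
    omega

/-- The arc `(0, p)` separates the polygon into two. It is kept in the part below it, as the root
arc, and becomes the side `(0, 1)` of the contracted other part. -/
theorem card_arcSystems_filter {m p : ℕ} (L : ℕ) (hp : 2 ≤ p) (hpm : p < m) :
    ((arcSystems m L).filter fun Q => (0, p) ∈ Q).card =
      ∑ q ∈ Finset.HasAntidiagonal.antidiagonal L,
        cutNumber True 0 p q.1 * (arcSystems (m + 1 - p) q.2).card := by
  have hr : ∀ q : ℕ × ℕ, cutNumber True 0 p q.1 * (arcSystems (m + 1 - p) q.2).card =
      (cuts True 0 p q.1 ×ˢ arcSystems (m + 1 - p) q.2).card := fun q => by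
    rw [cutNumber, if_neg (by omega), Finset.card_product]
  simp_rw [hr]
  rw [← Finset.card_sigma]
  refine Finset.card_nbij'
    (fun Q => ⟨((Q.filter fun e => e.2 ≤ p).card, (contractArcs p m Q).card),
      ((∅, Q.filter fun e => e.2 ≤ p), contractArcs p m Q)⟩)
    (fun w => insertArcs p w.2.1.2 w.2.2) ?_ ?_ ?_ ?_
  · intro Q hQ
    rw [Finset.mem_coe, Finset.mem_filter, mem_arcSystems] at hQ
    obtain ⟨⟨h1, h2, h3⟩, h4⟩ := hQ
    have hL : IsArcSystem p (Q.filter fun e => e.2 ≤ p) :=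
      ⟨fun e he => ⟨(h1.1 e (Finset.mem_filter.1 he).1).1, (Finset.mem_filter.1 he).2⟩,
        (h1.mono (Finset.filter_subset _ _)).2⟩
    have hR := h1.contract hp
    simp only [Finset.mem_sigma, Finset.mem_product, Finset.HasAntidiagonal.mem_antidiagonal,
      Finset.mem_coe]
    refine ⟨?_, (mem_cuts_true_zero hp).2 ⟨rfl, hL, Finset.mem_filter.2 ⟨h4, le_rfl⟩, rfl⟩,
      mem_arcSystems.2 ⟨hR, fun h => h2 ?_, rfl⟩⟩
    · rw [← card_insertArcs hL hR hp, insertArcs_contract h1 hp h4, h3]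
    · have := ((mem_contractArcs h1 hp).1 h).2
      dsimp only at this
      rwa [expand_of_pos (by omega) (by omega), expand, if_pos rfl] at this
  · rintro ⟨⟨k, l⟩, ⟨⟨P₁, Q₁⟩, Q₂⟩⟩ hw
    simp only [Finset.mem_sigma, Finset.mem_product, Finset.HasAntidiagonal.mem_antidiagonal,
      Finset.mem_coe] at hw
    obtain ⟨h0, h1, h2⟩ := hw
    obtain ⟨-, g2, g3, g4⟩ := (mem_cuts_true_zero hp).1 h1
    obtain ⟨g5, g6, g7⟩ := mem_arcSystems.1 h2
    dsimp only at g2 g3 g4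
    rw [Finset.mem_coe, Finset.mem_filter, mem_arcSystems]
    refine ⟨⟨g2.insertArcs g5 hp hpm, fun h => ?_, ?_⟩, mem_insertArcs.2 (Or.inl g3)⟩
    · rcases mem_insertArcs.1 h with h | ⟨f, hf, f1, f2⟩
      · have := g2.1 _ h
        dsimp only at this
        omega
      · have := expand_cases p f.1
        have := expand_cases p f.2
        have hf1 : f.1 = 0 := by omega
        have hf2 : f.2 = m + 1 - p := by omega
        rw [show f = (0, m + 1 - p) from Prod.ext hf1 hf2] at hf
        exact g6 hf
    · rw [card_insertArcs g2 g5 hp, g4, g7, h0]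
  · intro Q hQ
    rw [Finset.mem_coe, Finset.mem_filter, mem_arcSystems] at hQ
    exact insertArcs_contract hQ.1.1 hp hQ.2
  · rintro ⟨⟨k, l⟩, ⟨⟨P₁, Q₁⟩, Q₂⟩⟩ hw
    simp only [Finset.mem_sigma, Finset.mem_product, Finset.HasAntidiagonal.mem_antidiagonal,
      Finset.mem_coe] at hw
    obtain ⟨h0, h1, h2⟩ := hw
    obtain ⟨g1, g2, g3, g4⟩ := (mem_cuts_true_zero hp).1 h1
    obtain ⟨g5, g6, g7⟩ := mem_arcSystems.1 h2
    dsimp only at g1 g2 g3 g4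
    subst g1
    simp only [left_insertArcs g2 g5 hp, contract_insertArcs g2 g5 hp hpm, g4, g7]

theorem sum_antidiagonal_cutNumber_one_left (m L : ℕ) :
    ∑ q ∈ Finset.HasAntidiagonal.antidiagonal L, cutNumber True 0 1 q.1 * cutNumber True 0 m q.2 =
      cutNumber True 0 m L := by
  rw [Finset.sum_eq_single (0, L)]
  · simp [cutNumber_zero_one]
  · rintro ⟨a, b⟩ h hne
    rw [Finset.HasAntidiagonal.mem_antidiagonal] at h
    dsimp only at h
    have : a ≠ 0 := by
      rintro rfl
      exact hne (by simpa using h)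
    simp [cutNumber_zero_one, this]
  · simp

/-- Two rooted blocks of lengths `p` and `m + 1 - p` are two polygons; gluing them along their root
arcs gives a dissection of the `(m + 1)`-gon with the marked edge `(0, p)`. One of the two root arcs
disappears, hence `L + 1` arcs become `L` diagonals. The `m + 1` sides and `L` diagonals have `2 *
(m + 1 + L)` orientations, and by rotation each of the `m + 1` vertices starts equally many marked
edges. -/
theorem cutNumber_true_one (m L : ℕ) (hm : 2 ≤ m) :
    (m + 1) * cutNumber True 1 (m + 1) (L + 1) = 2 * (m + 1 + L) * (arcSystems m L).card := by
  have hend : cutNumber True 0 m (L + 1) = (arcSystems m L).card := by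
    rw [cutNumber_true_zero hm, if_neg (by omega), Nat.add_sub_cancel]
  have hmid : ∀ p, 2 ≤ p → p < m → ∑ q ∈ Finset.HasAntidiagonal.antidiagonal (L + 1),
      cutNumber True 0 p q.1 * cutNumber True 0 (m + 1 - p) q.2 =
        ((dissections (m + 1) L).filter fun E => chord (m + 1) 0 p ∈ E).card := by
    intro p hp hpm
    rw [card_dissections_succ_filter hp hpm.le, card_arcSystems_filter L hp hpm,
      Finset.Nat.sum_antidiagonal_succ', cutNumber_true_zero (m := m + 1 - p) (by omega),
      if_pos rfl, mul_zero, zero_add]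
    refine Finset.sum_congr rfl fun q _ => ?_
    rw [cutNumber_true_zero (m := m + 1 - p) (by omega), if_neg (by omega), Nat.add_sub_cancel]
  have hside : ∀ p, p < 2 ∨ p = m →
      ((dissections (m + 1) L).filter fun E => chord (m + 1) 0 p ∈ E).card = 0 := by
    intro p hp
    rw [Finset.card_eq_zero, Finset.filter_eq_empty_iff]
    intro E hE h
    have hd := (mem_dissections.1 hE).2.1 _ h
    rcases Nat.eq_zero_or_pos p with rfl | h0
    · exact hd.not_isDiag (Sym2.mk_isDiag_iff.2 (by simp))
    · have := (isDiagonal_chord_iff (n := m + 1) (by omega) (by push_cast; omega)).1 hd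
      push_cast at this
      omega
  have hd := sum_card_dissections_diagonal (m + 1) L
  rw [card_dissections_succ] at hd
  -- Writing `m = j + 2` isolates the `j` values of `p` that give diagonals. In the block sum, the
  -- extreme values `p = 0, m + 1` vanish, while `p = 1, m` correspond to the two sides at `0` and
  -- each contribute one full set of dissections.
  obtain ⟨j, rfl⟩ := Nat.exists_eq_add_of_le' hm
  rw [Finset.sum_range_succ, hside _ (Or.inr rfl), Finset.sum_range_succ', Finset.sum_range_succ',
    hside 0 (by omega), hside (0 + 1) (by omega)] at hd
  rw [cutNumber_succ, Finset.Nat.sum_antidiagonal_eq_sum_range_succ_mk]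
  rw [Finset.sum_range_succ, Finset.sum_range_succ, Finset.sum_range_succ', Finset.sum_range_succ']
  have e1 : ∑ q ∈ Finset.HasAntidiagonal.antidiagonal (L + 1),
      cutNumber True 0 0 q.1 * cutNumber True 0 (j + 2 + 1 - 0) q.2 = 0 := by
    simp [cutNumber_zero_left]
  have e2 : ∑ q ∈ Finset.HasAntidiagonal.antidiagonal (L + 1),
      cutNumber True 0 (j + 2 + 1) q.1 * cutNumber True 0 (j + 2 + 1 - (j + 2 + 1)) q.2 = 0 := by
    simp [cutNumber_zero_left]
  have e3 : ∑ q ∈ Finset.HasAntidiagonal.antidiagonal (L + 1),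
      cutNumber True 0 (0 + 1) q.1 * cutNumber True 0 (j + 2 + 1 - (0 + 1)) q.2 =
        (arcSystems (j + 2) L).card := by
    rw [← hend, ← sum_antidiagonal_cutNumber_one_left]
    rfl
  have e4 : ∑ q ∈ Finset.HasAntidiagonal.antidiagonal (L + 1),
      cutNumber True 0 (j + 2) q.1 * cutNumber True 0 (j + 2 + 1 - (j + 2)) q.2 =
        (arcSystems (j + 2) L).card := by
    rw [← hend, ← sum_antidiagonal_cutNumber_one_left, ← Finset.Nat.sum_antidiagonal_swap]
    refine Finset.sum_congr rfl fun q _ => ?_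
    rw [show j + 2 + 1 - (j + 2) = 1 by omega, mul_comm]
    rfl
  have e5 := Finset.sum_congr rfl fun i (hi : i ∈ Finset.range j) =>
    hmid (i + 1 + 1) (by omega) (by have := Finset.mem_range.1 hi; omega)
  rw [e1, e2, e3, e4, e5]
  linarith

/-! ### Rotation-invariant dissections and exposed vertices -/

theorem mem_move_chord {n : ℕ} {E : Finset (Sym2 (ZMod n))} (a b c : ℤ) :
    chord n (a + c) (b + c) ∈ move (.r (c : ZMod n)) E ↔ chord n a b ∈ E := by
  have := mem_move_r (i := (c : ZMod n)) (u := a) (v := b) (E := E)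
  rw [chord, Int.cast_add, Int.cast_add]
  exact this

theorem chord_add_mul_mem {n : ℕ} {E : Finset (Sym2 (ZMod n))} {c : ℤ}
    (hE : move (.r (c : ZMod n)) E = E) (a b z : ℤ) :
    chord n (a + z * c) (b + z * c) ∈ E ↔ chord n a b ∈ E := by
  have key : ∀ a b, chord n (a + c) (b + c) ∈ E ↔ chord n a b ∈ E := fun a b => by
    conv_lhs => rw [← hE]
    exact mem_move_chord a b c
  induction z with
  | zero => simp
  | succ z ih =>
    have e : ∀ x : ℤ, x + (z + 1) * c = x + z * c + c := fun x => by ring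
    rw [e, e]
    exact (key _ _).trans ih
  | pred z ih =>
    have e : ∀ x : ℤ, x + -z * c = x + (-z - 1) * c + c := fun x => by ring
    rw [e, e] at ih
    exact (key _ _).symm.trans ih

open Classical in
/-- The `k`-dissections of the `n`-gon that are invariant under rotation by `c`. -/
noncomputable def rotFixed (n k : ℕ) [NeZero n] (c : ZMod n) : Finset (Finset (Sym2 (ZMod n))) :=
  (dissections n k).filter fun E => move (.r c) E = E

theorem mem_rotFixed {n k : ℕ} [NeZero n] {c : ZMod n} {E : Finset (Sym2 (ZMod n))} :
    E ∈ rotFixed n k c ↔ IsDissection k E ∧ move (.r c) E = E := by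
  rw [rotFixed, Finset.mem_filter, mem_dissections]

open Classical in
/-- The vertices that are not cut off by a diagonal of `E` spanning at most `M` sides. -/
noncomputable def exposed {n : ℕ} [NeZero n] (M : ℕ) (E : Finset (Sym2 (ZMod n))) :
    Finset (ZMod n) :=
  Finset.univ.filter fun v => ∀ i j : ℕ, 0 < i → 0 < j → i + j ≤ M → s(v - i, v + j) ∉ E

theorem mem_exposed {n M : ℕ} [NeZero n] {E : Finset (Sym2 (ZMod n))} {v : ZMod n} :
    v ∈ exposed M E ↔ ∀ i j : ℕ, 0 < i → 0 < j → i + j ≤ M → s(v - i, v + j) ∉ E := by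
  simp [exposed]

theorem intCast_mem_exposed {n M : ℕ} [NeZero n] {E : Finset (Sym2 (ZMod n))} {v : ℤ} :
    (v : ZMod n) ∈ exposed M E ↔
      ∀ a b : ℤ, a < v → v < b → b ≤ a + M → chord n a b ∉ E := by
  rw [mem_exposed]
  constructor
  · intro h a b h1 h2 h3 hE
    obtain ⟨i, hi⟩ := Int.eq_ofNat_of_zero_le (show 0 ≤ v - a by omega)
    obtain ⟨j, hj⟩ := Int.eq_ofNat_of_zero_le (show 0 ≤ b - v by omega)
    refine h i j (by omega) (by omega) (by omega) ?_
    obtain rfl : a = v - i := by omega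
    obtain rfl : b = v + j := by omega
    simpa [chord] using hE
  · intro h i j hi hj hij hE
    refine h (v - i) (v + j) (by omega) (by omega) (by omega) ?_
    simpa [chord] using hE

theorem add_mem_exposed_move {n M : ℕ} [NeZero n] {E : Finset (Sym2 (ZMod n))} {v c : ZMod n} :
    v + c ∈ exposed M (move (.r c) E) ↔ v ∈ exposed M E := by
  rw [mem_exposed, mem_exposed]
  refine forall_congr' fun i => forall_congr' fun j => forall_congr' fun _ =>
    forall_congr' fun _ => forall_congr' fun _ => not_congr ?_
  rw [show v + c - i = v - i + c by ring, show v + c + j = v + j + c by ring]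
  exact mem_move_r

theorem exposed_move {n M : ℕ} [NeZero n] (E : Finset (Sym2 (ZMod n))) (c : ZMod n) :
    exposed M (move (.r c) E) = (exposed M E).map (Equiv.addRight c).toEmbedding := by
  ext v
  have := add_mem_exposed_move (M := M) (E := E) (v := v - c) (c := c)
  rw [sub_add_cancel] at this
  rw [this, Finset.mem_map_equiv, Equiv.addRight_symm, Equiv.coe_addRight, sub_eq_add_neg]

/-- If every vertex were cut off, the left endpoint of a short diagonal would be cut off by another
short diagonal. Not crossing the former, the latter would have to reach at least as far to the
right, and so be strictly longer. Iterating exceeds the length bound `M`. -/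
theorem IsDissection.exposed_nonempty {n k M : ℕ} [NeZero n] {E : Finset (Sym2 (ZMod n))}
    (h : IsDissection k E) (hM : 2 * M ≤ n) : (exposed M E).Nonempty := by
  by_contra hne
  rw [Finset.not_nonempty_iff_eq_empty] at hne
  have hcov : ∀ v : ℤ, ∃ a b : ℤ, a < v ∧ v < b ∧ b ≤ a + M ∧ chord n a b ∈ E := fun v => by
    have hv : (v : ZMod n) ∉ exposed M E := by
      rw [hne]
      exact Finset.notMem_empty _
    rw [intCast_mem_exposed] at hv
    push Not at hv
    exact hv
  have key : ∀ l : ℕ, ∃ a b : ℤ, a + l ≤ b ∧ a < b ∧ b ≤ a + M ∧ chord n a b ∈ E := by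
    intro l
    induction l with
    | zero =>
      obtain ⟨a, b, h1, h2, h3, h4⟩ := hcov 0
      exact ⟨a, b, by omega, by omega, h3, h4⟩
    | succ l ih =>
      obtain ⟨a, b, h1, h2, h3, h4⟩ := ih
      obtain ⟨a', b', g1, g2, g3, g4⟩ := hcov a
      refine ⟨a', b', ?_, by omega, g3, g4⟩
      by_contra hlt
      exact h.not_crossing (a := a') (b := a) (c := b') (d := b) g1 g2 (by push_cast at hlt; omega)
        (by push_cast at hlt; omega) g4 h4
  obtain ⟨a, b, h1, h2, h3, -⟩ := key (M + 1)
  push_cast at h1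
  omega

theorem move_r_comm {n : ℕ} (c c' : ZMod n) (E : Finset (Sym2 (ZMod n))) :
    move (.r c) (move (.r c') E) = move (.r c') (move (.r c) E) := by
  rw [← move_mul, ← move_mul, DihedralGroup.r_mul_r, DihedralGroup.r_mul_r, add_comm]

theorem move_injective {n : ℕ} (g : DihedralGroup n) :
    Function.Injective (move g : Finset (Sym2 (ZMod n)) → _) := fun E F h => by
  have := congrArg (move g⁻¹) h
  rwa [← move_mul, ← move_mul, inv_mul_cancel, move_one, move_one] at this

theorem sum_rotFixed_move {n k : ℕ} [NeZero n] {R : Type*} [AddCommMonoid R] (c c' : ZMod n)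
    (F : Finset (Sym2 (ZMod n)) → R) :
    ∑ E ∈ rotFixed n k c, F (move (.r c') E) = ∑ E ∈ rotFixed n k c, F E := by
  rw [rotFixed, Finset.sum_filter, Finset.sum_filter,
    ← sum_dissections_move (.r c') fun E => if move (.r c) E = E then F E else 0]
  refine Finset.sum_congr rfl fun E _ => ?_
  simp only [move_r_comm c c', (move_injective _).eq_iff]

/-- Each dissection spreads total weight `1` evenly over its exposed vertices. Rotations commute
with the rotation by `c`, so they permute the invariant dissections, and all `n` vertices collect
the same weight as `0`. -/
theorem card_rotFixed {n k M : ℕ} [NeZero n] (c : ZMod n) (hM : 2 * M ≤ n) :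
    ((rotFixed n k c).card : ℚ) =
      n * ∑ E ∈ (rotFixed n k c).filter fun E => 0 ∈ exposed M E,
        ((exposed M E).card : ℚ)⁻¹ := by
  have h1 : ((rotFixed n k c).card : ℚ) = ∑ E ∈ rotFixed n k c, ∑ v : ZMod n,
      if v ∈ exposed M E then ((exposed M E).card : ℚ)⁻¹ else 0 := by
    rw [Finset.card_eq_sum_ones, Nat.cast_sum]
    refine Finset.sum_congr rfl fun E hE => ?_
    have hne := (mem_rotFixed.1 hE).1.exposed_nonempty hM
    rw [Finset.sum_ite_mem, Finset.univ_inter, Finset.sum_const, nsmul_eq_mul, Nat.cast_one,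
      mul_inv_cancel₀]
    exact_mod_cast hne.card_pos.ne'
  have h2 : ∀ v : ZMod n, ∑ E ∈ rotFixed n k c,
      (if v ∈ exposed M E then ((exposed M E).card : ℚ)⁻¹ else 0) =
        ∑ E ∈ (rotFixed n k c).filter fun E => 0 ∈ exposed M E, ((exposed M E).card : ℚ)⁻¹ := by
    intro v
    rw [← sum_rotFixed_move c v, Finset.sum_filter]
    refine Finset.sum_congr rfl fun E _ => ?_
    have := add_mem_exposed_move (M := M) (E := E) (v := 0) (c := v)
    rw [zero_add] at this
    by_cases h : 0 ∈ exposed M E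
    · rw [if_pos (this.2 h), if_pos h, exposed_move, Finset.card_map]
    · rw [if_neg (mt this.1 h), if_neg h]
  rw [h1, Finset.sum_comm, Finset.sum_congr rfl fun v _ => h2 v, Finset.sum_const,
    Finset.card_univ, ZMod.card, nsmul_eq_mul]

/-! ### Rotation-invariant dissections as periodic arc systems -/

open Classical in
/-- The set of all chords of the `n`-gon that are translates of an arc of `Q` by multiples
of `M`. -/
noncomputable def periodize (n M : ℕ) [NeZero n] (Q : Finset (ℕ × ℕ)) : Finset (Sym2 (ZMod n)) :=
  Finset.univ.filter fun x => ∃ e ∈ Q, ∃ s : ℤ, x = chord n (e.1 + s * M) (e.2 + s * M)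

theorem mem_periodize {n M : ℕ} [NeZero n] {Q : Finset (ℕ × ℕ)} {x : Sym2 (ZMod n)} :
    x ∈ periodize n M Q ↔ ∃ e ∈ Q, ∃ s : ℤ, x = chord n (e.1 + s * M) (e.2 + s * M) := by
  simp [periodize]

theorem mul_le_neg {M z : ℤ} (hM : 0 ≤ M) (hz : z ≤ -1) : z * M ≤ -M := by nlinarith

theorem le_mul_of_one_le {M z : ℤ} (hM : 0 ≤ M) (hz : 1 ≤ z) : M ≤ z * M := by nlinarith

theorem mem_periodize_short {n d M : ℕ} [NeZero n] {Q : Finset (ℕ × ℕ)} (hQ : IsArcSystem M Q)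
    (hn : n = d * M) (hd : 2 ≤ d) {a b : ℤ} (hab : a < b) (hba : b ≤ a + M) :
    chord n a b ∈ periodize n M Q ↔ ∃ e ∈ Q, ∃ z : ℤ, a = e.1 + z * M ∧ b = e.2 + z * M := by
  have hn' : (n : ℤ) = d * M := by exact_mod_cast hn
  have hM : 2 * M ≤ n := by
    rw [hn]
    exact Nat.mul_le_mul_right M hd
  rw [mem_periodize]
  constructor
  · rintro ⟨e, he, s, hs⟩
    have h1 := hQ.1 e he
    obtain ⟨t, ⟨h2, h3⟩ | ⟨h2, h3⟩⟩ := chord_eq_cases hs (by omega) (by omega) (by omega) (by omega)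
    · refine ⟨e, he, s - t * d, ?_, ?_⟩
      · rw [hn'] at h2
        linear_combination -h2
      · rw [hn'] at h3
        linear_combination -h3
    -- The complementary path has length at least `n - M ≥ M`, so this branch forces `n = 2 * M` and
    -- `e = (0, M)`: the chord is a diameter, and translation by `M` exchanges its endpoints.
    · have h4 : (e.1 : ℤ) = 0 := by omega
      have h5 : (e.2 : ℤ) = M := by omega
      have h6 : (n : ℤ) = 2 * M := by omega
      refine ⟨e, he, s - 2 * t - 1, ?_, ?_⟩
      · rw [h6] at h2 h3
        linear_combination -h3 + h5 - h4
      · rw [h6] at h2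
        linear_combination -h2 + h4 - h5
  · rintro ⟨e, he, z, rfl, rfl⟩
    exact ⟨e, he, z, rfl⟩

theorem IsArcSystem.isDissection_periodize {n d M : ℕ} [NeZero n] {Q : Finset (ℕ × ℕ)}
    (hQ : IsArcSystem M Q) (hn : n = d * M) (hd : 2 ≤ d) :
    IsDissection (periodize n M Q).card (periodize n M Q) := by
  have hn' : (n : ℤ) = d * M := by exact_mod_cast hn
  have hM : 2 * M ≤ n := by
    rw [hn]
    exact Nat.mul_le_mul_right M hd
  refine isDissection_of_reps
    {p | ∃ e ∈ Q, ∃ s : ℤ, p = ((e.1 : ℤ) + s * M, (e.2 : ℤ) + s * M)} ?_ ?_ ?_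
  · intro x hx
    obtain ⟨e, he, s, rfl⟩ := mem_periodize.1 hx
    exact ⟨_, ⟨e, he, s, rfl⟩, rfl⟩
  · rintro p ⟨e, he, s, rfl⟩
    have := hQ.1 e he
    dsimp only
    omega
  · rintro p ⟨e, he, s, rfl⟩ q ⟨f, hf, s', rfl⟩ t ht
    dsimp only at ht
    have h1 := hQ.1 e he
    have h2 := hQ.1 f hf
    have h3 : s' * M + t * n = s * M + (s' + t * d - s) * M := by
      rw [hn']
      ring
    rw [add_assoc, add_assoc, h3] at ht
    generalize s' + t * d - s = z at ht
    rcases lt_trichotomy z 0 with hz | rfl | hz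
    · have := mul_le_neg (M := M) (by omega) (show z ≤ -1 by omega)
      omega
    · exact hQ.2 e he f hf (by omega)
    · have := le_mul_of_one_le (M := M) (by omega) (show 1 ≤ z by omega)
      omega

theorem move_periodize {n M : ℕ} [NeZero n] (Q : Finset (ℕ × ℕ)) :
    move (.r (M : ZMod n)) (periodize n M Q) = periodize n M Q := by
  refine Finset.eq_of_subset_of_card_le (fun x hx => ?_) ?_
  · obtain ⟨y, hy, rfl⟩ := Finset.mem_image.1 hx
    obtain ⟨e, he, s, rfl⟩ := mem_periodize.1 hy
    refine mem_periodize.2 ⟨e, he, s + 1, ?_⟩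
    have := map_add_chord (n := n) (e.1 + s * M) (e.2 + s * M) M
    rw [Int.cast_natCast] at this
    refine this.trans ?_
    ring_nf
  · rw [move, Finset.card_image_of_injective _ (Sym2.map.injective (Equiv.injective _))]

theorem IsArcSystem.arcsOf_periodize {n d M : ℕ} [NeZero n] {Q : Finset (ℕ × ℕ)}
    (hQ : IsArcSystem M Q) (hn : n = d * M) (hd : 2 ≤ d) : arcsOf n M (periodize n M Q) = Q := by
  ext e
  rw [mem_arcsOf]
  constructor
  · rintro ⟨h1, h2, h3⟩
    rw [mem_periodize_short hQ hn hd (by omega) (by omega)] at h3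
    obtain ⟨f, hf, z, h4, h5⟩ := h3
    have h6 := hQ.1 f hf
    rcases lt_trichotomy z 0 with hz | rfl | hz
    · have := mul_le_neg (M := M) (by omega) (show z ≤ -1 by omega)
      omega
    · rwa [show e = f from Prod.ext (by omega) (by omega)]
    · have := le_mul_of_one_le (M := M) (by omega) (show 1 ≤ z by omega)
      omega
  · intro he
    have h1 := hQ.1 e he
    exact ⟨h1.1, h1.2, mem_periodize.2 ⟨e, he, 0, by simp⟩⟩

theorem IsArcSystem.mem_exposed_periodize {n d M : ℕ} [NeZero n] {Q : Finset (ℕ × ℕ)}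
    (hQ : IsArcSystem M Q) (hn : n = d * M) (hd : 2 ≤ d) {x : ℕ} (hx : x < M) (s : ℤ) :
    ((x + s * M : ℤ) : ZMod n) ∈ exposed M (periodize n M Q) ↔ ¬ Covers Q x := by
  rw [intCast_mem_exposed]
  constructor
  · rintro h ⟨e, he, h1, h2⟩
    have h3 := hQ.1 e he
    exact h (e.1 + s * M) (e.2 + s * M) (by omega) (by omega) (by omega)
      (mem_periodize.2 ⟨e, he, s, rfl⟩)
  · intro h a b h1 h2 h3 hE
    rw [mem_periodize_short hQ hn hd (by omega) (by omega)] at hE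
    obtain ⟨e, he, z, rfl, rfl⟩ := hE
    have h4 := hQ.1 e he
    have h5 : z * M = s * M + (z - s) * M := by ring
    rw [h5] at h1 h2
    generalize z - s = w at h1 h2
    rcases lt_trichotomy w 0 with hz | rfl | hz
    · have := mul_le_neg (M := M) (by omega) (show w ≤ -1 by omega)
      omega
    · exact h ⟨e, he, by omega, by omega⟩
    · have := le_mul_of_one_le (M := M) (by omega) (show 1 ≤ w by omega)
      omega

/-- Every diagonal, read along its shorter side, has a translate by a multiple of `M` inside `[0,
M]`. It spans at most `M` sides, as otherwise it crosses its own rotate, and it does not pass over a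
multiple of `M`, because `0` and hence all its translates are exposed. -/
theorem IsDissection.periodize_arcsOf {n k d M : ℕ} [NeZero n] {E : Finset (Sym2 (ZMod n))}
    (h : IsDissection k E) (hn : n = d * M) (hd : 2 ≤ d) (hE : move (.r (M : ZMod n)) E = E)
    (h0 : 0 ∈ exposed M E) : periodize n M (arcsOf n M E) = E := by
  have hM : 2 * M ≤ n := by
    rw [hn]
    exact Nat.mul_le_mul_right M hd
  have hn0 : 0 < n := Nat.pos_of_ne_zero (NeZero.ne n)
  have hM0 : 0 < M := Nat.pos_of_ne_zero fun hM0 => by simp [hM0] at hn; omega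
  have hshift := chord_add_mul_mem (c := (M : ℤ)) (by rwa [Int.cast_natCast]) (E := E)
  have h0' := (intCast_mem_exposed (M := M) (E := E) (v := 0)).1 (by simpa using h0)
  have hshort : ∀ a b : ℤ, a + 2 ≤ b → 2 * (b - a) ≤ n → chord n a b ∈ E →
      chord n a b ∈ periodize n M (arcsOf n M E) := by
    intro a b hab hba habE
    -- A longer chord, of span at most `n / 2`, would cross its rotate by `M`.
    have hle : b ≤ a + M := by
      by_contra hlt
      refine h.not_crossing (a := a) (b := a + M) (c := b) (d := b + M) ?_ ?_ ?_ ?_ habE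
        (by simpa using (hshift a b 1).2 habE) <;> omega
    have hdm := Int.emod_add_mul_ediv a M
    have h1 := Int.emod_nonneg a (show (M : ℤ) ≠ 0 by omega)
    have h2 := Int.emod_lt_of_pos a (show (0 : ℤ) < M by omega)
    set x := a % M with hx
    set z := a / M with hz
    rw [mul_comm] at hdm
    -- Otherwise the translate whose left endpoint lies in `[-M, 0)` cuts off the exposed vertex
    -- `0`.
    have hb : b - z * M ≤ M := by
      by_contra hlt
      refine h0' (x - M) (b - z * M - M) (by omega) (by omega) (by omega) ?_
      have := hshift a b (-z - 1)
      rw [show a + (-z - 1) * M = x - M by rw [← hdm]; ring,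
        show b + (-z - 1) * M = b - z * M - M by ring] at this
      exact this.2 habE
    obtain ⟨i, hi⟩ := Int.eq_ofNat_of_zero_le h1
    obtain ⟨j, hj⟩ := Int.eq_ofNat_of_zero_le (show 0 ≤ b - z * M by omega)
    refine mem_periodize.2 ⟨(i, j), mem_arcsOf.2 ⟨by dsimp only; omega, by dsimp only; omega, ?_⟩,
      z, ?_⟩
    · dsimp only
      rw [← hshift _ _ z, show (i : ℤ) + z * M = a by omega, show (j : ℤ) + z * M = b by omega]
      exact habE
    · dsimp only
      rw [show (i : ℤ) + z * M = a by omega, show (j : ℤ) + z * M = b by omega]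
  ext x
  constructor
  · intro hx
    obtain ⟨e, he, s, rfl⟩ := mem_periodize.1 hx
    exact (hshift _ _ s).2 (mem_arcsOf.1 he).2.2
  · intro hx
    obtain ⟨a, b, h1, h2, h3, rfl⟩ := (h.2.1 x hx).exists_chord
    rcases le_total (2 * ((b : ℤ) - a)) n with hle | hle
    · exact hshort a b (by omega) hle hx
    · have hsw : chord n a b = chord n b (a + n) := by
        rw [chord_comm]
        simpa using (chord_add_mul n b a 0 1).symm
      rw [hsw] at hx ⊢
      exact hshort b (a + n) (by omega) (by omega) hx

/-! ### Counting rotation-invariant dissections by free points -/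

open Classical in
/-- The interior points of `[0, M]` that are not covered by an arc of `Q`. -/
noncomputable def freePoints (M : ℕ) (Q : Finset (ℕ × ℕ)) : Finset ℕ :=
  (Finset.Ioo 0 M).filter fun x => ¬ Covers Q x

theorem mem_freePoints {M x : ℕ} {Q : Finset (ℕ × ℕ)} :
    x ∈ freePoints M Q ↔ 0 < x ∧ x < M ∧ ¬ Covers Q x := by
  classical
  rw [freePoints, Finset.mem_filter, Finset.mem_Ioo, and_assoc]

open Classical in
/-- All arc systems on `0, …, M`. -/
noncomputable def allArcSystems (M : ℕ) : Finset (Finset (ℕ × ℕ)) :=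
  (Finset.range (M + 1) ×ˢ Finset.range (M + 1)).powerset.filter fun Q => IsArcSystem M Q

theorem mem_allArcSystems {M : ℕ} {Q : Finset (ℕ × ℕ)} :
    Q ∈ allArcSystems M ↔ IsArcSystem M Q := by
  classical
  rw [allArcSystems, Finset.mem_filter, and_iff_right_iff_imp]
  exact fun h => Finset.mem_powerset.2 h.subset

theorem isCut_true_iff {M : ℕ} {P : Finset ℕ} {Q : Finset (ℕ × ℕ)} :
    IsCut True M P Q ↔ IsArcSystem M Q ∧ P = freePoints M Q := by
  constructor
  · intro h
    refine ⟨h.arcs, Finset.ext fun x => ?_⟩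
    rw [mem_freePoints]
    refine ⟨fun hx => ⟨h.pos x hx, h.lt x hx, h.free x hx⟩, fun hx => ?_⟩
    by_contra hxP
    exact hx.2.2 (h.full trivial x hx.1 hx.2.1 hxP)
  · rintro ⟨h, rfl⟩
    refine ⟨fun p hp => (mem_freePoints.1 hp).1, fun p hp => (mem_freePoints.1 hp).2.1, h,
      fun p hp => (mem_freePoints.1 hp).2.2, fun _ x hx hxM hxP => ?_⟩
    by_contra hc
    exact hxP (mem_freePoints.2 ⟨hx, hxM, hc⟩)

theorem card_filter_freePoints {M : ℕ} (r K : ℕ) (hM : 0 < M) :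
    ((allArcSystems M).filter fun Q => Q.card = K ∧ (freePoints M Q).card = r).card =
      cutNumber True r M K := by
  rw [cutNumber, if_neg hM.ne']
  refine Finset.card_nbij' (fun Q => (freePoints M Q, Q)) (fun z => z.2) ?_ ?_ ?_ ?_
  · intro Q hQ
    rw [Finset.mem_coe, Finset.mem_filter, mem_allArcSystems] at hQ
    exact mem_cuts.2 ⟨isCut_true_iff.2 ⟨hQ.1, rfl⟩, hQ.2.2, hQ.2.1⟩
  · intro z hz
    obtain ⟨h1, h2, h3⟩ := mem_cuts.1 (Finset.mem_coe.1 hz)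
    obtain ⟨h4, h5⟩ := isCut_true_iff.1 h1
    rw [Finset.mem_coe, Finset.mem_filter, mem_allArcSystems]
    exact ⟨h4, h3, by rw [← h5]; exact h2⟩
  · intro Q hQ
    rfl
  · intro z hz
    obtain ⟨h1, h2, h3⟩ := mem_cuts.1 (Finset.mem_coe.1 hz)
    exact Prod.ext (isCut_true_iff.1 h1).2.symm rfl

theorem card_freePoints_lt {M : ℕ} (Q : Finset (ℕ × ℕ)) (hM : 0 < M) :
    (freePoints M Q).card < M := by
  have h1 : (freePoints M Q).card ≤ (Finset.Ioo 0 M).card :=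
    Finset.card_le_card fun x hx =>
      Finset.mem_Ioo.2 ⟨(mem_freePoints.1 hx).1, (mem_freePoints.1 hx).2.1⟩
  rw [Nat.card_Ioo] at h1
  omega

theorem sum_freePoints {M : ℕ} (K : ℕ) (hM : 0 < M) (f : ℕ → ℚ) :
    ∑ Q ∈ (allArcSystems M).filter (fun Q => Q.card = K), f (freePoints M Q).card =
      ∑ r ∈ Finset.range M, f r * cutNumber True r M K := by
  rw [← Finset.sum_fiberwise_of_maps_to (t := Finset.range M)
    (g := fun Q => (freePoints M Q).card)
    (fun Q _ => Finset.mem_range.2 (card_freePoints_lt Q hM))]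
  refine Finset.sum_congr rfl fun r _ => ?_
  rw [Finset.sum_congr rfl fun Q hQ => by rw [(Finset.mem_filter.1 hQ).2], Finset.sum_const,
    Finset.filter_filter, card_filter_freePoints r K hM, nsmul_eq_mul, mul_comm]

/-- This separates the one-block case `r = 0`, the only one in which a half-turn can fix a diameter.
-/
theorem IsArcSystem.root_mem_iff_freePoints {M : ℕ} {Q : Finset (ℕ × ℕ)} (h : IsArcSystem M Q)
    (hM : 2 ≤ M) : (0, M) ∈ Q ↔ (freePoints M Q).card = 0 := by
  rw [h.root_mem_iff hM, Finset.card_eq_zero, Finset.eq_empty_iff_forall_notMem]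
  refine forall_congr' fun x => ?_
  rw [mem_freePoints]
  tauto

/-- The exposed vertices are the `d` translates of `0` and of the free interior points. -/
theorem IsArcSystem.card_exposed_periodize {n d M : ℕ} [NeZero n] {Q : Finset (ℕ × ℕ)}
    (hQ : IsArcSystem M Q) (hn : n = d * M) (hd : 2 ≤ d) :
    (exposed M (periodize n M Q)).card = d * ((freePoints M Q).card + 1) := by
  have hn0 : 0 < n := Nat.pos_of_ne_zero (NeZero.ne n)
  have hM0 : 0 < M := Nat.pos_of_ne_zero fun hM0 => by simp [hM0] at hn; omega
  have h0 : ¬ Covers Q 0 := by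
    rintro ⟨e, -, he, -⟩
    omega
  have hU : (insert 0 (freePoints M Q)).card = (freePoints M Q).card + 1 :=
    Finset.card_insert_of_notMem fun h => absurd (mem_freePoints.1 h).1 (by omega)
  have hmem : ∀ x, x ∈ insert 0 (freePoints M Q) ↔ x < M ∧ ¬ Covers Q x := fun x => by
    rw [Finset.mem_insert, mem_freePoints]
    rcases Nat.eq_zero_or_pos x with rfl | hx
    · simp [h0, hM0]
    · simp [hx, hx.ne']
  have hcast : ∀ s x : ℕ, ((x + s * M : ℕ) : ZMod n) = ((x + (s : ℤ) * M : ℤ) : ZMod n) :=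
    fun s x => by push_cast; rfl
  rw [← hU, ← Finset.card_range d, ← Finset.card_product]
  symm
  refine Finset.card_nbij' (fun w => ((w.2 + w.1 * M : ℕ) : ZMod n))
    (fun v => (v.val / M, v.val % M)) ?_ ?_ ?_ ?_
  · rintro ⟨s, x⟩ hw
    rw [Finset.mem_coe, Finset.mem_product, hmem] at hw
    dsimp only at hw ⊢
    rw [hcast]
    exact (hQ.mem_exposed_periodize hn hd hw.2.1 s).2 hw.2.2
  · intro v hv
    rw [Finset.mem_coe, Finset.mem_product, hmem, Finset.mem_range]
    have h1 := Nat.mod_lt v.val hM0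
    refine ⟨?_, h1, ?_⟩
    · rw [Nat.div_lt_iff_lt_mul hM0, ← hn]
      exact ZMod.val_lt v
    · rw [← hQ.mem_exposed_periodize hn hd h1 ((v.val / M : ℕ) : ℤ), ← hcast, mul_comm,
        Nat.mod_add_div, ZMod.natCast_zmod_val]
      exact hv
  · rintro ⟨s, x⟩ hw
    rw [Finset.mem_coe, Finset.mem_product, hmem, Finset.mem_range] at hw
    dsimp only at hw ⊢
    rw [ZMod.val_cast_of_lt]
    · rw [Nat.add_mul_div_right _ _ hM0, Nat.add_mul_mod_self_right, Nat.div_eq_of_lt hw.2.1,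
        Nat.mod_eq_of_lt hw.2.1, zero_add]
    · rw [hn]
      nlinarith [hw.1, hw.2.1]
  · intro v hv
    dsimp only
    rw [mul_comm, Nat.mod_add_div, ZMod.natCast_zmod_val]

/-- The `d` translates of an arc are distinct chords, and so are those of different arcs. The only
possible coincidence reverses a chord, which makes it a diameter and is what the last hypothesis
excludes. -/
theorem IsArcSystem.card_periodize {n d M : ℕ} [NeZero n] {Q : Finset (ℕ × ℕ)}
    (hQ : IsArcSystem M Q) (hn : n = d * M) (hd : 2 ≤ d) (h : d ≠ 2 ∨ (0, M) ∉ Q) :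
    (periodize n M Q).card = d * Q.card := by
  have hn' : (n : ℤ) = d * M := by exact_mod_cast hn
  have hM : 2 * M ≤ n := by
    rw [hn]
    exact Nat.mul_le_mul_right M hd
  have hn0 : 0 < n := Nat.pos_of_ne_zero (NeZero.ne n)
  have hM0 : 0 < M := Nat.pos_of_ne_zero fun hM0 => by simp [hM0] at hn; omega
  rw [← Finset.card_range d, ← Finset.card_product]
  symm
  refine Finset.card_nbij (fun w => chord n (w.2.1 + (w.1 : ℤ) * M) (w.2.2 + (w.1 : ℤ) * M))
    ?_ ?_ ?_
  · rintro ⟨s, e⟩ hw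
    exact mem_periodize.2 ⟨e, (Finset.mem_product.1 hw).2, s, rfl⟩
  · rintro ⟨s, e⟩ hw ⟨s', e'⟩ hw' hch
    rw [Finset.mem_coe, Finset.mem_product, Finset.mem_range] at hw hw'
    dsimp only at hw hw' hch
    have h1 := hQ.1 e hw.2
    have h2 := hQ.1 e' hw'.2
    obtain ⟨t, ⟨h3, h4⟩ | ⟨h3, h4⟩⟩ := chord_eq_cases hch (by omega) (by omega) (by omega)
      (by omega)
    · have h5 : (s : ℤ) * M + t * n = s' * M + (s + t * d - s') * M := by
        rw [hn']
        ring
      rw [add_assoc, h5] at h3 h4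
      obtain hz : s + t * d - (s' : ℤ) = 0 := by
        generalize s + t * d - (s' : ℤ) = z at h3 h4
        rcases lt_trichotomy z 0 with hz | hz | hz
        · have := mul_le_neg (M := M) (by omega) (show z ≤ -1 by omega)
          omega
        · exact hz
        · have := le_mul_of_one_le (M := M) (by omega) (show 1 ≤ z by omega)
          omega
      have ht : t = 0 := eq_zero_of_mul_lt (n := d) (by omega) (by omega)
      rw [hz] at h3 h4
      rw [ht] at hz
      exact Prod.ext (by dsimp only; omega) (Prod.ext (by dsimp only; omega)
        (by dsimp only; omega))
    · exfalso
      have h5 : (e.1 : ℤ) = 0 := by omega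
      have h6 : (e.2 : ℤ) = M := by omega
      have h7 : (n : ℤ) = 2 * M := by omega
      rcases h with h | h
      · have : (d : ℤ) = 2 := by
          rw [hn'] at h7
          exact mul_right_cancel₀ (by exact_mod_cast hM0.ne') h7
        exact h (by exact_mod_cast this)
      · exact h (by rw [show (0, M) = e from Prod.ext (by dsimp only; omega)
          (by dsimp only; omega)]; exact hw.2)
  · intro x hx
    obtain ⟨e, he, s, rfl⟩ := mem_periodize.1 hx
    have h1 := Int.emod_nonneg s (show (d : ℤ) ≠ 0 by omega)
    have h2 := Int.emod_lt_of_pos s (show (0 : ℤ) < d by omega)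
    have h3 := Int.emod_add_mul_ediv s d
    obtain ⟨i, hi⟩ := Int.eq_ofNat_of_zero_le h1
    refine ⟨(i, e), ?_, ?_⟩
    · rw [Finset.mem_coe, Finset.mem_product, Finset.mem_range]
      exact ⟨by dsimp only; omega, he⟩
    · dsimp only
      rw [← chord_add_mul n _ _ (s / d) (s / d)]
      have h4 : (i : ℤ) * M + s / d * n = s * M := by
        rw [hn', show (i : ℤ) = s % d from hi.symm]
        linear_combination (M : ℤ) * h3
      rw [add_assoc, add_assoc, h4]

/-- The root arc is a diameter, fixed by the half-turn, so its two translates are one chord. -/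
theorem IsArcSystem.card_periodize_root {n M : ℕ} [NeZero n] {Q : Finset (ℕ × ℕ)}
    (hQ : IsArcSystem M Q) (hn : n = 2 * M) (h : (0, M) ∈ Q) :
    (periodize n M Q).card + 1 = 2 * Q.card := by
  have hQ' := hQ.mono (Finset.erase_subset (0, M) Q)
  have h1 := hQ'.card_periodize hn le_rfl (Or.inr (Finset.notMem_erase _ _))
  have hroot := hQ.1 _ h
  dsimp only at hroot
  have hn' : (n : ℤ) = 2 * M := by exact_mod_cast hn
  have h2 : chord n 0 M ∉ periodize n M (Q.erase (0, M)) := by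
    rw [mem_periodize_short hQ' hn le_rfl (by omega) (by omega)]
    rintro ⟨e, he, z, h3, h4⟩
    have h5 := hQ'.1 e he
    rcases lt_trichotomy z 0 with hz | rfl | hz
    · have := mul_le_neg (M := M) (by omega) (show z ≤ -1 by omega)
      omega
    · rw [show e = (0, M) from Prod.ext (by dsimp only; omega) (by dsimp only; omega)] at he
      exact Finset.notMem_erase _ _ he
    · have := le_mul_of_one_le (M := M) (by omega) (show 1 ≤ z by omega)
      omega
  have h3 : periodize n M Q = insert (chord n 0 M) (periodize n M (Q.erase (0, M))) := by
    ext x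
    rw [Finset.mem_insert, mem_periodize, mem_periodize]
    constructor
    · rintro ⟨e, he, s, rfl⟩
      by_cases h0 : e = (0, M)
      · left
        subst h0
        -- Every translate of the root arc is the same diameter, with its endpoints exchanged when
        -- `s` is odd.
        rcases Int.even_or_odd' s with ⟨t, rfl | rfl⟩
        · rw [← chord_add_mul n 0 M t t, hn']
          push_cast
          ring_nf
        · rw [chord_comm, ← chord_add_mul n 0 M (t + 1) t, hn']
          push_cast
          ring_nf
      · exact Or.inr ⟨e, Finset.mem_erase.2 ⟨h0, he⟩, s, rfl⟩
    · rintro (rfl | ⟨e, he, s, rfl⟩)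
      · exact ⟨_, h, 0, by simp⟩
      · exact ⟨e, Finset.mem_of_mem_erase he, s, rfl⟩
  rw [h3, Finset.card_insert_of_notMem h2, h1, Finset.card_erase_of_mem h]
  have := Finset.card_pos.2 ⟨_, h⟩
  omega

/-- The weight arises as `n / (d * (r + 1)) = M / (r + 1)`, with `r` the number of free points. -/
theorem card_rotFixed_eq_sum {n d M : ℕ} [NeZero n] (k : ℕ) (hn : n = d * M) (hd : 2 ≤ d) :
    ((rotFixed n k (M : ZMod n)).card : ℚ) =
      ∑ Q ∈ (allArcSystems M).filter (fun Q => (periodize n M Q).card = k),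
        (M : ℚ) / ((freePoints M Q).card + 1) := by
  have hM : 2 * M ≤ n := by
    rw [hn]
    exact Nat.mul_le_mul_right M hd
  have hn0 : 0 < n := Nat.pos_of_ne_zero (NeZero.ne n)
  have hM0 : 0 < M := Nat.pos_of_ne_zero fun hM0 => by simp [hM0] at hn; omega
  have hd' : (d : ℚ) ≠ 0 := by
    have : d ≠ 0 := by omega
    exact_mod_cast this
  rw [card_rotFixed _ hM, Finset.mul_sum]
  refine Finset.sum_nbij' (arcsOf n M) (periodize n M) ?_ ?_ ?_ ?_ ?_
  · intro E hE
    rw [Finset.mem_filter, mem_rotFixed] at hE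
    rw [Finset.mem_filter, mem_allArcSystems, hE.1.1.periodize_arcsOf hn hd hE.1.2 hE.2]
    exact ⟨hE.1.1.isArcSystem (by omega), hE.1.1.1⟩
  · intro Q hQ
    rw [Finset.mem_filter, mem_allArcSystems] at hQ
    rw [Finset.mem_filter, mem_rotFixed]
    refine ⟨⟨?_, move_periodize Q⟩, ?_⟩
    · rw [← hQ.2]
      exact hQ.1.isDissection_periodize hn hd
    · have := (hQ.1.mem_exposed_periodize hn hd hM0 0).2 (by rintro ⟨e, -, he, -⟩; omega)
      simpa using this
  · intro E hE
    rw [Finset.mem_filter, mem_rotFixed] at hE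
    exact hE.1.1.periodize_arcsOf hn hd hE.1.2 hE.2
  · intro Q hQ
    rw [Finset.mem_filter, mem_allArcSystems] at hQ
    exact hQ.1.arcsOf_periodize hn hd
  · intro E hE
    rw [Finset.mem_filter, mem_rotFixed] at hE
    have h1 := (hE.1.1.isArcSystem (M := M) (by omega)).card_exposed_periodize hn hd
    rw [hE.1.1.periodize_arcsOf hn hd hE.1.2 hE.2] at h1
    rw [h1]
    have hnq : (n : ℚ) = d * M := by exact_mod_cast hn
    rw [hnq]
    push_cast
    field_simp

theorem card_rotFixed_mul {n d M : ℕ} [NeZero n] (K : ℕ) (hn : n = d * M) (hd : 3 ≤ d) :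
    ((rotFixed n (d * K) (M : ZMod n)).card : ℚ) =
      ∑ r ∈ Finset.range M, (M : ℚ) / (r + 1) * cutNumber True r M K := by
  have hn0 : 0 < n := Nat.pos_of_ne_zero (NeZero.ne n)
  have hM0 : 0 < M := Nat.pos_of_ne_zero fun hM0 => by simp [hM0] at hn; omega
  rw [card_rotFixed_eq_sum _ hn (by omega), ← sum_freePoints K hM0 fun r => (M : ℚ) / (r + 1)]
  refine Finset.sum_congr (Finset.filter_congr fun Q hQ => ?_) fun _ _ => rfl
  rw [(mem_allArcSystems.1 hQ).card_periodize hn (by omega) (Or.inl (by omega))]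
  exact Nat.mul_right_inj (by omega)

theorem card_rotFixed_eq_zero {n d M k : ℕ} [NeZero n] (hn : n = d * M) (hd : 3 ≤ d)
    (hk : ¬ d ∣ k) : (rotFixed n k (M : ZMod n)).card = 0 := by
  have h : ((rotFixed n k (M : ZMod n)).card : ℚ) = 0 := by
    rw [card_rotFixed_eq_sum _ hn (by omega), Finset.filter_false_of_mem, Finset.sum_empty]
    intro Q hQ h
    rw [(mem_allArcSystems.1 hQ).card_periodize hn (by omega) (Or.inl (by omega))] at h
    exact hk ⟨_, h.symm⟩
  exact_mod_cast h

/-- A diameter makes the number of diagonals odd, so for an even number the one-block systems `r =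
0` drop out. -/
theorem card_rotFixed_two_even {n M : ℕ} [NeZero n] (K : ℕ) (hn : n = 2 * M) (hM : 2 ≤ M) :
    ((rotFixed n (2 * K) (M : ZMod n)).card : ℚ) =
      ∑ r ∈ Finset.range M, (if r = 0 then 0 else (M : ℚ) / (r + 1)) * cutNumber True r M K := by
  rw [card_rotFixed_eq_sum _ hn le_rfl,
    ← sum_freePoints K (by omega) fun r => if r = 0 then 0 else (M : ℚ) / (r + 1),
    Finset.sum_filter, Finset.sum_filter]
  refine Finset.sum_congr rfl fun Q hQ => ?_
  have h := mem_allArcSystems.1 hQ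
  by_cases h0 : (0, M) ∈ Q
  · rw [if_pos ((h.root_mem_iff_freePoints hM).1 h0), ite_self, if_neg]
    have := h.card_periodize_root hn h0
    omega
  · rw [h.card_periodize hn le_rfl (Or.inr h0),
      if_neg (mt (h.root_mem_iff_freePoints hM).2 h0)]
    exact if_congr (Nat.mul_right_inj (by omega)) rfl rfl

/-- An odd number of diagonals forces a diameter. Only `r = 0` remains, with weight `M`, and
deleting the root arc leaves `K` arcs. -/
theorem card_rotFixed_two_odd {n M : ℕ} [NeZero n] (K : ℕ) (hn : n = 2 * M) (hM : 2 ≤ M) :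
    ((rotFixed n (2 * K + 1) (M : ZMod n)).card : ℚ) = M * (arcSystems M K).card := by
  have h1 : ((arcSystems M K).card : ℚ) = ∑ r ∈ Finset.range M, (if r = 0 then 1 else 0) *
      (cutNumber True r M (K + 1) : ℚ) := by
    rw [Finset.sum_eq_single 0 (fun r _ hr => by rw [if_neg hr, zero_mul])
      (fun h => absurd (Finset.mem_range.2 (by omega)) h), if_pos rfl, one_mul,
      cutNumber_true_zero hM, if_neg (by omega), Nat.add_sub_cancel]
  rw [card_rotFixed_eq_sum _ hn le_rfl, h1,
    ← sum_freePoints (K + 1) (by omega) fun r => if r = 0 then (1 : ℚ) else 0,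
    Finset.sum_filter, Finset.sum_filter, Finset.mul_sum]
  refine Finset.sum_congr rfl fun Q hQ => ?_
  have h := mem_allArcSystems.1 hQ
  by_cases h0 : (0, M) ∈ Q
  · have h2 := (h.root_mem_iff_freePoints hM).1 h0
    have h3 := h.card_periodize_root hn h0
    have h4 : (periodize n M Q).card = 2 * K + 1 ↔ Q.card = K + 1 := by omega
    rw [if_pos h2, h2]
    simp only [h4]
    split_ifs <;> simp
  · rw [h.card_periodize hn le_rfl (Or.inr h0),
      if_neg (mt (h.root_mem_iff_freePoints hM).2 h0), ite_self, mul_zero, if_neg (by omega)]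

/-! ### Grouping the rotations by order -/

/-- The rotations that leave a set of chords invariant. -/
def rotationStabilizer {n : ℕ} (E : Finset (Sym2 (ZMod n))) : AddSubgroup (ZMod n) where
  carrier := {c | move (.r c) E = E}
  zero_mem' := by
    change move (.r 0) E = E
    rw [← DihedralGroup.one_def, move_one]
  add_mem' {a b} ha hb := by
    change move (.r (a + b)) E = E
    rw [← DihedralGroup.r_mul_r, move_mul, show move (.r b) E = E from hb]
    exact ha
  neg_mem' {a} ha := by
    change move (.r (-a)) E = E
    conv_lhs => rw [← show move (.r a) E = E from ha]
    rw [← move_mul, DihedralGroup.r_mul_r, neg_add_cancel, ← DihedralGroup.one_def, move_one]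

/-- By Bézout, `p` and `gcd(n, p)` generate the same subgroup of `ZMod n`. -/
theorem natCast_mem_iff_gcd_mem {n : ℕ} (H : AddSubgroup (ZMod n)) (p : ℕ) :
    (p : ZMod n) ∈ H ↔ ((n.gcd p : ℕ) : ZMod n) ∈ H := by
  constructor
  · intro h
    have h1 : ((n.gcd p : ℕ) : ZMod n) = (n.gcdB p) • (p : ZMod n) := by
      have := congrArg (Int.cast : ℤ → ZMod n) (Nat.gcd_eq_gcd_ab n p)
      push_cast at this
      rw [ZMod.natCast_self, zero_mul, zero_add] at this
      rw [this, zsmul_eq_mul, mul_comm]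
    rw [h1]
    exact H.zsmul_mem h _
  · intro h
    obtain ⟨x, hx⟩ := Nat.gcd_dvd_right n p
    have h1 : (p : ZMod n) = x • ((n.gcd p : ℕ) : ZMod n) := by
      rw [nsmul_eq_mul, ← Nat.cast_mul, mul_comm, ← hx]
    rw [h1]
    exact H.nsmul_mem h _

theorem rotFixed_gcd {n k : ℕ} [NeZero n] (p : ℕ) :
    rotFixed n k (p : ZMod n) = rotFixed n k ((n.gcd p : ℕ) : ZMod n) := by
  ext E
  rw [mem_rotFixed, mem_rotFixed]
  exact and_congr_right fun _ => natCast_mem_iff_gcd_mem (rotationStabilizer E) p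

theorem sum_card_rotFixed (n k : ℕ) [NeZero n] :
    ∑ i : ZMod n, (rotFixed n k i).card =
      ∑ d ∈ n.divisors, d.totient * (rotFixed n k ((n / d : ℕ) : ZMod n)).card := by
  have hn : n ≠ 0 := NeZero.ne n
  rw [sum_zmod, ← Finset.sum_fiberwise_of_maps_to (t := n.divisors) (g := fun p => n.gcd p)
    (fun p _ => Nat.mem_divisors.2 ⟨Nat.gcd_dvd_left n p, hn⟩),
    ← Nat.sum_div_divisors n fun d => d.totient * (rotFixed n k ((n / d : ℕ) : ZMod n)).card]
  refine Finset.sum_congr rfl fun g hg => ?_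
  have hgn := Nat.dvd_of_mem_divisors hg
  rw [Nat.totient_div_of_dvd hgn, Nat.div_div_self hgn hn, Finset.sum_const_nat]
  intro p hp
  rw [rotFixed_gcd, (Finset.mem_filter.1 hp).2]

/-! ### Conjugacy of reflections and Burnside's lemma -/

open Classical in
/-- The `k`-dissections of the `n`-gon that are invariant under the reflection `v ↦ -(v + c)`. -/
noncomputable def refFixed (n k : ℕ) [NeZero n] (c : ZMod n) : Finset (Finset (Sym2 (ZMod n))) :=
  (dissections n k).filter fun E => move (.sr c) E = E

theorem mem_refFixed {n k : ℕ} [NeZero n] {c : ZMod n} {E : Finset (Sym2 (ZMod n))} :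
    E ∈ refFixed n k c ↔ IsDissection k E ∧ move (.sr c) E = E := by
  rw [refFixed, Finset.mem_filter, mem_dissections]

/-- Conjugating a reflection by the rotation by `j` changes its parameter by `2 * j`, and conjugate
elements have equally many fixed points. -/
theorem card_refFixed_add_two_mul {n k : ℕ} [NeZero n] (c j : ZMod n) :
    (refFixed n k (c + 2 * j)).card = (refFixed n k c).card := by
  rw [refFixed, refFixed, Finset.card_filter, Finset.card_filter,
    ← sum_dissections_move (.r j) fun E => if move (.sr c) E = E then 1 else 0]
  refine Finset.sum_congr rfl fun E _ => if_congr ?_ rfl rfl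
  rw [← (move_injective (.r (-j))).eq_iff (a := move (.sr c) _), ← move_mul, ← move_mul, ← move_mul,
    DihedralGroup.r_mul_sr, DihedralGroup.sr_mul_r, DihedralGroup.r_mul_r, neg_add_cancel,
    ← DihedralGroup.one_def, move_one, show c - -j + j = c + 2 * j by ring]

theorem sum_card_refFixed_odd {n : ℕ} (k : ℕ) [NeZero n] (hn : Odd n) :
    ∑ i : ZMod n, (refFixed n k i).card = n * (refFixed n k 1).card := by
  rw [Finset.sum_const_nat (m := (refFixed n k 1).card), Finset.card_univ, ZMod.card]
  intro i _
  obtain ⟨m, hm⟩ := hn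
  -- For `n = 2 * m + 1` the inverse of `2` is `m + 1`, so all reflections are conjugate.
  have h2 : (2 : ZMod n) * (m + 1 : ℕ) = 1 := by
    have : ((n : ℕ) : ZMod n) = 0 := ZMod.natCast_self n
    have h3 : ((2 * m + 1 : ℕ) : ZMod n) = 0 := by rw [← hm, this]
    push_cast at h3 ⊢
    linear_combination h3
  have := card_refFixed_add_two_mul (k := k) (1 : ZMod n) ((m + 1 : ℕ) * (i - 1))
  rwa [← mul_assoc, h2, one_mul, add_sub_cancel] at this

theorem sum_card_refFixed_even {n N : ℕ} (k : ℕ) [NeZero n] (hn : n = 2 * N) :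
    ∑ i : ZMod n, (refFixed n k i).card =
      N * (refFixed n k 0).card + N * (refFixed n k 1).card := by
  have key : ∀ m, ∑ p ∈ Finset.range (2 * m), (refFixed n k (p : ZMod n)).card =
      m * (refFixed n k 0).card + m * (refFixed n k 1).card := by
    intro m
    induction m with
    | zero => simp
    | succ m ih =>
      have h0 := card_refFixed_add_two_mul (k := k) (0 : ZMod n) m
      have h1 := card_refFixed_add_two_mul (k := k) (1 : ZMod n) m
      rw [show 2 * (m + 1) = 2 * m + 1 + 1 by ring, Finset.sum_range_succ, Finset.sum_range_succ,
        ih]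
      rw [show ((2 * m : ℕ) : ZMod n) = 0 + 2 * m by push_cast; ring, h0,
        show ((2 * m + 1 : ℕ) : ZMod n) = 1 + 2 * m by push_cast; ring, h1]
      ring
  rw [sum_zmod, ← key N, ← hn]

theorem numDihedralClasses_eq (n k : ℕ) [NeZero n] :
    (numDihedralClasses n k : ℚ) * (2 * n) =
      ∑ i : ZMod n, ((rotFixed n k i).card : ℚ) + ∑ i : ZMod n, ((refFixed n k i).card : ℚ) := by
  classical
  have : Finite (Dissection n k) := Subtype.finite
  have : Fintype (Dissection n k) := Fintype.ofFinite _
  have : Fintype (MulAction.orbitRel.Quotient (DihedralGroup n) (Dissection n k)) :=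
    Fintype.ofFinite _
  have hfix : ∀ g : DihedralGroup n, Fintype.card (MulAction.fixedBy (Dissection n k) g) =
      ((dissections n k).filter fun E => move g E = E).card := fun g => by
    rw [← Nat.card_eq_fintype_card]
    refine Nat.card_eq_of_equiv_fin ?_
    refine Equiv.trans ?_ (Finset.equivFin _)
    exact
      { toFun := fun Φ => ⟨Φ.1.1, Finset.mem_filter.2 ⟨mem_dissections.2 Φ.1.2,
          congrArg Subtype.val Φ.2⟩⟩
        invFun := fun E => ⟨⟨E.1, mem_dissections.1 (Finset.mem_filter.1 E.2).1⟩,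
          Subtype.ext (Finset.mem_filter.1 E.2).2⟩
        left_inv := fun _ => rfl
        right_inv := fun _ => rfl }
  have h := MulAction.sum_card_fixedBy_eq_card_orbits_mul_card_group (DihedralGroup n)
    (Dissection n k)
  rw [DihedralGroup.card] at h
  rw [numDihedralClasses, Nat.card_eq_fintype_card]
  have hd : ∑ g : DihedralGroup n, Fintype.card (MulAction.fixedBy (Dissection n k) g) =
      ∑ i : ZMod n, (rotFixed n k i).card + ∑ i : ZMod n, (refFixed n k i).card := by
    rw [← DihedralGroup.equivSum.symm.sum_comp, Fintype.sum_sum_type]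
    refine congrArg₂ _ (Finset.sum_congr rfl fun i _ => ?_) (Finset.sum_congr rfl fun i _ => ?_)
    · rw [hfix, rotFixed]
      rfl
    · rw [hfix, refFixed]
      rfl
  rw [hd] at h
  exact_mod_cast h.symm

/-! ### Reflection-invariant dissections from one half of the polygon -/

theorem chord_reflect_mem_move {n : ℕ} {E : Finset (Sym2 (ZMod n))} (a b c : ℤ) :
    chord n (c - a) (c - b) ∈ move (.sr (-(c : ZMod n))) E ↔ chord n a b ∈ E := by
  have h := map_mem_move (g := .sr (-(c : ZMod n))) (e := chord n a b) (E := E)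
  have h1 : (chord n a b).map (vertexAction n (.sr (-(c : ZMod n)))) =
      chord n (c - a) (c - b) := by
    change s(-((a : ZMod n) + -(c : ZMod n)), -((b : ZMod n) + -(c : ZMod n))) = _
    rw [chord]
    push_cast
    ring_nf
  rwa [h1] at h

theorem chord_reflect_mem {n : ℕ} {E : Finset (Sym2 (ZMod n))} {c : ℤ}
    (hE : move (.sr (-(c : ZMod n))) E = E) {a b : ℤ} (h : chord n a b ∈ E) :
    chord n (c - b) (c - a) ∈ E := by
  rw [chord_comm, ← hE]
  exact (chord_reflect_mem_move a b c).2 h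

/-- The arcs below the middle of `[0, c]` and their mirror images, together with the symmetric
arcs that start in `P`. -/
def double (n c : ℕ) (P : Finset ℕ) (Q : Finset (ℕ × ℕ)) : Finset (Sym2 (ZMod n)) :=
  (chords n Q ∪ Q.image fun e => chord n (c - e.2) (c - e.1)) ∪
    P.image fun p : ℕ => chord n p (c - p)

theorem mem_double {n c : ℕ} {P : Finset ℕ} {Q : Finset (ℕ × ℕ)} {x : Sym2 (ZMod n)} :
    x ∈ double n c P Q ↔ (∃ e ∈ Q, x = chord n e.1 e.2) ∨
      (∃ e ∈ Q, x = chord n (c - e.2) (c - e.1)) ∨ ∃ p ∈ P, x = chord n p (c - p) := by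
  simp only [double, Finset.mem_union, mem_chords, Finset.mem_image, or_assoc]
  simp only [eq_comm (a := x)]

/-- On the closed window `[0, n]` only the labels `0` and `n` coincide, so they are the only source
of different representatives. -/
theorem chord_eq_cases_of_le {n : ℕ} {a b p q : ℤ} (h : chord n a b = chord n p q) (ha : 0 ≤ a)
    (hab : a < b) (hb : b ≤ n) (hba : b < a + n) (hp : 0 ≤ p) (hpq : p < q) (hq : q ≤ n)
    (hqp : q < p + n) : (p = a ∧ q = b) ∨ (a = 0 ∧ p = b ∧ q = n) ∨ (b = n ∧ p = 0 ∧ q = a) := by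
  obtain ⟨s, hs⟩ := chord_eq_cases h hab hba hpq hqp
  have h1 : s = 0 ∨ s = -1 ∨ s = 1 := by
    rcases lt_trichotomy s 0 with hz | hz | hz
    · rcases eq_or_ne s (-1) with h' | h'
      · exact Or.inr (Or.inl h')
      · have := mul_le_neg (M := n) (z := s + 1) (by omega) (by omega)
        rw [add_mul] at this
        omega
    · exact Or.inl hz
    · rcases eq_or_ne s 1 with h' | h'
      · exact Or.inr (Or.inr h')
      · have := le_mul_of_one_le (M := n) (z := s - 1) (by omega) (by omega)
        rw [sub_mul] at this
        omega
  rcases h1 with rfl | rfl | rfl <;> omega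

/-- The starting points of the symmetric arcs of `E` on `[0, c]`. -/
def axisPoints (n c : ℕ) (E : Finset (Sym2 (ZMod n))) : Finset ℕ :=
  (Finset.Ioo 0 (c / 2)).filter fun p => chord n p (c - p) ∈ E

theorem mem_axisPoints {n c p : ℕ} {E : Finset (Sym2 (ZMod n))} :
    p ∈ axisPoints n c E ↔ 0 < p ∧ p < c / 2 ∧ chord n p (c - p) ∈ E := by
  rw [axisPoints, Finset.mem_filter, Finset.mem_Ioo, and_assoc]

theorem IsDissection.isCut_reflect {n k c : ℕ} [NeZero n] {E : Finset (Sym2 (ZMod n))}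
    (h : IsDissection k E) (hc : c ≤ n) :
    IsCut False (c / 2) (axisPoints n c E) (arcsOf n (c / 2) E) where
  pos p hp := (mem_axisPoints.1 hp).1
  lt p hp := (mem_axisPoints.1 hp).2.1
  arcs := h.isArcSystem (by have := Nat.pos_of_ne_zero (NeZero.ne n); omega)
  free p hp := by
    rintro ⟨e, he, h1, h2⟩
    have h3 := mem_arcsOf.1 he
    have h4 := mem_axisPoints.1 hp
    exact h.not_crossing (a := e.1) (b := p) (c := e.2) (d := c - p) (by omega) (by omega)
      (by omega) (by omega) h3.2.2 h4.2.2
  full hβ := hβ.elim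

theorem IsCut.isDissection_double {β : Prop} {n c : ℕ} [NeZero n] {P : Finset ℕ}
    {Q : Finset (ℕ × ℕ)} (h : IsCut β (c / 2) P Q) (hc : c ≤ n) (hn : 4 ≤ n) :
    IsDissection (double n c P Q).card (double n c P Q) := by
  refine isDissection_of_reps ({p | ∃ e ∈ Q, p = ((e.1 : ℤ), (e.2 : ℤ))} ∪
    ({p | ∃ e ∈ Q, p = ((c - e.2 : ℤ), (c - e.1 : ℤ))} ∪
      {x | ∃ p ∈ P, x = ((p : ℤ), (c - p : ℤ))})) ?_ ?_ ?_
  · intro x hx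
    rcases mem_double.1 hx with ⟨e, he, rfl⟩ | ⟨e, he, rfl⟩ | ⟨p, hp, rfl⟩
    · exact ⟨_, Or.inl ⟨e, he, rfl⟩, rfl⟩
    · exact ⟨_, Or.inr (Or.inl ⟨e, he, rfl⟩), rfl⟩
    · exact ⟨_, Or.inr (Or.inr ⟨p, hp, rfl⟩), rfl⟩
  · rintro x (⟨e, he, rfl⟩ | ⟨e, he, rfl⟩ | ⟨p, hp, rfl⟩)
    · have := h.arcs.1 e he
      dsimp only
      omega
    · have := h.arcs.1 e he
      dsimp only
      omega
    · have := h.pos p hp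
      have := h.lt p hp
      dsimp only
      omega
  · intro x hx y hy t ht
    have hx' : 0 ≤ x.1 ∧ x.1 < x.2 ∧ x.2 ≤ c := by
      rcases hx with ⟨e, he, rfl⟩ | ⟨e, he, rfl⟩ | ⟨p, hp, rfl⟩
      · have := h.arcs.1 e he
        dsimp only
        omega
      · have := h.arcs.1 e he
        dsimp only
        omega
      · have := h.lt p hp
        dsimp only
        omega
    have hy' : 0 ≤ y.1 ∧ y.1 < y.2 ∧ y.2 ≤ c := by
      rcases hy with ⟨e, he, rfl⟩ | ⟨e, he, rfl⟩ | ⟨p, hp, rfl⟩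
      · have := h.arcs.1 e he
        dsimp only
        omega
      · have := h.arcs.1 e he
        dsimp only
        omega
      · have := h.lt p hp
        dsimp only
        omega
    -- All representing intervals lie in `[0, c]` with `c ≤ n`, so after a shift by a nonzero
    -- multiple of `n` they can only touch.
    have ht0 : t = 0 := by
      rcases lt_trichotomy t 0 with hz | hz | hz
      · have := mul_le_neg (M := n) (z := t) (by omega) (by omega)
        omega
      · exact hz
      · have := le_mul_of_one_le (M := n) (z := t) (by omega) (by omega)
        omega
    subst ht0
    clear hx' hy'
    rcases hx with ⟨e, he, rfl⟩ | ⟨e, he, rfl⟩ | ⟨p, hp, rfl⟩ <;>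
      rcases hy with ⟨f, hf, rfl⟩ | ⟨f, hf, rfl⟩ | ⟨q, hq, rfl⟩ <;> dsimp only at ht
    · exact h.arcs.2 e he f hf (by omega)
    · have := h.arcs.1 e he
      have := h.arcs.1 f hf
      omega
    · exact h.free q hq ⟨e, he, by omega, by omega⟩
    · have := h.arcs.1 e he
      have := h.arcs.1 f hf
      omega
    · exact h.arcs.2 f hf e he (by omega)
    · have := h.arcs.1 e he
      have := h.lt q hq
      omega
    · have := h.arcs.1 f hf
      have := h.lt p hp
      omega
    · exact h.free p hp ⟨f, hf, by omega, by omega⟩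
    · omega

theorem move_double {n c : ℕ} [NeZero n] (P : Finset ℕ) (Q : Finset (ℕ × ℕ)) :
    move (.sr (-(c : ZMod n))) (double n c P Q) = double n c P Q := by
  have hmap : ∀ a b : ℤ, (chord n a b).map (vertexAction n (.sr (-(c : ZMod n)))) =
      chord n (c - b) (c - a) := fun a b => by
    change s(-((a : ZMod n) + -(c : ZMod n)), -((b : ZMod n) + -(c : ZMod n))) = _
    rw [chord_comm, chord]
    push_cast
    ring_nf
  refine Finset.eq_of_subset_of_card_le (fun x hx => ?_) ?_
  · obtain ⟨y, hy, rfl⟩ := Finset.mem_image.1 hx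
    rw [mem_double]
    rcases mem_double.1 hy with ⟨e, he, rfl⟩ | ⟨e, he, rfl⟩ | ⟨p, hp, rfl⟩
    · exact Or.inr (Or.inl ⟨e, he, hmap _ _⟩)
    · refine Or.inl ⟨e, he, ?_⟩
      rw [hmap, sub_sub_cancel, sub_sub_cancel]
    · refine Or.inr (Or.inr ⟨p, hp, ?_⟩)
      rw [hmap, sub_sub_cancel]
  · rw [move, Finset.card_image_of_injective _ (Sym2.map.injective (Equiv.injective _))]

/-- Among the short chords of a doubled arc system only the given ones occur. -/
theorem IsCut.chord_mem_double {β : Prop} {n c : ℕ} {P : Finset ℕ} {Q : Finset (ℕ × ℕ)}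
    (h : IsCut β (c / 2) P Q) (hc : c ≤ n) (hn : 4 ≤ n) {a b : ℕ} (hab : a < b)
    (hb : b ≤ c / 2) : chord n a b ∈ double n c P Q ↔ (a, b) ∈ Q := by
  rw [mem_double]
  constructor
  · rintro (⟨e, he, h1⟩ | ⟨e, he, h1⟩ | ⟨p, hp, h1⟩)
    · have h2 := h.arcs.1 e he
      have h3 := chord_natCast_inj (by omega) (by omega) (by omega) (by omega) h1
      rwa [show (a, b) = e from Prod.ext h3.1 h3.2]
    · have h2 := h.arcs.1 e he
      have h3 := chord_eq_cases_of_le h1 (by omega) (by omega) (by omega) (by omega) (by omega)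
        (by omega) (by omega) (by omega)
      rwa [show (a, b) = e from Prod.ext (by dsimp only; omega) (by dsimp only; omega)]
    · have h2 := h.lt p hp
      have h2' := h.pos p hp
      have h3 := chord_eq_cases_of_le h1 (by omega) (by omega) (by omega) (by omega) (by omega)
        (by omega) (by omega) (by omega)
      omega
  · exact fun he => Or.inl ⟨_, he, rfl⟩

theorem IsCut.axis_mem_double {β : Prop} {n c : ℕ} {P : Finset ℕ} {Q : Finset (ℕ × ℕ)}
    (h : IsCut β (c / 2) P Q) (hc : c ≤ n) (hn : 4 ≤ n) {p : ℕ} (hp0 : 0 < p) (hpc : p < c / 2) :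
    chord n p (c - p) ∈ double n c P Q ↔ p ∈ P := by
  rw [mem_double]
  constructor
  · rintro (⟨e, he, h1⟩ | ⟨e, he, h1⟩ | ⟨q, hq, h1⟩)
    · have h2 := h.arcs.1 e he
      have h3 := chord_eq_cases_of_le h1 (by omega) (by omega) (by omega) (by omega) (by omega)
        (by omega) (by omega) (by omega)
      omega
    · have h2 := h.arcs.1 e he
      have h3 := chord_eq_cases_of_le h1 (by omega) (by omega) (by omega) (by omega) (by omega)
        (by omega) (by omega) (by omega)
      omega
    · have h2 := h.lt q hq
      have h2' := h.pos q hq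
      have h3 := chord_eq_cases_of_le h1 (by omega) (by omega) (by omega) (by omega) (by omega)
        (by omega) (by omega) (by omega)
      rwa [show p = q by omega]
  · exact fun hp => Or.inr (Or.inr ⟨p, hp, rfl⟩)

theorem IsCut.axisPoints_double {β : Prop} {n c : ℕ} {P : Finset ℕ} {Q : Finset (ℕ × ℕ)}
    (h : IsCut β (c / 2) P Q) (hc : c ≤ n) (hn : 4 ≤ n) : axisPoints n c (double n c P Q) = P := by
  ext p
  rw [mem_axisPoints]
  constructor
  · rintro ⟨h1, h2, h3⟩
    exact (h.axis_mem_double hc hn h1 h2).1 h3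
  · intro hp
    exact ⟨h.pos p hp, h.lt p hp, (h.axis_mem_double hc hn (h.pos p hp) (h.lt p hp)).2 hp⟩

theorem IsCut.arcsOf_double {β : Prop} {n c : ℕ} {P : Finset ℕ} {Q : Finset (ℕ × ℕ)}
    (h : IsCut β (c / 2) P Q) (hc : c ≤ n) (hn : 4 ≤ n) :
    arcsOf n (c / 2) (double n c P Q) = Q := by
  ext e
  rw [mem_arcsOf]
  constructor
  · rintro ⟨h1, h2, h3⟩
    exact (h.chord_mem_double hc hn (by omega) h2).1 h3
  · intro he
    have h1 := h.arcs.1 e he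
    exact ⟨h1.1, h1.2, (h.chord_mem_double hc hn (by omega) h1.2).2 he⟩

/-- Compare a diagonal `(a, b)` with its mirror image `(c - b, c - a)`. If `a + b = c` it is
symmetric. Otherwise it must stay on one side of the axis, since it would cross its image. The
bounds on `c` leave only `c = n` and `c = n - 1`, so no vertex lies outside `[0, c]` modulo `n`. -/
theorem IsDissection.double_eq {n k c : ℕ} [NeZero n] {E : Finset (Sym2 (ZMod n))}
    (h : IsDissection k E) (hc : c ≤ n) (hc' : n ≤ c + 1)
    (hE : move (.sr (-(c : ZMod n))) E = E) :
    double n c (axisPoints n c E) (arcsOf n (c / 2) E) = E := by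
  have hrefl : ∀ {a b : ℤ}, chord n a b ∈ E → chord n (c - b) (c - a) ∈ E := fun hab =>
    chord_reflect_mem (c := (c : ℤ)) (by rwa [Int.cast_natCast]) hab
  ext x
  rw [mem_double]
  constructor
  · rintro (⟨e, he, rfl⟩ | ⟨e, he, rfl⟩ | ⟨p, hp, rfl⟩)
    · exact (mem_arcsOf.1 he).2.2
    · exact hrefl (mem_arcsOf.1 he).2.2
    · exact (mem_axisPoints.1 hp).2.2
  · intro hx
    obtain ⟨a, b, h1, h2, h3, rfl⟩ := (h.2.1 x hx).exists_chord
    have hx' := hrefl hx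
    rcases lt_trichotomy (a + b) c with hab | hab | hab
    · by_cases hb : b ≤ c / 2
      · exact Or.inl ⟨(a, b), mem_arcsOf.2 ⟨h1, hb, hx⟩, rfl⟩
      -- The diagonal and its mirror image fail to cross only if they share the endpoint `0 = n` on
      -- the axis. Then the diagonal, read as `(b, n)`, is the mirror image of an arc starting at
      -- `0`.
      · have h0 : a = 0 ∧ c = n := by
          by_contra h0
          exact h.not_crossing (a := a) (b := c - b) (c := b) (d := c - a) (by omega) (by omega)
            (by omega) (by omega) hx hx'
        obtain ⟨rfl, rfl⟩ := h0
        have h4 : chord c ((0 : ℕ) : ℤ) b = chord c b c := by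
          rw [chord_comm]
          simpa using (chord_add_mul c b 0 0 1).symm
        refine Or.inr (Or.inl ⟨(0, c - b), mem_arcsOf.2 ⟨by dsimp only; omega,
          by dsimp only; omega, ?_⟩, ?_⟩)
        · dsimp only
          rw [Nat.cast_sub h2.le, chord_comm]
          have h5 : chord c ((c : ℤ) - b) ((c : ℤ) - (0 : ℕ)) =
              chord c ((c : ℤ) - b) ((0 : ℕ) : ℤ) := by
            simpa using chord_add_mul c (c - b) 0 0 1
          rw [← h5]
          exact hx'
        · dsimp only
          rw [Nat.cast_sub h2.le, sub_sub_cancel, h4, Nat.cast_zero, sub_zero]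
    · refine Or.inr (Or.inr ⟨a, mem_axisPoints.2 ⟨by omega, by omega, ?_⟩, ?_⟩)
      · rw [show (c : ℤ) - a = b by omega]
        exact hx
      · rw [show (c : ℤ) - a = b by omega]
    · by_cases ha : c - c / 2 ≤ a
      · refine Or.inr (Or.inl ⟨(c - b, c - a), mem_arcsOf.2 ⟨by dsimp only; omega,
          by dsimp only; omega, ?_⟩, ?_⟩)
        · dsimp only
          rw [Nat.cast_sub (by omega), Nat.cast_sub (by omega)]
          exact hx'
        · dsimp only
          rw [Nat.cast_sub (by omega), Nat.cast_sub (by omega), sub_sub_cancel, sub_sub_cancel]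
      · exact (h.not_crossing (a := c - b) (b := a) (c := c - a) (d := b) (by omega) (by omega)
          (by omega) (by omega) hx' hx).elim

/-- Arcs come in mirror pairs and symmetric chords are single. An arc can be its own mirror image
only if it lies on the axis, which happens just for the root arc with both `0` and `c / 2` on the
axis; `h0` excludes this. -/
theorem IsCut.card_double {β : Prop} {n c : ℕ} {P : Finset ℕ} {Q : Finset (ℕ × ℕ)}
    (h : IsCut β (c / 2) P Q) (hc : c ≤ n) (hn : 4 ≤ n) (h0 : n ≠ 2 * (c / 2) ∨ (0, c / 2) ∉ Q) :
    (double n c P Q).card = P.card + 2 * Q.card := by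
  have hQ : ∀ e ∈ Q, e.1 = 0 → e.2 = c / 2 → n ≠ 2 * (c / 2) := fun e he h1 h2 =>
    h0.resolve_right fun h' => h' (by rwa [show (0, c / 2) = e from Prod.ext h1.symm h2.symm])
  rw [double, Finset.card_union_of_disjoint, Finset.card_union_of_disjoint, chords,
    Finset.card_image_of_injOn, Finset.card_image_of_injOn, Finset.card_image_of_injOn]
  · omega
  · intro p hp q hq hpq
    have := h.lt p hp
    have := h.pos p hp
    have := h.lt q hq
    have := h.pos q hq
    have h3 := chord_eq_cases_of_le hpq (by omega) (by omega) (by omega) (by omega) (by omega)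
      (by omega) (by omega) (by omega)
    omega
  · intro e he f hf hef
    have := h.arcs.1 e he
    have := h.arcs.1 f hf
    have h3 := chord_eq_cases_of_le hef (by omega) (by omega) (by omega) (by omega) (by omega)
      (by omega) (by omega) (by omega)
    exact Prod.ext (by omega) (by omega)
  · exact h.arcs.injOn_chord (by omega)
  · rw [Finset.disjoint_left]
    intro x hx hx'
    obtain ⟨e, he, rfl⟩ := mem_chords.1 hx
    obtain ⟨f, hf, hef⟩ := Finset.mem_image.1 hx'
    have := h.arcs.1 e he
    have := h.arcs.1 f hf
    have := hQ e he
    have h3 := chord_eq_cases_of_le hef (by omega) (by omega) (by omega) (by omega) (by omega)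
      (by omega) (by omega) (by omega)
    omega
  · rw [Finset.disjoint_left]
    intro x hx hx'
    obtain ⟨p, hp, rfl⟩ := Finset.mem_image.1 hx'
    have h1 := h.lt p hp
    have h2 := h.pos p hp
    rcases Finset.mem_union.1 hx with hx | hx
    · obtain ⟨e, he, hep⟩ := mem_chords.1 hx
      have := h.arcs.1 e he
      have h3 := chord_eq_cases_of_le hep (by omega) (by omega) (by omega) (by omega) (by omega)
        (by omega) (by omega) (by omega)
      omega
    · obtain ⟨e, he, hep⟩ := Finset.mem_image.1 hx
      have := h.arcs.1 e he
      have h3 := chord_eq_cases_of_le hep (by omega) (by omega) (by omega) (by omega) (by omega)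
        (by omega) (by omega) (by omega)
      omega

theorem IsCut.eq_empty_of_root {β : Prop} {N : ℕ} {P : Finset ℕ} {Q : Finset (ℕ × ℕ)}
    (h : IsCut β N P Q) (h0 : (0, N) ∈ Q) : P = ∅ := by
  rw [Finset.eq_empty_iff_forall_notMem]
  exact fun p hp => h.free p hp ⟨_, h0, h.pos p hp, h.lt p hp⟩

/-- The root arc is the diameter along the axis and coincides with its mirror image. It covers all
interior points, so there are no symmetric chords. -/
theorem IsCut.card_double_root {β : Prop} {n c : ℕ} {P : Finset ℕ} {Q : Finset (ℕ × ℕ)}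
    (h : IsCut β (c / 2) P Q) (hc : c ≤ n) (hn : 4 ≤ n) (h0 : n = 2 * (c / 2))
    (hQ : (0, c / 2) ∈ Q) : (double n c P Q).card + 1 = P.card + 2 * Q.card := by
  obtain rfl := h.eq_empty_of_root hQ
  have hc2 : c = 2 * (c / 2) := by omega
  have hcut : IsCut False (c / 2) ∅ (Q.erase (0, c / 2)) :=
    ⟨by simp, by simp, h.arcs.mono (Finset.erase_subset _ _), by simp, fun h => h.elim⟩
  have h1 := hcut.card_double hc hn (Or.inr (Finset.notMem_erase _ _))
  have h2 : chord n (0 : ℕ) (c / 2 : ℕ) ∉ double n c ∅ (Q.erase (0, c / 2)) := by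
    rw [hcut.chord_mem_double hc hn (by omega) le_rfl]
    exact Finset.notMem_erase _ _
  have h3 : double n c ∅ Q =
      insert (chord n (0 : ℕ) (c / 2 : ℕ)) (double n c ∅ (Q.erase (0, c / 2))) := by
    have h4 : chord n ((c : ℤ) - (c / 2 : ℕ)) ((c : ℤ) - (0 : ℕ)) =
        chord n (0 : ℕ) (c / 2 : ℕ) := by
      rw [show (c : ℤ) - (c / 2 : ℕ) = (c / 2 : ℕ) by omega,
        show (c : ℤ) - (0 : ℕ) = (0 : ℕ) + 1 * n by omega, chord_comm]
      simpa using chord_add_mul n ((0 : ℕ) : ℤ) (c / 2 : ℕ) 1 0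
    ext x
    rw [Finset.mem_insert, mem_double, mem_double]
    constructor
    · rintro (⟨e, he, rfl⟩ | ⟨e, he, rfl⟩ | ⟨p, hp, rfl⟩)
      · by_cases he0 : e = (0, c / 2)
        · subst he0
          exact Or.inl rfl
        · exact Or.inr (Or.inl ⟨e, Finset.mem_erase.2 ⟨he0, he⟩, rfl⟩)
      · by_cases he0 : e = (0, c / 2)
        · subst he0
          exact Or.inl h4
        · exact Or.inr (Or.inr (Or.inl ⟨e, Finset.mem_erase.2 ⟨he0, he⟩, rfl⟩))
      · exact absurd hp (Finset.notMem_empty p)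
    · rintro (rfl | ⟨e, he, rfl⟩ | ⟨e, he, rfl⟩ | ⟨p, hp, rfl⟩)
      · exact Or.inl ⟨_, hQ, rfl⟩
      · exact Or.inl ⟨e, Finset.mem_of_mem_erase he, rfl⟩
      · exact Or.inr (Or.inl ⟨e, Finset.mem_of_mem_erase he, rfl⟩)
      · exact absurd hp (Finset.notMem_empty p)
  rw [h3, Finset.card_insert_of_notMem h2, h1, Finset.card_erase_of_mem hQ]
  have := Finset.card_pos.2 ⟨_, hQ⟩
  simp only [Finset.card_empty]
  omega

/-! ### Counting reflection-invariant dissections -/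

open Classical in
/-- All pairs of a non-crossing arc system on `[0, N]` and a set of uncovered interior points. -/
noncomputable def allCuts (N : ℕ) : Finset (Finset ℕ × Finset (ℕ × ℕ)) :=
  ((Finset.range N).powerset ×ˢ
    (Finset.range (N + 1) ×ˢ Finset.range (N + 1)).powerset).filter fun z => IsCut False N z.1 z.2

theorem mem_allCuts {N : ℕ} {z : Finset ℕ × Finset (ℕ × ℕ)} :
    z ∈ allCuts N ↔ IsCut False N z.1 z.2 := by
  classical
  rw [allCuts, Finset.mem_filter, and_iff_right_iff_imp]
  intro h
  rw [Finset.mem_product, Finset.mem_powerset, Finset.mem_powerset]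
  exact ⟨fun p hp => Finset.mem_range.2 (h.lt p hp), h.arcs.subset⟩

theorem card_refFixed_eq {n c : ℕ} [NeZero n] (k : ℕ) (hc : c ≤ n) (hc' : n ≤ c + 1)
    (hn : 4 ≤ n) : (refFixed n k (-(c : ZMod n))).card =
      ((allCuts (c / 2)).filter fun z => (double n c z.1 z.2).card = k).card := by
  refine Finset.card_nbij' (fun E => (axisPoints n c E, arcsOf n (c / 2) E))
    (fun z => double n c z.1 z.2) ?_ ?_ ?_ ?_
  · intro E hE
    rw [Finset.mem_coe, mem_refFixed] at hE
    rw [Finset.mem_coe, Finset.mem_filter, mem_allCuts, hE.1.double_eq hc hc' hE.2]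
    exact ⟨hE.1.isCut_reflect hc, hE.1.1⟩
  · intro z hz
    rw [Finset.mem_coe, Finset.mem_filter, mem_allCuts] at hz
    rw [Finset.mem_coe, mem_refFixed]
    refine ⟨?_, move_double _ _⟩
    rw [← hz.2]
    exact hz.1.isDissection_double hc hn
  · intro E hE
    rw [Finset.mem_coe, mem_refFixed] at hE
    exact hE.1.double_eq hc hc' hE.2
  · intro z hz
    rw [Finset.mem_coe, Finset.mem_filter, mem_allCuts] at hz
    exact Prod.ext (hz.1.axisPoints_double hc hn) (hz.1.arcsOf_double hc hn)

theorem card_allCuts_filter {N : ℕ} (k t : ℕ) (hN : 0 < N) :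
    (((allCuts N).filter fun z => z.1.card + 2 * z.2.card = k ∧ z.1.card = t).card : ℚ) =
      axialSum N k t := by
  by_cases hK : ∃ K, t + 2 * K = k
  · obtain ⟨K, rfl⟩ := hK
    rw [axialSum_eq, cutNumber, if_neg hN.ne']
    congr 2
    ext z
    rw [Finset.mem_filter, mem_allCuts, mem_cuts]
    exact and_congr_right fun _ => ⟨fun h => ⟨h.2, by omega⟩, fun h => ⟨by omega, h.1⟩⟩
  · push Not at hK
    rw [axialSum_eq_zero hK, Finset.filter_false_of_mem, Finset.card_empty, Nat.cast_zero]
    intro z _ h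
    exact hK z.2.card (by omega)

theorem card_refFixed_one {n : ℕ} [NeZero n] (k : ℕ) (hn : 4 ≤ n) :
    ((refFixed n k 1).card : ℚ) = ∑ t ∈ Finset.Icc 0 k, axialSum ((n - 1) / 2) k t := by
  -- The reflection `v ↦ -(v + 1)` is `v ↦ c - v` with `c = n - 1`. Its axis passes through the
  -- midpoint of the side joining `n - 1` and `0`, so no root arc needs special treatment.
  have h1 : (1 : ZMod n) = -((n - 1 : ℕ) : ZMod n) := by
    rw [Nat.cast_sub (by omega), ZMod.natCast_self]
    simp
  rw [h1, card_refFixed_eq k (by omega) (by omega) hn]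
  have h2 : ((allCuts ((n - 1) / 2)).filter fun z => (double n (n - 1) z.1 z.2).card = k) =
      (allCuts ((n - 1) / 2)).filter fun z => z.1.card + 2 * z.2.card = k :=
    Finset.filter_congr fun z hz => by
      rw [(mem_allCuts.1 hz).card_double (by omega) hn (Or.inl (by omega))]
  rw [h2, Finset.card_eq_sum_card_fiberwise (f := fun z => z.1.card) (t := Finset.Icc 0 k)
    (fun z hz => by
      have := (Finset.mem_filter.1 hz).2
      exact Finset.mem_coe.2 (Finset.mem_Icc.2 ⟨Nat.zero_le _, by dsimp only; omega⟩)),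
    Nat.cast_sum]
  refine Finset.sum_congr rfl fun t _ => ?_
  rw [Finset.filter_filter, card_allCuts_filter k t (by omega)]

theorem A_half_even {x : ℚ} {K : ℕ} : A x (((2 * K : ℕ) : ℚ) / 2) = A x K := by
  push_cast
  rw [mul_div_cancel_left₀ _ two_ne_zero]

theorem A_half_odd {x : ℚ} {K : ℕ} : A x (((2 * K + 1 : ℕ) : ℚ) / 2) = 0 := by
  refine A_eq_zero_of_right fun y hy => ?_
  have : ((2 * K + 1 : ℕ) : ℚ) = (2 * y : ℕ) := by
    push_cast at hy ⊢
    linarith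
  have : 2 * K + 1 = 2 * y := by exact_mod_cast this
  omega

/-- With the root arc there are no cut points, so `k + 1` is twice the number of arcs; deleting the
root leaves `(k - 1) / 2` arcs. For even `k` both sides vanish. -/
theorem card_allCuts_root {N : ℕ} (k : ℕ) (hN : 2 ≤ N) :
    (((allCuts N).filter fun z => z.1.card + 2 * z.2.card = k + 1 ∧ (0, N) ∈ z.2).card : ℚ) =
      A ((N : ℚ) + 1) (((k : ℚ) - 1) / 2) := by
  rcases Nat.even_or_odd' k with ⟨K, rfl | rfl⟩
  · rw [Finset.filter_false_of_mem, Finset.card_empty, Nat.cast_zero]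
    · symm
      refine A_eq_zero_of_right fun y hy => ?_
      have : ((2 * K : ℕ) : ℚ) = (2 * y + 1 : ℕ) := by
        push_cast at hy ⊢
        linarith
      have : 2 * K = 2 * y + 1 := by exact_mod_cast this
      omega
    · rintro z hz ⟨h1, h2⟩
      rw [(mem_allCuts.1 hz).eq_empty_of_root h2, Finset.card_empty] at h1
      omega
  · have h1 : (((2 * K + 1 : ℕ) : ℚ) - 1) / 2 = K := by
      push_cast
      ring
    rw [h1, A_natCast_succ K (by omega), ← card_rooted False K hN]
    congr 2
    ext z
    rw [Finset.mem_filter, Finset.mem_filter, mem_allCuts, mem_cuts]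
    constructor
    · rintro ⟨h2, h3, h4⟩
      rw [h2.eq_empty_of_root h4, Finset.card_empty] at h3
      exact ⟨⟨h2, by rw [h2.eq_empty_of_root h4, Finset.card_empty], by omega⟩, h4⟩
    · rintro ⟨⟨h2, h3, h4⟩, h5⟩
      exact ⟨h2, by omega, h5⟩

/-- For `t > 0` a cut point already rules out the root arc. Only for `t = 0` does the condition
bite, leaving the summand `A_k` of the single block. -/
theorem card_allCuts_unrooted {N : ℕ} (k t : ℕ) (hN : 2 ≤ N) :
    (((allCuts N).filter fun z => (z.1.card + 2 * z.2.card = k ∧ (0, N) ∉ z.2) ∧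
      z.1.card = t).card : ℚ) =
      if t = 0 then A ((N : ℚ) + 1) ((k : ℚ) / 2) else axialSum N k t := by
  split_ifs with ht
  · subst ht
    rcases Nat.even_or_odd' k with ⟨K, rfl | rfl⟩
    · rw [A_half_even, A_natCast_succ K (by omega), ← card_unrooted]
      congr 2
      ext z
      rw [Finset.mem_filter, Finset.mem_filter, mem_allCuts, mem_cuts]
      constructor
      · rintro ⟨h1, ⟨h2, h3⟩, h4⟩
        exact ⟨⟨h1, h4, by omega⟩, h3⟩
      · rintro ⟨⟨h1, h2, h3⟩, h4⟩
        exact ⟨h1, ⟨by omega, h4⟩, h2⟩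
    · rw [A_half_odd, Finset.filter_false_of_mem, Finset.card_empty, Nat.cast_zero]
      rintro z - h
      omega
  · rw [← card_allCuts_filter k t (by omega)]
    congr 2
    refine Finset.filter_congr fun z hz => ?_
    constructor
    · rintro ⟨⟨h1, -⟩, h2⟩
      exact ⟨h1, h2⟩
    · rintro ⟨h1, h2⟩
      refine ⟨⟨h1, fun h0 => ht ?_⟩, h2⟩
      rw [← h2, (mem_allCuts.1 hz).eq_empty_of_root h0, Finset.card_empty]

/-- The three terms correspond to the diameter on the axis, to neither a diameter on the axis nor
symmetric chords, and to `t ≥ 1` symmetric chords. The case `t = 0` cannot be absorbed into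
`axialSum`, since the root arc counts once here and not twice. -/
theorem card_refFixed_zero {n N : ℕ} [NeZero n] (k : ℕ) (hn : n = 2 * N) (hN : 2 ≤ N) :
    ((refFixed n k 0).card : ℚ) = A ((N : ℚ) + 1) (((k : ℚ) - 1) / 2) +
      A ((N : ℚ) + 1) ((k : ℚ) / 2) + ∑ t ∈ Finset.Icc 1 k, axialSum N k t := by
  have h1 : (0 : ZMod n) = -((n : ℕ) : ZMod n) := by
    rw [ZMod.natCast_self, neg_zero]
  obtain rfl : N = n / 2 := by omega
  rw [h1, card_refFixed_eq k le_rfl (by omega) (by omega), ← card_allCuts_root k hN,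
    ← Finset.card_filter_add_card_filter_not
      (fun z : Finset ℕ × Finset (ℕ × ℕ) => (0, n / 2) ∈ z.2), Finset.filter_filter,
    Finset.filter_filter, Nat.cast_add, add_assoc]
  congr 2
  · congr 1
    refine Finset.filter_congr fun z hz => ?_
    refine and_congr_left fun h0 => ?_
    have := (mem_allCuts.1 hz).card_double_root le_rfl (by omega) hn h0
    omega
  · have h2 : ((allCuts (n / 2)).filter fun z => (double n n z.1 z.2).card = k ∧
        (0, n / 2) ∉ z.2) = (allCuts (n / 2)).filter fun z =>
          z.1.card + 2 * z.2.card = k ∧ (0, n / 2) ∉ z.2 :=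
      Finset.filter_congr fun z hz => and_congr_left fun h0 => by
        rw [(mem_allCuts.1 hz).card_double le_rfl (by omega) (Or.inr h0)]
    rw [h2, Finset.card_eq_sum_card_fiberwise (f := fun z => z.1.card) (t := Finset.range (k + 1))
      (fun z hz => by
        have := (Finset.mem_filter.1 hz).2.1
        exact Finset.mem_coe.2 (Finset.mem_range.2 (by dsimp only; omega))), Nat.cast_sum,
      Finset.sum_range_succ', add_comm, Finset.range_eq_Ico,
      Finset.sum_Ico_add' (fun t => ((((allCuts (n / 2)).filter fun z =>
        z.1.card + 2 * z.2.card = k ∧ (0, n / 2) ∉ z.2).filter fun z => z.1.card = t).card : ℚ))]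
    congr 1
    · rw [Finset.filter_filter, card_allCuts_unrooted k 0 hN, if_pos rfl]
    · refine Finset.sum_congr rfl fun t ht => ?_
      rw [Finset.filter_filter, card_allCuts_unrooted k t hN, if_neg]
      have := (Finset.mem_Ico.1 ht).1
      omega

/-! ### The rotation part of the formula -/

theorem cutNumber_eq_zero_of_le {β : Prop} {r N K : ℕ} (h : N ≤ r) : cutNumber β r N K = 0 := by
  rw [cutNumber]
  split_ifs with hN
  · rfl
  · rw [Finset.card_eq_zero, Finset.eq_empty_iff_forall_notMem]
    intro z hz
    obtain ⟨h1, h2, -⟩ := mem_cuts.1 hz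
    have h3 : z.1.card ≤ (Finset.Ioo 0 N).card :=
      Finset.card_le_card fun x hx => Finset.mem_Ioo.2 ⟨h1.pos x hx, h1.lt x hx⟩
    rw [Nat.card_Ioo] at h3
    omega

/-- The split into one, two, and at least three blocks matches the three sums of `R(n, k)`.
Extending the range from `M` to `n` adds only zeros. -/
theorem sum_range_cutNumber {M n : ℕ} (K : ℕ) (f : ℕ → ℚ) (hM : M ≤ n) (hn : 2 ≤ n) :
    ∑ r ∈ Finset.range M, f r * cutNumber True r M K =
      f 0 * cutNumber True 0 M K + (f 1 * cutNumber True 1 M K +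
        ∑ r ∈ Finset.Ico 2 n, f r * cutNumber True r M K) := by
  rw [Finset.sum_subset (Finset.range_subset_range.2 hM), Finset.range_eq_Ico,
    Finset.sum_eq_sum_Ico_succ_bot (by omega), Finset.sum_eq_sum_Ico_succ_bot (by omega)]
  intro r _ hr
  rw [cutNumber_eq_zero_of_le (by simpa using hr), Nat.cast_zero, mul_zero]

theorem sum_markedIndex_weighted {d : ℕ} (hd : 0 < d) (M K : ℕ) (w : ℚ) :
    ∑ r ∈ Finset.Icc 3 (d * M), ∑ p ∈ markedIndex (d * M) (d * K) d r,
        w / (2 * d * r) * ∏ i, A ((p.1 i : ℚ) + 1) (p.2 i) =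
      ∑ r ∈ Finset.Ico 2 (d * M), w / (2 * d * (r + 1)) * cutNumber True r M K := by
  rw [← Finset.Ico_add_one_right_eq_Icc, ← Finset.sum_Ico_add' _ 2 (d * M) 1]
  refine Finset.sum_congr rfl fun r _ => ?_
  rw [← Finset.mul_sum, sum_markedIndex hd]
  push_cast
  rfl

theorem A_div_sub_one_eq_zero {x : ℚ} {d k : ℕ} (hd : 0 < d) (h : ¬ d ∣ k) :
    A x ((k : ℚ) / d - 1) = 0 := by
  refine A_eq_zero_of_right fun y hy => h ⟨y + 1, ?_⟩
  have hd' : (d : ℚ) ≠ 0 := by exact_mod_cast hd.ne'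
  have : (k : ℚ) = (d * (y + 1) : ℕ) := by
    push_cast
    rw [← hy]
    field_simp
    ring
  exact_mod_cast this

/-- The case `M = 1`, `L = 0` must be excluded: a segment of length `1` carries no arc, whereas
`A^2_0 = 1`. -/
theorem cutNumber_true_zero_succ_eq_A {M : ℕ} (L : ℕ) (h : M = 1 → L ≠ 0) (hM : 0 < M) :
    (cutNumber True 0 M (L + 1) : ℚ) = A ((M : ℚ) + 1) L := by
  rw [A_natCast_succ L hM]
  rcases Nat.lt_or_ge 1 M with hM' | hM'
  · rw [cutNumber_true_zero hM', if_neg (by omega), Nat.add_sub_cancel]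
  · obtain rfl : M = 1 := by omega
    rw [cutNumber_zero_one, card_arcSystems_one, if_neg (by omega), if_neg (h rfl)]

/-- For `M = 2` the two blocks have length `1` and carry no arcs, so the count is `0`, while the
closed formula would see `A^2_0 = 1`. This is why the second sum of `R(n, k)` stops at `n / 3`. -/
theorem cutNumber_true_one_eq_A {M : ℕ} (L : ℕ) (hM : 0 < M) :
    (cutNumber True 1 M (L + 1) : ℚ) =
      if 3 ≤ M then 2 * (M + L) / M * A M L else 0 := by
  split_ifs with h
  · obtain ⟨m, rfl⟩ := Nat.exists_eq_add_of_le' hM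
    have h1 := cutNumber_true_one m L (by omega)
    have h2 : ((m : ℚ) + 1) * cutNumber True 1 (m + 1) (L + 1) =
        2 * (m + 1 + L) * (arcSystems m L).card := by exact_mod_cast h1
    have h3 : (m : ℚ) + 1 ≠ 0 := by positivity
    push_cast
    rw [A_natCast_succ L (by omega)]
    field_simp
    linear_combination h2
  · rw [Nat.cast_eq_zero]
    rcases Nat.lt_or_ge 1 M with hM' | hM'
    · obtain rfl : M = 2 := by omega
      rw [cutNumber_succ, Finset.sum_eq_zero]
      rintro ⟨a, b⟩ hab
      rw [Finset.HasAntidiagonal.mem_antidiagonal] at hab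
      refine Finset.sum_eq_zero ?_
      rintro ⟨x, y⟩ hxy
      rw [Finset.HasAntidiagonal.mem_antidiagonal] at hxy
      dsimp only at hab hxy ⊢
      rcases Nat.eq_zero_or_pos a with rfl | ha
      · rw [cutNumber_zero_left, zero_mul]
      · rcases Nat.eq_zero_or_pos b with rfl | hb
        · rw [cutNumber_zero_left, mul_zero]
        · obtain rfl : a = 1 := by omega
          obtain rfl : b = 1 := by omega
          rw [cutNumber_zero_one, cutNumber_zero_one]
          split_ifs <;> omega
    · exact cutNumber_eq_zero_of_le hM'

/-- The contribution of the rotations of order `d` to Burnside's formula. -/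
theorem totient_mul_card_rotFixed {n k d : ℕ} [NeZero n] (hk : 1 ≤ k) (hkn : k + 3 ≤ n)
    (hd : 2 ≤ d) (hdn : d ∣ n) :
    (d.totient : ℚ) * (rotFixed n k ((n / d : ℕ) : ZMod n)).card / (2 * n) =
      (if 3 ≤ d then (d.totient : ℚ) / (2 * d) * A (n / d + 1) (k / d - 1) else 0) +
      (if d ≤ n / 3 then (d.totient : ℚ) * (n + k - d) / (2 * d * n) * A (n / d) (k / d - 1)
        else 0) +
      ∑ r ∈ Finset.Icc 3 n, ∑ p ∈ markedIndex n k d r,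
        (d.totient : ℚ) / (2 * d * r) * ∏ i, A ((p.1 i : ℚ) + 1) (p.2 i) +
      (if d = 2 then 1 / 4 * A (n / 2 + 1) ((k - 1) / 2) else 0) := by
  obtain ⟨M, hn⟩ := hdn
  have hM0 : 0 < M := Nat.pos_of_ne_zero fun h => by subst h; omega
  have hdQ : (d : ℚ) ≠ 0 := by
    have : d ≠ 0 := by omega
    exact_mod_cast this
  have hMQ : (M : ℚ) ≠ 0 := by exact_mod_cast hM0.ne'
  have hnQ : (n : ℚ) = d * M := by exact_mod_cast hn
  have hnd : n / d = M := by rw [hn, Nat.mul_div_cancel_left _ (by omega)]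
  have hndQ : (n : ℚ) / d = M := by rw [hnQ, mul_div_cancel_left₀ _ hdQ]
  have hMn : M ≤ n := by rw [hn]; exact Nat.le_mul_of_pos_left _ (by omega)
  rw [hnd, hndQ]
  by_cases hdk : d ∣ k
  · obtain ⟨K, rfl⟩ := hdk
    have hK0 : 0 < K := Nat.pos_of_ne_zero fun h => by subst h; omega
    obtain ⟨L, rfl⟩ := Nat.exists_eq_add_of_le' hK0
    have hkd : ((d * (L + 1) : ℕ) : ℚ) / d - 1 = L := by
      push_cast
      rw [mul_div_cancel_left₀ _ hdQ]
      ring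
    -- `M = 1` and `L = 0` would give `k = d = n`, against `k + 3 ≤ n`.
    have hM1 : M = 1 → L ≠ 0 := by
      rintro rfl rfl
      omega
    have h3 := sum_markedIndex_weighted (d := d) (by omega) M (L + 1) d.totient
    rw [← hn] at h3
    have hle : d ≤ n / 3 ↔ 3 ≤ M := by
      rw [Nat.le_div_iff_mul_le (by omega), hn]
      exact Nat.mul_le_mul_left_iff (by omega)
    have hT2 : (if d ≤ n / 3 then (d.totient : ℚ) * (n + (d * (L + 1) : ℕ) - d) / (2 * d * n) *
        A M L else 0) = (d.totient : ℚ) / (2 * d) * (1 / 2 * cutNumber True 1 M (L + 1)) := by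
      rw [cutNumber_true_one_eq_A L hM0]
      simp only [hle]
      split_ifs
      · rw [hnQ]
        push_cast
        field_simp
        ring
      · ring
    rw [hkd, hT2, h3, ← cutNumber_true_zero_succ_eq_A L hM1 hM0]
    have hsum : ∑ r ∈ Finset.Ico 2 n, (d.totient : ℚ) / (2 * d * (r + 1)) *
        cutNumber True r M (L + 1) = (d.totient : ℚ) / (2 * n) *
          ∑ r ∈ Finset.Ico 2 n, (M : ℚ) / (r + 1) * cutNumber True r M (L + 1) := by
      rw [Finset.mul_sum]
      refine Finset.sum_congr rfl fun r _ => ?_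
      have : (r : ℚ) + 1 ≠ 0 := by positivity
      rw [hnQ]
      field_simp
    rw [hsum]
    rcases eq_or_lt_of_le hd with rfl | hd3
    -- For `d = 2` and even `k` there is no diameter: the extra term vanishes because its lower
    -- index is not an integer.
    · have hA : A ((n : ℚ) / 2 + 1) ((((2 * (L + 1) : ℕ) : ℚ) - 1) / 2) = 0 := by
        refine A_eq_zero_of_right fun y hy => ?_
        have : ((2 * (L + 1) : ℕ) : ℚ) = (2 * y + 1 : ℕ) := by
          push_cast at hy ⊢
          linarith
        have : 2 * (L + 1) = 2 * y + 1 := by exact_mod_cast this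
        omega
      rw [if_neg (by omega), if_pos rfl, hA, card_rotFixed_two_even (L + 1) hn (by omega),
        sum_range_cutNumber (L + 1) _ hMn (by omega), if_pos rfl, if_neg one_ne_zero]
      have hs : ∑ r ∈ Finset.Ico 2 n, (if r = 0 then (0 : ℚ) else (M : ℚ) / (r + 1)) *
          cutNumber True r M (L + 1) =
            ∑ r ∈ Finset.Ico 2 n, (M : ℚ) / (r + 1) * cutNumber True r M (L + 1) := by
        refine Finset.sum_congr rfl fun r hr => ?_
        have := (Finset.mem_Ico.1 hr).1
        rw [if_neg (by omega)]
      rw [hs, hnQ]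
      push_cast
      field_simp
      ring
    · rw [if_pos (show 3 ≤ d from hd3), if_neg (by omega), card_rotFixed_mul (L + 1) hn hd3,
        sum_range_cutNumber (L + 1) (fun r => (M : ℚ) / (r + 1)) hMn (by omega), hnQ]
      push_cast
      field_simp
      ring
  · have hz : ∀ r, markedIndex n k d r = ∅ := fun r => markedIndex_eq_empty_of_not_dvd hdk
    simp only [A_div_sub_one_eq_zero (show 0 < d by omega) hdk, hz, Finset.sum_empty,
      Finset.sum_const_zero, mul_zero, ite_self, add_zero, zero_add]
    rcases eq_or_lt_of_le hd with rfl | hd3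
    · obtain ⟨K, rfl | rfl⟩ := Nat.even_or_odd' k
      · exact absurd ⟨K, rfl⟩ hdk
      · have h1 : (((2 * K + 1 : ℕ) : ℚ) - 1) / 2 = K := by
          push_cast
          ring
        have h2 : (n : ℚ) / 2 = M := by rw [← hndQ, Nat.cast_ofNat]
        rw [if_pos rfl, card_rotFixed_two_odd K hn (by omega), h1, h2, A_natCast_succ K hM0, hnQ,
          Nat.totient_two]
        push_cast
        field_simp
        ring
    · rw [if_neg (by omega), card_rotFixed_eq_zero hn hd3 hdk]
      simp

theorem card_rotFixed_self (n k : ℕ) [NeZero n] (hn : 2 ≤ n) :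
    ((rotFixed n k ((n / 1 : ℕ) : ZMod n)).card : ℚ) = A n k := by
  have h : rotFixed n k ((n / 1 : ℕ) : ZMod n) = dissections n k := by
    ext E
    rw [mem_rotFixed, mem_dissections, Nat.div_one, ZMod.natCast_self, ← DihedralGroup.one_def,
      move_one]
    exact and_iff_left rfl
  rw [h]
  obtain ⟨m, rfl⟩ := Nat.exists_eq_add_of_le' (show 1 ≤ n by omega)
  rw [card_dissections_succ]
  push_cast
  rw [A_natCast_succ k (by omega)]

/-- The contribution of all rotations to Burnside's formula. -/
theorem sum_card_rotFixed_eq {n k : ℕ} [NeZero n] (hk : 1 ≤ k) (hkn : k + 3 ≤ n) :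
    (∑ i : ZMod n, ((rotFixed n k i).card : ℚ)) / (2 * n) =
      1 / (2 * n) * A n k
      + ∑ d ∈ n.divisors with 3 ≤ d, (d.totient : ℚ) / (2 * d) * A (n / d + 1) (k / d - 1)
      + ∑ d ∈ Finset.Icc 2 (n / 3),
          (d.totient : ℚ) * (n + k - d) / (2 * d * n) * A (n / d) (k / d - 1)
      + ∑ d ∈ n.divisors with 2 ≤ d, ∑ r ∈ Finset.Icc 3 n, ∑ p ∈ markedIndex n k d r,
          (d.totient : ℚ) / (2 * d * r) * ∏ i, A ((p.1 i : ℚ) + 1) (p.2 i)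
      + (if Even n then 1 / 4 * A (n / 2 + 1) ((k - 1) / 2) else 0) := by
  have hn0 : n ≠ 0 := NeZero.ne n
  have h1 : ∑ i : ZMod n, ((rotFixed n k i).card : ℚ) =
      ∑ d ∈ n.divisors, (d.totient : ℚ) * (rotFixed n k ((n / d : ℕ) : ZMod n)).card := by
    exact_mod_cast sum_card_rotFixed n k
  have hdiv : n.divisors = insert 1 (n.divisors.filter fun d => 2 ≤ d) := by
    ext d
    rw [Finset.mem_insert, Finset.mem_filter, Nat.mem_divisors]
    constructor
    · rintro ⟨h2, -⟩
      have := Nat.pos_of_dvd_of_pos h2 (by omega)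
      rcases eq_or_ne d 1 with h | h
      · exact Or.inl h
      · exact Or.inr ⟨⟨h2, hn0⟩, by omega⟩
    · rintro (rfl | h)
      · exact ⟨one_dvd n, hn0⟩
      · exact h.1
  have h2 : ∑ d ∈ n.divisors with 2 ≤ d,
      (d.totient : ℚ) * (rotFixed n k ((n / d : ℕ) : ZMod n)).card / (2 * n) = _ :=
    Finset.sum_congr rfl fun d hd => totient_mul_card_rotFixed hk hkn (Finset.mem_filter.1 hd).2
      (Nat.dvd_of_mem_divisors (Finset.mem_filter.1 hd).1)
  rw [h1, hdiv, Finset.sum_insert (by simp), add_div, Finset.sum_div, ← hdiv, h2,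
    card_rotFixed_self n k (by omega), Finset.sum_add_distrib, Finset.sum_add_distrib,
    Finset.sum_add_distrib, Nat.totient_one]
  have h3 : ∑ d ∈ n.divisors with 2 ≤ d, (if 3 ≤ d then
      (d.totient : ℚ) / (2 * d) * A (n / d + 1) (k / d - 1) else 0) =
      ∑ d ∈ n.divisors with 3 ≤ d, (d.totient : ℚ) / (2 * d) * A (n / d + 1) (k / d - 1) := by
    rw [← Finset.sum_filter, Finset.filter_filter]
    exact Finset.sum_congr (Finset.filter_congr fun d _ => by omega) fun _ _ => rfl
  have h4 : ∑ d ∈ n.divisors with 2 ≤ d, (if d ≤ n / 3 then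
      (d.totient : ℚ) * (n + k - d) / (2 * d * n) * A (n / d) (k / d - 1) else 0) =
      ∑ d ∈ Finset.Icc 2 (n / 3),
        (d.totient : ℚ) * (n + k - d) / (2 * d * n) * A (n / d) (k / d - 1) := by
    rw [← Finset.sum_filter, Finset.filter_filter]
    refine Finset.sum_subset (fun d hd => ?_) fun d hd hd' => ?_
    · exact Finset.mem_Icc.2 (Finset.mem_filter.1 hd).2
    -- The second sum runs over all `d ≤ n / 3`, but for `d` not dividing `n` the upper index `n /
    -- d` is not an integer and `A` is `0`.
    · rw [A_eq_zero_of_left, mul_zero]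
      intro y hy
      have h2d := (Finset.mem_Icc.1 hd).1
      have hdQ : (d : ℚ) ≠ 0 := by
        have : d ≠ 0 := by omega
        exact_mod_cast this
      refine hd' (Finset.mem_filter.2 ⟨Nat.mem_divisors.2 ⟨⟨y, ?_⟩, hn0⟩, Finset.mem_Icc.1 hd⟩)
      rw [div_eq_iff hdQ] at hy
      have : n = y * d := by exact_mod_cast hy
      rw [this, mul_comm]
  have h5 : ∑ d ∈ n.divisors with 2 ≤ d, (if d = 2 then
      1 / 4 * A ((n : ℚ) / 2 + 1) (((k : ℚ) - 1) / 2) else 0) =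
      if Even n then 1 / 4 * A ((n : ℚ) / 2 + 1) (((k : ℚ) - 1) / 2) else 0 := by
    rw [Finset.sum_ite_eq']
    refine if_congr ?_ rfl rfl
    rw [Finset.mem_filter, Nat.mem_divisors, even_iff_two_dvd]
    exact ⟨fun h => h.1.1, fun h => ⟨⟨h, hn0⟩, le_rfl⟩⟩
  rw [h3, h4, h5]
  push_cast
  ring

end PolygonDissection

/-! ### Assembly of the rotation and reflection parts -/

theorem theorem6 (n k : ℕ) [NeZero n] (hk : 1 ≤ k) (hkn : k + 3 ≤ n) :
    (Even n →
      (PolygonDissection.numDihedralClasses n k : ℚ) =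
        1 / (2 * n) * PolygonDissection.A n k
        + 1 / 2 * PolygonDissection.A (n / 2 + 1) ((k - 1) / 2)
        + 1 / 4 * PolygonDissection.A (n / 2 + 1) (k / 2)
        + ∑ d ∈ n.divisors with 3 ≤ d,
            (d.totient : ℚ) / (2 * d) * PolygonDissection.A (n / d + 1) (k / d - 1)
        + ∑ d ∈ Finset.Icc 2 (n / 3),
            (d.totient : ℚ) * (n + k - d) / (2 * d * n)
              * PolygonDissection.A (n / d) (k / d - 1)
        + ∑ d ∈ n.divisors with 2 ≤ d, ∑ r ∈ Finset.Icc 3 n,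
            ∑ p ∈ PolygonDissection.markedIndex n k d r,
              (d.totient : ℚ) / (2 * d * r)
                * ∏ i, PolygonDissection.A ((p.1 i : ℚ) + 1) (p.2 i)
        + 1 / 4 * ∑ t ∈ Finset.Icc 1 k, PolygonDissection.axialSum (n / 2) k t
        + 1 / 4 * ∑ t ∈ Finset.Icc 0 k, PolygonDissection.axialSum (n / 2 - 1) k t) ∧
    (Odd n →
      (PolygonDissection.numDihedralClasses n k : ℚ) =
        1 / (2 * n) * PolygonDissection.A n k
        + ∑ d ∈ n.divisors with 3 ≤ d,
            (d.totient : ℚ) / (2 * d) * PolygonDissection.A (n / d + 1) (k / d - 1)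
        + ∑ d ∈ Finset.Icc 2 (n / 3),
            (d.totient : ℚ) * (n + k - d) / (2 * d * n)
              * PolygonDissection.A (n / d) (k / d - 1)
        + ∑ d ∈ n.divisors with 2 ≤ d, ∑ r ∈ Finset.Icc 3 n,
            ∑ p ∈ PolygonDissection.markedIndex n k d r,
              (d.totient : ℚ) / (2 * d * r)
                * ∏ i, PolygonDissection.A ((p.1 i : ℚ) + 1) (p.2 i)
        + 1 / 2 * ∑ t ∈ Finset.Icc 0 k, PolygonDissection.axialSum ((n - 1) / 2) k t) := by
  have hn : (2 * n : ℚ) ≠ 0 := by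
    have : n ≠ 0 := by omega
    exact_mod_cast (by omega : 2 * n ≠ 0)
  have hB := PolygonDissection.numDihedralClasses_eq n k
  have hR := PolygonDissection.sum_card_rotFixed_eq hk hkn
  have hN : (PolygonDissection.numDihedralClasses n k : ℚ) =
      (∑ i : ZMod n, ((PolygonDissection.rotFixed n k i).card : ℚ)) / (2 * n) +
        (∑ i : ZMod n, ((PolygonDissection.refFixed n k i).card : ℚ)) / (2 * n) := by
    rw [← add_div, ← hB, mul_div_cancel_right₀ _ hn]
  have hn' : (n : ℚ) ≠ 0 := fun h => hn (by rw [h, mul_zero])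
  have hhalf : ∀ x : ℚ, n * x / (2 * n) = 1 / 2 * x := fun x => by field_simp
  have hquarter : ∀ x y : ℚ, (n / 2 * x + n / 2 * y) / (2 * n) = 1 / 4 * x + 1 / 4 * y :=
    fun x y => by
      field_simp
      ring
  rw [hN, hR]
  constructor
  · intro heven
    obtain ⟨N, hN2⟩ := even_iff_two_dvd.1 heven
    have hS : ∑ i : ZMod n, ((PolygonDissection.refFixed n k i).card : ℚ) =
        N * (PolygonDissection.refFixed n k 0).card +
          N * (PolygonDissection.refFixed n k 1).card := by
      exact_mod_cast PolygonDissection.sum_card_refFixed_even k hN2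
    have hNQ : (N : ℚ) = n / 2 := by
      rw [hN2]
      push_cast
      ring
    rw [hS, PolygonDissection.card_refFixed_zero k hN2 (by omega),
      PolygonDissection.card_refFixed_one k (by omega), if_pos heven, hNQ,
      show (n - 1) / 2 = n / 2 - 1 by omega, show N = n / 2 by omega, hquarter]
    -- The coefficient `1/2` of `A^{n/2+1}_{(k-1)/2}` is `1/4` from the half-turn plus `1/4` from
    -- the reflections whose axis contains a diameter.
    linarith
  · intro hodd
    have hS : ∑ i : ZMod n, ((PolygonDissection.refFixed n k i).card : ℚ) =
        n * (PolygonDissection.refFixed n k 1).card := by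
      exact_mod_cast PolygonDissection.sum_card_refFixed_odd k hodd
    rw [hS, PolygonDissection.card_refFixed_one k (by omega),
      if_neg (Nat.not_even_iff_odd.2 hodd), hhalf, add_zero]
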